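/- **Setting.** Zimin words: $Z_0=\epsilon$ and $Z_k=Z_{k-1}\,k\,Z_{k-1}$. A ranked pattern is a nonempty word $\pi$ of length $n$ with exactly $m$ distinct variables, together with a ranking function $R$ from the variables to $\{1,\dots,k\}$. An *instance* of it in $Z_k$ is a valuation $h$ of the variables by words such that $h(\pi)$ is a factor of $Z_k$ and, for each variable $x$, the maximal letter of $h(x)$ is $R(x)$. It is *shortest* if $|h(\pi)|$ is minimal among all instances in $Z_k$. For a word $u$, $\mathrm{compress}(u)$ is obtained by deleting every element that has a larger element both somewhere to its left and somewhere to its right. Let $\pi_{(i)}$ be $\pi$ with the variables of rank less than $i$ removed, let $\mathcal V_i$ be the set of variables of rank $i$, and let $K$ be the maximal rank. The adjacency graph $AG(w)$ of a word $w$ of variables has two vertices $x^L,x^R$ for each variable $x$ occurring in $w$, and an edge $x^Ly^R$ whenever $xy$ is a factor of $w$. Its vertices receive values $0,1$; $x^L=1$ means that the value of $x$ ends with the current letter, and $x^R=1$ that it starts with it. The operation $valuate(a,b)$ fails if the vertex $a$ already has the value $1-b$; otherwise it gives the value $b$ to all vertices of the connected component of $a$ lying in the same part ($L$ or $R$) as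 $a$, and $1-b$ to the vertices of this component in the other part. $ShortestFirstLast(w,W)$: for each $x\in W$ perform $valuate(x^L,1)$ and $valuate(x^R,1)$ (if one of these fails, the whole procedure fails); then, if $v$ is the first variable of $w$ and $v^R$ has no value, perform $valuate(v^R,0)$; then, if $u$ is the last variable of $w$ and $u^L$ has no value, perform $valuate(u^L,0)$; then perform $valuate(x^L,0)$ for every $x^L$ that has no value. $Compressed\text{-}Embedding$ with $ShortestFirstLast$: fail unless exactly one position of $\pi$ carries a variable of rank $K$; give that variable the value $K$. For $i=K-1,\dots,1$ run $ShortestFirstLast(\pi_{(i)},\mathcal V_i)$ (if it fails, fail); give each variable of rank $i$ the value $i$, and for each variable $x$ of rank larger than $i$ insert the letter $i$ at the beginning of the value of $x$ if $x^R=1$, and at its end if $x^L=1$. Let $l$ be the sum, over $1\le i<K$, of the number of connected components of $AG(\pi_{(i)})$ that contain no copy of a variable of rank $i$ (the components left unvaluated after the newly added variables have been valuated). **Theorem.** For every $k\ge 1$ and every ranked pattern with ranks in $\{1,\dots,k\}$: 1. $Compressed\text{-}Embedding$ with $ShortestFirstLast$ fails if and only if the ranked pattern has no instance in $Z_k$.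 If it does not fail, the valuation that it returns is $x\mapsto \mathrm{compress}(h(x))$ for some shortest instance $h$ in $Z_k$. 2. If there is an instance in $Z_k$, then the number of instances in $Z_k$ is exactly $2^l$. 3. There are a single random access machine program and a constant $C$ such that, for every $k$ and every ranked pattern with ranks in $\{1,\dots,k\}$, the program, given $(\pi,R,k)$, outputs both the compressed shortest instance returned by the above algorithm (or the information that there is no instance) and the number of instances in $Z_k$, written in binary. It does so within $C\,nk$ steps and using a memory of $C\,(n+mk)$ words, each holding a nonnegative integer smaller than $C\,(n+mk)$. In particular, the time is $O(n\cdot k)$ and simultaneously, if the number $m$ of variables is at most $k$, the space is $O(n+k^2)$. -/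

import Mathlib

namespace ZiminMatching

/-! ### Zimin words, compressed factors, ranked patterns and their instances -/

/-- Zimin words: `Z_0` is empty, `Z_1 = 1` and `Z_k = Z_{k-1} k Z_{k-1}`. -/
def zimin : ℕ → List ℕ
  | 0 => []
  | k + 1 => zimin k ++ (k + 1) :: zimin k

/-- Scan the word `pre ++ u` from the beginning of `u` on; an element is dropped if it has a larger
element somewhere to its left and a larger element somewhere to its right. -/
def compressFrom : List ℕ → List ℕ → List ℕ
  | _, [] => []
  | pre, a :: u =>
      if (∃ s ∈ pre, a < s) ∧ (∃ t ∈ u, a < t) then compressFrom (pre ++ [a]) u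
      else a :: compressFrom (pre ++ [a]) u

/-- The compressed representation of a word. -/
def compress (u : List ℕ) : List ℕ := compressFrom [] u

/-- A ranked pattern with exactly `m` distinct variables (named by `Fin m`): a nonempty word in which
every variable occurs, and a ranking function with positive values. -/
structure RankedPattern (m : ℕ) where
  pat : List (Fin m)
  rank : Fin m → ℕ
  pat_ne_nil : pat ≠ []
  occurs : ∀ x, x ∈ pat
  rank_pos : ∀ x, 1 ≤ rank x

namespace RankedPattern

variable {m : ℕ} (P : RankedPattern m)

/-- The image of the pattern under the morphism given by `h` on the variables. -/
def image (h : Fin m → List ℕ) : List ℕ := P.pat.flatMap h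

/-- `h` is an instance in `Z_k`: the image of the pattern is a factor of `Z_k`, and the maximal
letter of `h x` is the given rank of `x` (so no `h x` is empty). -/
def IsInstance (k : ℕ) (h : Fin m → List ℕ) : Prop :=
  P.image h <:+: zimin k ∧ ∀ x, IsGreatest {a | a ∈ h x} (P.rank x)

/-- The set of all instances (valuations) of the ranked pattern in `Z_k`. -/
def instances (k : ℕ) : Set (Fin m → List ℕ) := {h | P.IsInstance k h}

/-- An instance whose image of the pattern is as short as possible. -/
def IsShortestInstance (k : ℕ) (h : Fin m → List ℕ) : Prop :=
  P.IsInstance k h ∧ ∀ g, P.IsInstance k g → (P.image h).length ≤ (P.image g).length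

/-- The maximal rank of a variable. -/
def maxRank : ℕ := Finset.univ.sup P.rank

/-- The pattern `π_(i)`: the variables of rank smaller than `i` are removed. -/
def restrict (i : ℕ) : List (Fin m) := P.pat.filter (fun x => i ≤ P.rank x)

end RankedPattern

/-! ### The adjacency graph and `ShortestFirstLast` -/

/-- Vertices of the adjacency graph of `w`: two copies `x^L` (`Sum.inl x`) and `x^R` (`Sum.inr x`) of
every variable `x` occurring in `w`. -/
abbrev Vertex {V : Type} (w : List V) : Type := {x // x ∈ w} ⊕ {x // x ∈ w}

/-- The adjacency graph: `x^L` and `y^R` are joined iff `xy` is a factor of `w`. -/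
def adjGraph {V : Type} (w : List V) : SimpleGraph (Vertex w) :=
  SimpleGraph.fromRel fun a b => ∃ x y, a = Sum.inl x ∧ b = Sum.inr y ∧ [x.1, y.1] <:+: w

/-- A partial 0/1-valuation of the vertices. The value of `x^L` says whether the value of `x` ends
with the current letter, the value of `x^R` whether it starts with the current letter. -/
abbrev PartialVal {V : Type} (w : List V) : Type := Vertex w → Option Bool

open Classical in
/-- `valuate(a, b)`: fail if `a` already has the value different from `b`; otherwise give the value
`b` to all vertices of the connected component of `a` in the same part of the bipartition as `a`, and
the opposite value to those in the other part. -/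
noncomputable def valuate {V : Type} {w : List V} (p : PartialVal w) (a : Vertex w) (b : Bool) :
    Option (PartialVal w) :=
  if p a = some (!b) then none
  else some fun c =>
    if (adjGraph w).Reachable a c then some (if a.isLeft = c.isLeft then b else !b) else p c

/-- If `a` has no value then `valuate(a, 0)`. -/
noncomputable def valuateIfUnset {V : Type} {w : List V} (p : PartialVal w) (a : Vertex w) :
    Option (PartialVal w) :=
  if p a = none then valuate p a false else some p

/-- The first loop: `valuate(x^L, 1)` and `valuate(x^R, 1)` for every `x ∈ W`. -/
noncomputable def valuateNew {V : Type} (w : List V) (W : V → Prop) [DecidablePred W] :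
    Option (PartialVal w) :=
  (w.attach.filter (fun x => W x.1)).foldlM
    (fun p x => (valuate p (Sum.inl x) true).bind fun q => valuate q (Sum.inr x) true)
    (fun _ => none)

/-- `ShortestFirstLast(w, W)`: after the first loop, the first variable does not start with the
current letter and the last variable does not end with it, if these are still undecided (in this
order); then every `x^L` that has no value is set to `0`. -/
noncomputable def shortestFirstLast {V : Type} (w : List V) (W : V → Prop) [DecidablePred W] :
    Option (PartialVal w) :=
  (valuateNew w W).bind fun p =>
    (w.attach.head?.toList.map Sum.inr ++ w.attach.getLast?.toList.map Sum.inl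
      ++ w.attach.map Sum.inl).foldlM valuateIfUnset p

/-! ### `Compressed-Embedding` with `ShortestFirstLast` -/

/-- Insert the letter `i` at the beginning if the word does not already begin with `i`. -/
def firstInsert (i : ℕ) (u : List ℕ) : List ℕ := if u.head? = some i then u else i :: u

/-- Insert the letter `i` at the end if the word does not already end with `i`. -/
def lastInsert (i : ℕ) (u : List ℕ) : List ℕ := if u.getLast? = some i then u else u ++ [i]

namespace RankedPattern

variable {m : ℕ} (P : RankedPattern m)

/-- Step `i`: the variables of rank `i` get the value `i`; the letter `i` is inserted at the ends of
the values of the variables of larger rank as `ShortestFirstLast(π_(i), V_i)` says. -/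
noncomputable def embeddingStep (val : Fin m → List ℕ) (i : ℕ) : Option (Fin m → List ℕ) :=
  (shortestFirstLast (P.restrict i) (fun x => P.rank x = i)).map fun p x =>
    if P.rank x = i then [i]
    else if hx : x ∈ P.restrict i then
      let u := if p (Sum.inr ⟨x, hx⟩) = some true then firstInsert i (val x) else val x
      if p (Sum.inl ⟨x, hx⟩) = some true then lastInsert i u else u
    else val x

/-- `Compressed-Embedding` with `ShortestFirstLast`: with `K` the maximal rank, fail unless exactly
one position of the pattern has rank `K`; give the value `K` to that variable, and then perform the
steps `K - 1, …, 1`. -/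
noncomputable def compressedEmbedding : Option (Fin m → List ℕ) :=
  if (P.restrict P.maxRank).length = 1 then
    (List.range' 1 (P.maxRank - 1)).reverse.foldlM P.embeddingStep
      (fun x => if P.rank x = P.maxRank then [P.maxRank] else [])
  else none

/-- The number of connected components of the adjacency graph of `π_(i)` that are left without value
once the vertices of the newly added variables (those of rank `i`) have been valuated, that is, of
those components which contain no copy of a variable of rank `i`. -/
noncomputable def unvaluated (i : ℕ) : ℕ :=
  Nat.card {c : (adjGraph (P.restrict i)).ConnectedComponent //
    ∀ x : {x // x ∈ P.restrict i}, P.rank x.1 = i →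
      Sum.inl x ∉ c.supp ∧ Sum.inr x ∉ c.supp}

/-- The total number of unvaluated components over all steps `1 ≤ i < K`. -/
noncomputable def totalUnvaluated : ℕ := ∑ i ∈ Finset.Ico 1 P.maxRank, P.unvaluated i

end RankedPattern

/-! ### Random access machines

Programs are structured programs over finitely many registers and a memory of `B` words, each word
holding a natural number smaller than `B`. Every assignment, load, store and test costs one unit of
time; the arithmetical expressions in a program involve registers only, and have a fixed size, since
the program does not depend on the input. -/

/-- Arithmetical expressions over registers (`sub` is truncated subtraction). -/
inductive Expr : Type
  | lit (c : ℕ) : Expr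
  | reg (r : ℕ) : Expr
  | add (e₁ e₂ : Expr) : Expr
  | sub (e₁ e₂ : Expr) : Expr
  | mul (e₁ e₂ : Expr) : Expr

/-- The value of an expression for given contents of the registers. -/
def Expr.eval (ρ : ℕ → ℕ) : Expr → ℕ
  | .lit c => c
  | .reg r => ρ r
  | .add e₁ e₂ => e₁.eval ρ + e₂.eval ρ
  | .sub e₁ e₂ => e₁.eval ρ - e₂.eval ρ
  | .mul e₁ e₂ => e₁.eval ρ * e₂.eval ρ

/-- Programs. -/
inductive Prog : Type
  | skip : Prog
  | assign (r : ℕ) (e : Expr) : Prog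
  | load (r : ℕ) (a : Expr) : Prog
  | store (a e : Expr) : Prog
  | seq (c d : Prog) : Prog
  | ifNonzero (e : Expr) (c d : Prog) : Prog
  | whileNonzero (e : Expr) (c : Prog) : Prog

/-- Contents of the registers and of the memory. -/
structure State : Type where
  reg : ℕ → ℕ
  mem : ℕ → ℕ

/-- `Exec B c s t s'`: on a machine with `B` memory words (addresses smaller than `B`) which hold
numbers smaller than `B`, the program `c` started in `s` halts after `t` steps in `s'`. There is no
such `t` and `s'` if the program does not halt, uses an address `≥ B`, or produces a number `≥ B`. -/
inductive Exec (B : ℕ) : Prog → State → ℕ → State → Prop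
  | skip (s : State) : Exec B .skip s 0 s
  | assign (r : ℕ) (e : Expr) (s : State) (hv : e.eval s.reg < B) :
      Exec B (.assign r e) s 1 ⟨Function.update s.reg r (e.eval s.reg), s.mem⟩
  | load (r : ℕ) (a : Expr) (s : State) (ha : a.eval s.reg < B) :
      Exec B (.load r a) s 1 ⟨Function.update s.reg r (s.mem (a.eval s.reg)), s.mem⟩
  | store (a e : Expr) (s : State) (ha : a.eval s.reg < B) (hv : e.eval s.reg < B) :
      Exec B (.store a e) s 1 ⟨s.reg, Function.update s.mem (a.eval s.reg) (e.eval s.reg)⟩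
  | seq {c d : Prog} {s₁ s₂ s₃ : State} {t₁ t₂ : ℕ} (h₁ : Exec B c s₁ t₁ s₂)
      (h₂ : Exec B d s₂ t₂ s₃) : Exec B (.seq c d) s₁ (t₁ + t₂) s₃
  | ifTrue {e : Expr} {c d : Prog} {s s' : State} {t : ℕ} (he : e.eval s.reg ≠ 0)
      (h : Exec B c s t s') : Exec B (.ifNonzero e c d) s (t + 1) s'
  | ifFalse {e : Expr} {c d : Prog} {s s' : State} {t : ℕ} (he : e.eval s.reg = 0)
      (h : Exec B d s t s') : Exec B (.ifNonzero e c d) s (t + 1) s'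
  | whileTrue {e : Expr} {c : Prog} {s₁ s₂ s₃ : State} {t₁ t₂ : ℕ} (he : e.eval s₁.reg ≠ 0)
      (h₁ : Exec B c s₁ t₁ s₂) (h₂ : Exec B (.whileNonzero e c) s₂ t₂ s₃) :
      Exec B (.whileNonzero e c) s₁ (t₁ + t₂ + 1) s₃
  | whileFalse {e : Expr} {c : Prog} {s : State} (he : e.eval s.reg = 0) :
      Exec B (.whileNonzero e c) s 1 s

/-- The memory contains the word `u` from address `a` on. -/
def State.Holds (s : State) (a : ℕ) (u : List ℕ) : Prop :=
  ∀ (j : ℕ) (hj : j < u.length), s.mem (a + j) = u[j]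

/-- The initial state: the length `n` of the pattern, the number `m` of variables and `k` in the
registers 0, 1, 2; the ranks of the variables, followed by the pattern, in the memory from address 0
on; and zeros everywhere else. -/
def RankedPattern.input {m : ℕ} (P : RankedPattern m) (k : ℕ) : State where
  reg := fun r => [P.pat.length, m, k].getD r 0
  mem := fun a => (List.ofFn P.rank ++ P.pat.map Fin.val).getD a 0

/-- The final state presents a valuation (or the information that there is none) and a number `N`.
Register 0 tells if there is a valuation. If so, register 1 holds the address of a table with two
entries for each variable: the address and the length of its value. Registers 2 and 3 hold the
address and the length of the binary expansion of `N` (least significant bit first). -/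
def State.Outputs {m : ℕ} (s : State) (val : Option (Fin m → List ℕ)) (N : ℕ) : Prop :=
  (val = none → s.reg 0 = 0) ∧
  (∀ v, val = some v → s.reg 0 = 1 ∧
    ∀ x : Fin m, s.Holds (s.mem (s.reg 1 + 2 * x)) (v x) ∧
      s.mem (s.reg 1 + 2 * x + 1) = (v x).length) ∧
  s.Holds (s.reg 2) (Nat.digits 2 N) ∧ s.reg 3 = (Nat.digits 2 N).length

end ZiminMatching

namespace ZiminMatching

/-! ### Alternating words -/

/-! Deleting from $Z_K$ all letters below $i$ leaves a word in which every second letter, including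
the first and the last, is $i$; deleting these $i$'s as well leaves the corresponding word for $i+1$
(`ziminFrom_eq_pad`). So a word is a factor at level $i$ iff of any two neighbouring letters exactly
one is $i$, and its part without $i$ is a factor at level $i+1$ (`infix_cons_pad_iff`). Instances
can therefore be built level by level, downwards from the maximal rank $K$. Letters above $K$ play
no role (`infix_zimin_iff`), and at level $K$ the word is the single letter $K$: there is one
instance if exactly one position has rank $K$, and none otherwise.

When an instance of level $i+1$ is lifted to level $i$, variables of rank $i$ take the value $i$,
and for the others the only choice is whether their values begin and end with $i$. Label $x^L$ by
"ends with $i$" and $x^R$ by "does not begin with $i$". For a factor $xy$, alternation says that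
$x^L$ and $y^R$ have equal labels. So the admissible choices are the labelings of the connected
components of the adjacency graph in which a new variable forces true on the component of $x^L$ and
false on that of $x^R$. Pairs of such a labeling and an instance of level $i+1$ correspond
bijectively to instances of level $i$ (`levelExtend_mem`, `levelExtend_injOn`,
`exists_eq_levelExtend`). Either two demands collide and nothing survives, or the number of
instances is multiplied by 2 for every component without a new variable (`encard_levelLabels`).

Shortest instances are found greedily. The length of the new image is twice the old length minus 1,
plus one for each end of the image that is $i$ (`length_image_levelExtend`). The set of labelings
does not depend on the instance being lifted, so both contributions can be minimised separately.
`ShortestFirstLast` minimises the second one (`shortestLabel_minimal`): an end carries $i$ only if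
this is forced, or if both ends hang on one free component, where every labeling costs exactly one.
Since compression erases precisely the new letters inside a value (`compress_expand`), the algorithm
may work with compressed values throughout. `LevelCorrect` collects these facts for the induction.

For the running time, the memory is divided into 16 arrays of length $N = 8(n+mk)$. One level
restricts the pattern, links the occurrences of each variable, labels the components by
breadth-first search, marks the components of new variables, and inserts $i$ into deques placed in
disjoint segments of $2k+1$ cells. The search is paid for by a potential that reserves time
proportional to the number of occurrences for every vertex not yet expanded, so a level costs $O(n)$
and all levels $O(nk)$. The number of instances is a power of two, so its binary expansion consists
of zeros and a final one. -/

/-- Insert the letter `i` after every letter of the word. -/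
def pad (i : ℕ) (z : List ℕ) : List ℕ := z.flatMap fun a => [a, i]

/-- Of any two consecutive letters exactly one is `i`. -/
def Alternating (i : ℕ) (u : List ℕ) : Prop := u.IsChain fun a b => (a = i ↔ b ≠ i)

/-- Separate the letters by `i`, and put `i` at the beginning and at the end as told. -/
def expand (i : ℕ) (b₁ b₂ : Bool) (v : List ℕ) : List ℕ :=
  (if b₁ then [i] else []) ++ (v.intersperse i ++ if b₂ then [i] else [])

@[simp] lemma pad_nil (i : ℕ) : pad i [] = [] := rfl

@[simp] lemma pad_cons (i a : ℕ) (z : List ℕ) : pad i (a :: z) = a :: i :: pad i z := rfl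

lemma pad_append (i : ℕ) (y z : List ℕ) : pad i (y ++ z) = pad i y ++ pad i z := by
  simp [pad]

lemma filter_pad {i : ℕ} {z : List ℕ} (hz : i ∉ z) : (pad i z).filter (· ≠ i) = z := by
  induction z with
  | nil => rfl
  | cons a z ih =>
    simp only [List.mem_cons, not_or] at hz
    simp only [pad_cons]
    rw [List.filter_cons_of_pos (by simpa using Ne.symm hz.1),
      List.filter_cons_of_neg (by simp), ih hz.2]

lemma alternating_pad {i : ℕ} {z : List ℕ} (hz : i ∉ z) : Alternating i (i :: pad i z) := by
  induction z with
  | nil => simp [Alternating]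
  | cons a z ih =>
    simp only [List.mem_cons, not_or] at hz
    have := ih hz.2
    unfold Alternating at this ⊢
    simp only [pad_cons, List.isChain_cons_cons, true_iff]
    exact ⟨Ne.symm hz.1, ⟨by simp [Ne.symm hz.1], this⟩⟩

lemma exists_cons_pad (i : ℕ) (z : List ℕ) : ∃ y, i :: pad i z = y ++ [i] := by
  induction z with
  | nil => exact ⟨[], rfl⟩
  | cons a z ih =>
    obtain ⟨y, hy⟩ := ih
    exact ⟨i :: a :: y, by simp [hy]⟩

lemma Alternating.tail {i a : ℕ} {u : List ℕ} (h : Alternating i (a :: u)) : Alternating i u :=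
  List.IsChain.tail h

lemma alternating_cons_cons {i a b : ℕ} {u : List ℕ} :
    Alternating i (a :: b :: u) ↔ (a = i ↔ b ≠ i) ∧ Alternating i (b :: u) :=
  List.isChain_cons_cons

/-- Once it is known whether the word starts with `i`, alternation dictates where all further `i`'s
stand. Removing the first letter exchanges the two cases, so they are proved together. -/
lemma Alternating.prefix_pad {i : ℕ} : ∀ {u : List ℕ}, Alternating i u →
    (u.head? = some i → u <+: i :: pad i (u.filter (· ≠ i))) ∧
    (u.head? ≠ some i → u <+: pad i (u.filter (· ≠ i)))
  | [], _ => by simp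
  | a :: u, h => by
    have ih := h.tail.prefix_pad
    by_cases ha : a = i
    · subst ha
      refine ⟨fun _ => ?_, fun h => by simp at h⟩
      rw [List.filter_cons_of_neg (by simp), List.prefix_cons_inj]
      apply ih.2
      cases u with
      | nil => simp
      | cons b u => simpa using (alternating_cons_cons.1 h).1
    · refine ⟨fun h => by simp [ha] at h, fun _ => ?_⟩
      rw [List.filter_cons_of_pos (by simpa using ha), pad_cons, List.prefix_cons_inj]
      cases u with
      | nil => simp
      | cons b u =>
        have := (alternating_cons_cons.1 h).1
        apply ih.1
        simp only [List.head?_cons, Option.some.injEq]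
        tauto

/-- This is what reduces a level to the next one: the position of a factor is determined by its
letters other than `i`, and the `i`'s needed around them are always available. -/
lemma infix_cons_pad_iff {i : ℕ} {u z : List ℕ} (hz : i ∉ z) :
    u <:+: i :: pad i z ↔ Alternating i u ∧ u.filter (· ≠ i) <:+: z := by
  constructor
  · intro h
    refine ⟨List.IsChain.infix (alternating_pad hz) h, ?_⟩
    have := h.filter (fun a => decide (a ≠ i))
    rwa [List.filter_cons_of_neg (by simp), filter_pad hz] at this
  · rintro ⟨h, s, t, e⟩
    -- The padded part in front of the match ends with `i`; this last `i` is split off, because `u`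
    -- may begin with it.
    obtain ⟨y, hy⟩ := exists_cons_pad i s
    have h₁ : u <+: i :: pad i (u.filter (· ≠ i)) ∨ u <+: pad i (u.filter (· ≠ i)) := by
      by_cases hu : u.head? = some i
      exacts [.inl (h.prefix_pad.1 hu), .inr (h.prefix_pad.2 hu)]
    have h₂ : u <:+: i :: pad i (u.filter (· ≠ i)) := by
      rcases h₁ with h₁ | h₁
      · exact h₁.isInfix
      · exact h₁.isInfix.trans (List.infix_cons List.infix_rfl)
    refine h₂.trans ⟨y, pad i t, ?_⟩
    rw [← e, pad_append, pad_append, ← List.cons_append, ← List.cons_append, hy]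
    simp

/-- A word with q > 0 letters other than `i` has one `i` in each of its q - 1 gaps, and possibly one
more at either end. -/
lemma Alternating.length_eq {i : ℕ} : ∀ {u : List ℕ}, Alternating i u →
    u.filter (· ≠ i) ≠ [] → u.length + 1 = 2 * (u.filter (· ≠ i)).length +
      ((if u.head? = some i then 1 else 0) + if u.getLast? = some i then 1 else 0)
  | [], _, h => by simp at h
  | [a], _, h => by
    by_cases ha : a = i
    · simp [ha] at h
    · simp [ha]
  | a :: b :: u, h, hne => by
    have h' := alternating_cons_cons.1 h
    have ih := h'.2.length_eq
    rw [List.getLast?_cons_cons]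
    by_cases ha : a = i
    · rw [List.filter_cons_of_neg (by simpa using ha)] at hne ⊢
      have := ih hne
      have hb := h'.1.1 ha
      simp only [List.head?_cons, Option.some.injEq, ha, hb, if_true, if_false,
        List.length_cons] at this ⊢
      omega
    · have hb : b = i := by tauto
      subst hb
      rw [List.filter_cons_of_pos (by simpa using ha)]
      by_cases hu : u = []
      · subst hu
        simp [ha]
      · have : (b :: u).filter (· ≠ b) ≠ [] := by
          obtain ⟨c, u, rfl⟩ := List.exists_cons_of_ne_nil hu
          have := (alternating_cons_cons.1 h'.2).1
          simp at this
          simp [this]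
        have := ih this
        simp only [List.head?_cons, Option.some.injEq, ha, if_true, if_false,
          List.length_cons] at this ⊢
        omega

/-- An alternating word is determined by its letters other than `i` and by its ends. -/
lemma Alternating.ext {i : ℕ} {u u' : List ℕ} (h : Alternating i u) (h' : Alternating i u')
    (hne : u.filter (· ≠ i) ≠ []) (e : u.filter (· ≠ i) = u'.filter (· ≠ i))
    (hh : u.head? = some i ↔ u'.head? = some i)
    (hl : u.getLast? = some i ↔ u'.getLast? = some i) : u = u' := by
  have l := h.length_eq hne
  have l' := h'.length_eq (e ▸ hne)
  simp only [← hh, ← hl, ← e] at l'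
  have hlen : u.length = u'.length := by omega
  by_cases hu : u.head? = some i
  · have a := h.prefix_pad.1 hu
    have b := h'.prefix_pad.1 (hh.1 hu)
    rw [← e] at b
    exact (List.prefix_of_prefix_length_le a b hlen.le).eq_of_length hlen
  · have a := h.prefix_pad.2 hu
    have b := h'.prefix_pad.2 (fun h => hu (hh.2 h))
    rw [← e] at b
    exact (List.prefix_of_prefix_length_le a b hlen.le).eq_of_length hlen

/-! ### Expansion -/

lemma intersperse_cons_of_ne_nil (i a : ℕ) {v : List ℕ} (hv : v ≠ []) :
    (a :: v).intersperse i = a :: i :: v.intersperse i := by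
  obtain ⟨b, v, rfl⟩ := List.exists_cons_of_ne_nil hv
  simp

lemma intersperse_head? (i : ℕ) (v : List ℕ) : (v.intersperse i).head? = v.head? := by
  cases v with
  | nil => rfl
  | cons a v => cases v <;> simp

lemma intersperse_ne_nil (i : ℕ) {v : List ℕ} (hv : v ≠ []) : v.intersperse i ≠ [] := by
  intro h
  have := intersperse_head? i v
  rw [h] at this
  exact hv (List.head?_eq_none_iff.1 this.symm)

lemma intersperse_getLast? (i : ℕ) (v : List ℕ) : (v.intersperse i).getLast? = v.getLast? := by
  induction v with
  | nil => rfl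
  | cons a v ih =>
    by_cases hv : v = []
    · simp [hv]
    · rw [intersperse_cons_of_ne_nil i a hv]
      obtain ⟨b, v, rfl⟩ := List.exists_cons_of_ne_nil hv
      rw [List.getLast?_cons_cons, List.getLast?_cons_cons, ← ih]
      cases h : (b :: v).intersperse i with
      | nil => simpa [h] using intersperse_head? i (b :: v)
      | cons c u => rw [List.getLast?_cons_cons]

lemma filter_intersperse {i : ℕ} {v : List ℕ} (hv : i ∉ v) :
    (v.intersperse i).filter (· ≠ i) = v := by
  induction v with
  | nil => rfl
  | cons a v ih =>
    simp only [List.mem_cons, not_or] at hv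
    by_cases h : v = []
    · simp [h, Ne.symm hv.1]
    · rw [intersperse_cons_of_ne_nil i a h, List.filter_cons_of_pos (by simpa using Ne.symm hv.1),
        List.filter_cons_of_neg (by simp), ih hv.2]

lemma filter_expand {i : ℕ} {v : List ℕ} (b₁ b₂ : Bool) (hv : i ∉ v) :
    (expand i b₁ b₂ v).filter (· ≠ i) = v := by
  rw [expand, List.filter_append, List.filter_append, filter_intersperse hv]
  cases b₁ <;> cases b₂ <;> simp

lemma mem_expand {i a : ℕ} {v : List ℕ} {b₁ b₂ : Bool} (ha : a ≠ i) (hv : i ∉ v) :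
    a ∈ expand i b₁ b₂ v ↔ a ∈ v := by
  rw [← (congrArg (a ∈ ·) (filter_expand b₁ b₂ hv) : _ = (a ∈ v))]
  simp [ha]

lemma alternating_intersperse {i : ℕ} {v : List ℕ} (hv : i ∉ v) :
    Alternating i (v.intersperse i) := by
  induction v with
  | nil => simp [Alternating]
  | cons a v ih =>
    simp only [List.mem_cons, not_or] at hv
    by_cases h : v = []
    · simp [h, Alternating]
    · rw [intersperse_cons_of_ne_nil i a h, alternating_cons_cons]
      refine ⟨by simp [Ne.symm hv.1], ?_⟩
      have := ih hv.2
      have hh := intersperse_head? i v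
      cases h' : v.intersperse i with
      | nil => simp [Alternating]
      | cons b u =>
        rw [h'] at hh this
        refine alternating_cons_cons.2 ⟨?_, this⟩
        have hb : b ∈ v := List.mem_of_mem_head? (by rw [← hh]; simp)
        simp only [true_iff]
        rintro rfl
        exact hv.2 hb

lemma alternating_expand {i : ℕ} {v : List ℕ} (b₁ b₂ : Bool) (hv : i ∉ v) (hne : v ≠ []) :
    Alternating i (expand i b₁ b₂ v) := by
  have hne' : v.intersperse i ≠ [] := intersperse_ne_nil i hne
  have h₁ : Alternating i (v.intersperse i ++ if b₂ then [i] else []) := by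
    refine List.isChain_append.2 ⟨alternating_intersperse hv, by cases b₂ <;> simp, ?_⟩
    intro x hx y hy
    rw [intersperse_getLast?] at hx
    have : x ≠ i := by
      rintro rfl
      exact hv (List.mem_of_mem_getLast? hx)
    cases b₂ <;> simp at hy
    simp [this, ← hy]
  refine List.isChain_append.2 ⟨by cases b₁ <;> simp, h₁, ?_⟩
  intro x hx y hy
  rw [List.head?_append_of_ne_nil _ hne', intersperse_head?] at hy
  have : y ≠ i := by
    rintro rfl
    exact hv (List.mem_of_mem_head? hy)
  cases b₁ <;> simp at hx
  simp [this, ← hx]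

lemma head?_expand {i : ℕ} {v : List ℕ} (b₁ b₂ : Bool) (hv : i ∉ v) (hne : v ≠ []) :
    (expand i b₁ b₂ v).head? = some i ↔ b₁ = true := by
  have hne' : v.intersperse i ≠ [] := intersperse_ne_nil i hne
  cases b₁
  · simp only [expand, Bool.false_eq_true, if_false, List.nil_append, iff_false]
    rw [List.head?_append_of_ne_nil _ hne', intersperse_head?]
    intro h
    exact hv (List.mem_of_mem_head? h)
  · simp [expand]

lemma getLast?_expand {i : ℕ} {v : List ℕ} (b₁ b₂ : Bool) (hv : i ∉ v) (hne : v ≠ []) :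
    (expand i b₁ b₂ v).getLast? = some i ↔ b₂ = true := by
  have hne' : v.intersperse i ≠ [] := intersperse_ne_nil i hne
  cases b₂
  · simp only [expand, Bool.false_eq_true, if_false, List.append_nil, iff_false]
    rw [List.getLast?_append_of_ne_nil _ hne', intersperse_getLast?]
    intro h
    exact hv (List.mem_of_mem_getLast? h)
  · simp [expand]

/-! ### Compression of an expansion -/

/-- Inserted `i`'s never count as larger letters for the letters of `v`, so these survive or vanish
as before, while an `i` between two of them is deleted. The prefixes are compared only through
letters above `i`, so that `pre'` may contain additional `i`'s. -/
lemma compressFrom_intersperse {i : ℕ} (b : Bool) : ∀ {v : List ℕ} {pre pre' : List ℕ},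
    v ≠ [] → (∀ a ∈ v, i < a) →
    (∀ a, i < a → ((∃ s ∈ pre', a < s) ↔ ∃ s ∈ pre, a < s)) →
    compressFrom pre' (v.intersperse i ++ if b then [i] else []) =
      compressFrom pre v ++ if b then [i] else []
  | [], _, _, h, _, _ => absurd rfl h
  | [a], pre, pre', _, hv, hp => by
    have ha : i < a := hv a (by simp)
    cases b <;> simp [compressFrom, ha.le]
  | a :: c :: v, pre, pre', _, hv, hp => by
    have ha : i < a := hv a (by simp)
    have hc : i < c := hv c (by simp)
    have ih := compressFrom_intersperse (i := i) b (v := c :: v) (pre := pre ++ [a])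
      (pre' := pre' ++ [a] ++ [i]) (by simp) (fun x hx => hv x (List.mem_cons_of_mem _ hx)) ?_
    swap
    · intro x hx
      have := hp x hx
      simp only [List.mem_append, List.mem_singleton, or_and_right, exists_or, exists_eq_left] at *
      rw [this]
      have : ¬ x < i := by omega
      simp [this]
    have hmem : ∀ x, i < x → ((∃ t ∈ i :: ((c :: v).intersperse i ++ if b then [i] else []), x < t) ↔
        ∃ t ∈ c :: v, x < t) := by
      intro x hx
      have hiv : i ∉ c :: v := fun h => absurd (hv i (List.mem_cons_of_mem _ h)) (lt_irrefl _)
      constructor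
      · rintro ⟨t, ht, hxt⟩
        refine ⟨t, ?_, hxt⟩
        rw [← mem_expand (b₁ := true) (b₂ := b) (i := i) (by omega) hiv]
        simpa [expand] using ht
      · rintro ⟨t, ht, hxt⟩
        refine ⟨t, ?_, hxt⟩
        rw [← mem_expand (b₁ := true) (b₂ := b) (i := i) (by omega) hiv] at ht
        simpa [expand] using ht
    rw [intersperse_cons_of_ne_nil i a (by simp), List.cons_append, List.cons_append]
    rw [compressFrom, compressFrom.eq_2 pre a (c :: v)]
    -- This `i` stands between the larger letters `a` and `c`.
    have hdrop : compressFrom (pre' ++ [a]) (i :: ((c :: v).intersperse i ++ if b then [i] else []))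
        = compressFrom (pre' ++ [a] ++ [i]) ((c :: v).intersperse i ++ if b then [i] else []) := by
      rw [compressFrom, if_pos]
      refine ⟨⟨a, by simp, ha⟩, c, ?_, hc⟩
      apply List.mem_append_left
      have := intersperse_head? i (c :: v)
      exact List.mem_of_mem_head? (by rw [this]; simp)
    simp only [hmem a ha, hp a ha, hdrop, ih]
    split_ifs <;> simp

/-- Only an `i` at an end lacks a larger letter on one side. This is why inserting letters at the
ends of compressed values is all that the algorithm has to do. -/
lemma compress_expand {i : ℕ} (b₁ b₂ : Bool) {v : List ℕ} (hne : v ≠ []) (hv : ∀ a ∈ v, i < a) :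
    compress (expand i b₁ b₂ v) =
      (if b₁ then [i] else []) ++ (compress v ++ if b₂ then [i] else []) := by
  cases b₁
  · simp only [expand, compress, Bool.false_eq_true, if_false, List.nil_append]
    exact compressFrom_intersperse b₂ hne hv fun _ _ => Iff.rfl
  · simp only [expand, compress, if_true, List.singleton_append]
    rw [compressFrom, if_neg (by simp)]
    congr 1
    refine compressFrom_intersperse b₂ hne hv fun a ha => ?_
    simp [ha.le]

lemma compress_singleton (i : ℕ) : compress [i] = [i] := by simp [compress, compressFrom]

/-! ### Zimin words -/

lemma le_of_mem_zimin {a : ℕ} : ∀ {k : ℕ}, a ∈ zimin k → 1 ≤ a ∧ a ≤ k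
  | 0, h => by simp [zimin] at h
  | k + 1, h => by
    simp only [zimin, List.mem_append, List.mem_cons] at h
    rcases h with h | h | h
    · have := le_of_mem_zimin h; omega
    · omega
    · have := le_of_mem_zimin h; omega

/-- The Zimin word `Z_k` without the letters smaller than `i`. -/
def ziminFrom (k i : ℕ) : List ℕ := (zimin k).filter (i ≤ ·)

lemma ziminFrom_one (k : ℕ) : ziminFrom k 1 = zimin k :=
  List.filter_eq_self.2 fun _ h => by simpa using (le_of_mem_zimin h).1

lemma ziminFrom_of_lt {k i : ℕ} (h : k < i) : ziminFrom k i = [] :=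
  List.filter_eq_nil_iff.2 fun a ha => by
    have := (le_of_mem_zimin ha).2
    simp; omega

lemma ziminFrom_succ {k i : ℕ} (h : i ≤ k + 1) :
    ziminFrom (k + 1) i = ziminFrom k i ++ (k + 1) :: ziminFrom k i := by
  simp [ziminFrom, zimin, h]

lemma ziminFrom_self {k : ℕ} (hk : 1 ≤ k) : ziminFrom k k = [k] := by
  obtain ⟨k, rfl⟩ := Nat.exists_eq_add_of_le' hk
  rw [ziminFrom_succ le_rfl, ziminFrom_of_lt (by omega)]
  rfl

/-- In $Z_{k+1} = Z_k\,(k+1)\,Z_k$ both halves, once the letters below `i` are gone, begin and end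
with `i`, so the middle letter fits into the alternation. The recursion starts where the middle
letter is `i` itself. -/
lemma ziminFrom_eq_pad {i : ℕ} (hi : 1 ≤ i) : ∀ {k : ℕ}, i ≤ k →
    ziminFrom k i = i :: pad i (ziminFrom k (i + 1))
  | 0, h => by omega
  | k + 1, h => by
    rcases Nat.lt_or_ge k i with hk | hk
    · have : i = k + 1 := by omega
      subst this
      rw [ziminFrom_self hi, ziminFrom_of_lt (by omega)]
      rfl
    · rw [ziminFrom_succ h, ziminFrom_succ (by omega), ziminFrom_eq_pad hi hk, pad_append]
      simp

lemma infix_append_cons_iff {α : Type*} {u y z : List α} {a : α} (ha : a ∉ u) :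
    u <:+: y ++ a :: z ↔ u <:+: y ∨ u <:+: z := by
  constructor
  · rintro ⟨s, t, e⟩
    rw [List.append_eq_append_iff] at e
    rcases e with ⟨r, h₁, h₂⟩ | ⟨r, h₁, h₂⟩
    · exact .inl ⟨s, r, h₁.symm⟩
    · rcases List.append_eq_append_iff.1 h₁ with ⟨q, h₃, h₄⟩ | ⟨q, h₃, h₄⟩
      · cases r with
        | nil => exact .inl ⟨s, [], by simp [h₁]⟩
        | cons c r =>
          simp only [List.cons_append, List.cons.injEq] at h₂
          exact absurd (by rw [h₄, ← h₂.1]; simp) ha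
      · cases q with
        | nil =>
          cases u with
          | nil => exact .inl List.nil_infix
          | cons c u =>
            simp only [List.nil_append] at h₄
            rw [h₄] at h₂
            simp only [List.cons_append, List.cons.injEq] at h₂
            exact absurd (by rw [h₂.1]; simp) ha
        | cons c q =>
          rw [h₄] at h₂
          simp only [List.cons_append, List.append_assoc, List.cons.injEq] at h₂
          exact .inr ⟨q, t, by rw [h₂.2]; simp⟩
  · rintro (h | h)
    · exact List.infix_append_of_infix_left h
    · exact List.infix_append_of_infix_right (List.infix_cons h)

/-- A word without the letter $k+1$ cannot cross the middle of $Z_{k+1}$, so it lies inside one of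
the two copies of $Z_k$. -/
lemma infix_zimin_iff {u : List ℕ} {l : ℕ} (hu : ∀ a ∈ u, a ≤ l) :
    ∀ {k : ℕ}, l ≤ k → (u <:+: zimin k ↔ u <:+: zimin l)
  | 0, h => by rw [Nat.le_zero.1 h]
  | k + 1, h => by
    rcases Nat.lt_or_ge k l with hk | hk
    · rw [show l = k + 1 by omega]
    · rw [zimin, infix_append_cons_iff, or_self, infix_zimin_iff hu hk]
      intro h
      have := hu _ h
      omega

end ZiminMatching

/-! ### A closed form of `ShortestFirstLast`: orientations of connected components. -/

namespace ZiminMatching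

open scoped Classical in
/-- The partial valuation in which the components in `A` have the value 1 on the left copies and the
components in `N` the value 1 on the right copies. -/
noncomputable def orientedVal {V : Type} {w : List V} (A N : Vertex w → Prop) : PartialVal w :=
  fun c => if A c then some c.isLeft else if N c then some (!c.isLeft) else none

/-- `A` and `N` are disjoint unions of connected components. -/
structure Oriented {V : Type} {w : List V} (A N : Vertex w → Prop) : Prop where
  disjoint : ∀ c, A c → ¬ N c
  left : ∀ a c, (adjGraph w).Reachable a c → A a → A c
  right : ∀ a c, (adjGraph w).Reachable a c → N a → N c

section Valuate

variable {V : Type} {w : List V} {A N : Vertex w → Prop}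

lemma Oriented.insert_left (h : Oriented A N) {a : Vertex w} (ha : ¬ N a) :
    Oriented (fun c => A c ∨ (adjGraph w).Reachable a c) N where
  disjoint c hc hN := hc.elim (fun h' => h.disjoint c h' hN) fun r => ha (h.right _ _ r.symm hN)
  left a c r := Or.imp (h.left a c r) fun h' => h'.trans r
  right := h.right

lemma Oriented.insert_right (h : Oriented A N) {a : Vertex w} (ha : ¬ A a) :
    Oriented A (fun c => N c ∨ (adjGraph w).Reachable a c) where
  disjoint c hA hc := hc.elim (fun h' => h.disjoint c hA h') fun r => ha (h.left _ _ r.symm hA)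
  left := h.left
  right a c r := Or.imp (h.right a c r) fun h' => h'.trans r

/-- The value `a.isLeft` orients the component of `a` as in `A`, whichever side `a` lies on: this
covers both valuate(x^L, 1) and valuate(x^R, 0). The opposite value orients it as in `N`, which
covers valuate(x^R, 1) and valuate(x^L, 0). -/
lemma valuate_left_eq_none (h : Oriented A N) {a : Vertex w} (ha : N a) :
    valuate (orientedVal A N) a a.isLeft = none := by
  have : ¬ A a := fun h' => h.disjoint a h' ha
  simp [valuate, orientedVal, ha, this]

open scoped Classical in
lemma valuate_left_eq_some {a : Vertex w} (ha : ¬ N a) :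
    valuate (orientedVal A N) a a.isLeft =
      some (orientedVal (fun c => A c ∨ (adjGraph w).Reachable a c) N) := by
  rw [valuate, if_neg]
  · congr 1
    funext c
    by_cases hc : (adjGraph w).Reachable a c
    · simp only [hc, orientedVal, or_true, if_true]
      cases a <;> cases c <;> simp
    · simp only [hc, orientedVal, if_false]
      exact if_congr (by simp) rfl rfl
  · by_cases hA : A a <;> cases a <;> simp [orientedVal, hA, ha]

lemma valuate_right_eq_none {a : Vertex w} (ha : A a) :
    valuate (orientedVal A N) a (!a.isLeft) = none := by
  simp [valuate, orientedVal, ha]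

open scoped Classical in
lemma valuate_right_eq_some (h : Oriented A N) {a : Vertex w} (ha : ¬ A a) :
    valuate (orientedVal A N) a (!a.isLeft) =
      some (orientedVal A (fun c => N c ∨ (adjGraph w).Reachable a c)) := by
  rw [valuate, if_neg]
  · congr 1
    funext c
    by_cases hc : (adjGraph w).Reachable a c
    · have : ¬ A c := fun h' => ha (h.left _ _ hc.symm h')
      simp only [hc, this, orientedVal, or_true, if_true, if_false]
      cases a <;> cases c <;> simp
    · simp only [hc, orientedVal, if_false]
      exact if_congr Iff.rfl rfl (if_congr (by simp) rfl rfl)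
  · by_cases hN : N a <;> cases a <;> simp [orientedVal, hN, ha]

/-- Processing `x` moves the component of its left copy into `A` and that of its right copy into
`N`. A collision of `x` with a later variable then shows up as a collision of that variable with the
current orientation, which is why the induction runs over arbitrary `A` and `N`. -/
lemma foldlM_valuate_new (L : List {x // x ∈ w}) : ∀ {A N : Vertex w → Prop}, Oriented A N →
    (((∃ x ∈ L, N (Sum.inl x) ∨ A (Sum.inr x)) ∨
        ∃ x ∈ L, ∃ y ∈ L, (adjGraph w).Reachable (Sum.inl x) (Sum.inr y)) →
      L.foldlM (fun p x => (valuate p (Sum.inl x) true).bind fun q => valuate q (Sum.inr x) true)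
        (orientedVal A N) = none) ∧
    ((¬ ∃ x ∈ L, N (Sum.inl x) ∨ A (Sum.inr x)) →
        (¬ ∃ x ∈ L, ∃ y ∈ L, (adjGraph w).Reachable (Sum.inl x) (Sum.inr y)) →
      Oriented (fun c => A c ∨ ∃ x ∈ L, (adjGraph w).Reachable (Sum.inl x) c)
          (fun c => N c ∨ ∃ x ∈ L, (adjGraph w).Reachable (Sum.inr x) c) ∧
      L.foldlM (fun p x => (valuate p (Sum.inl x) true).bind fun q => valuate q (Sum.inr x) true)
        (orientedVal A N) =
      some (orientedVal (fun c => A c ∨ ∃ x ∈ L, (adjGraph w).Reachable (Sum.inl x) c)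
        (fun c => N c ∨ ∃ x ∈ L, (adjGraph w).Reachable (Sum.inr x) c))) := by
  induction L with
  | nil => intro A N h; simpa using h
  | cons x L ih =>
    intro A N h
    rw [List.foldlM_cons]
    by_cases h₁ : N (Sum.inl x)
    · have := valuate_left_eq_none h h₁
      rw [show (Sum.inl x : Vertex w).isLeft = true from rfl] at this
      rw [this]
      exact ⟨fun _ => rfl, fun h' => absurd ⟨x, by simp, .inl h₁⟩ h'⟩
    have e₁ := valuate_left_eq_some (A := A) h₁
    rw [show (Sum.inl x : Vertex w).isLeft = true from rfl] at e₁
    rw [e₁, Option.bind_some]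
    have h' := h.insert_left h₁
    by_cases h₂ : A (Sum.inr x) ∨ (adjGraph w).Reachable (Sum.inl x) (Sum.inr x)
    · have := valuate_right_eq_none (A := fun c => A c ∨ (adjGraph w).Reachable (Sum.inl x) c)
        (N := N) h₂
      rw [show (!(Sum.inr x : Vertex w).isLeft) = true from rfl] at this
      rw [this]
      refine ⟨fun _ => rfl, fun g₁ g₂ => ?_⟩
      exact h₂.elim (fun h₂ => absurd ⟨x, by simp, .inr h₂⟩ g₁)
        fun h₂ => absurd ⟨x, by simp, x, by simp, h₂⟩ g₂
    have e₂ := valuate_right_eq_some h' h₂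
    rw [show (!(Sum.inr x : Vertex w).isLeft) = true from rfl] at e₂
    rw [e₂]
    have h'' := h'.insert_right h₂
    have ih := ih h''
    have hs : ∀ y, (adjGraph w).Reachable (Sum.inr x) (Sum.inl y) ↔
        (adjGraph w).Reachable (Sum.inl y) (Sum.inr x) :=
      fun y => ⟨fun h => h.symm, fun h => h.symm⟩
    simp only [hs] at ih
    simp only [List.mem_cons, exists_eq_or_imp] at ih ⊢
    simp only [or_assoc] at ih ⊢
    refine ⟨fun hc => ih.1 ?_, fun g₁ g₂ => ?_⟩
    · grind
    · rw [Option.bind_eq_bind, Option.bind_some]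
      exact ih.2 (by grind) (by grind)

/-- This loop cannot fail: an undecided component joins `N`, a decided one is left alone. -/
lemma foldlM_valuateIfUnset_left (L : List {x // x ∈ w}) : ∀ {A N : Vertex w → Prop},
    Oriented A N →
    ∃ N', (∀ c, N' c ↔ N c ∨ (¬ A c ∧ ∃ x ∈ L, (adjGraph w).Reachable (Sum.inl x) c)) ∧
      Oriented A N' ∧
      (L.map Sum.inl).foldlM valuateIfUnset (orientedVal A N) = some (orientedVal A N') := by
  induction L with
  | nil => intro A N h; exact ⟨N, by simp, h, by simp⟩
  | cons x L ih =>
    intro A N h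
    simp only [List.map_cons, List.foldlM_cons]
    by_cases hx : A (Sum.inl x) ∨ N (Sum.inl x)
    · have : valuateIfUnset (orientedVal A N) (Sum.inl x) = some (orientedVal A N) := by
        rw [valuateIfUnset, if_neg]
        by_cases hA : A (Sum.inl x)
        · simp [orientedVal, hA]
        · simp [orientedVal, hA, hx.resolve_left hA]
      rw [this]
      obtain ⟨N', h₁, h₂, h₃⟩ := ih h
      refine ⟨N', fun c => ?_, h₂, h₃⟩
      have := h.left (Sum.inl x) c
      have := h.right (Sum.inl x) c
      rw [h₁]
      simp only [List.mem_cons, exists_eq_or_imp]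
      tauto
    · rw [not_or] at hx
      have : valuateIfUnset (orientedVal A N) (Sum.inl x) =
          some (orientedVal A (fun c => N c ∨ (adjGraph w).Reachable (Sum.inl x) c)) := by
        rw [valuateIfUnset, if_pos (by simp [orientedVal, hx])]
        exact valuate_right_eq_some h hx.1
      rw [this]
      obtain ⟨N', h₁, h₂, h₃⟩ := ih (h.insert_right hx.1)
      refine ⟨N', fun c => ?_, h₂, h₃⟩
      have : (adjGraph w).Reachable (Sum.inl x) c → ¬ A c := fun r hA => hx.1 (h.left _ _ r.symm hA)
      rw [h₁]
      simp only [List.mem_cons, exists_eq_or_imp]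
      tauto

lemma adj_iff {a b : Vertex w} : (adjGraph w).Adj a b ↔
    ∃ x y : {x // x ∈ w}, [x.1, y.1] <:+: w ∧
      (a = Sum.inl x ∧ b = Sum.inr y ∨ a = Sum.inr y ∧ b = Sum.inl x) := by
  rw [adjGraph, SimpleGraph.fromRel_adj]
  constructor
  · rintro ⟨-, ⟨x, y, rfl, rfl, h⟩ | ⟨x, y, rfl, rfl, h⟩⟩
    · exact ⟨x, y, h, .inl ⟨rfl, rfl⟩⟩
    · exact ⟨x, y, h, .inr ⟨rfl, rfl⟩⟩
  · rintro ⟨x, y, h, ⟨rfl, rfl⟩ | ⟨rfl, rfl⟩⟩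
    · exact ⟨by simp, .inl ⟨x, y, rfl, rfl, h⟩⟩
    · exact ⟨by simp, .inr ⟨x, y, rfl, rfl, h⟩⟩

lemma adj_inl_inr {x y : {x // x ∈ w}} (h : [x.1, y.1] <:+: w) :
    (adjGraph w).Adj (Sum.inl x) (Sum.inr y) := adj_iff.2 ⟨x, y, h, .inl ⟨rfl, rfl⟩⟩

/-- Consequently every right copy, except perhaps that of the first variable, is adjacent to a left
copy and gets its value from the loop over the left copies. -/
lemma exists_pair_infix (hw : w ≠ []) {y : V} (hy : y ∈ w) (hne : y ≠ w.head hw) :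
    ∃ x ∈ w, [x, y] <:+: w := by
  obtain ⟨s, t, rfl⟩ := List.append_of_mem hy
  rcases List.eq_nil_or_concat s with rfl | ⟨s, x, rfl⟩
  · simp at hne
  · exact ⟨x, by simp, s, t, by simp⟩

/-- The first variable of a word, as an element of its subtype of occurring variables. -/
def firstVar (w : List V) (hw : w ≠ []) : {x // x ∈ w} := ⟨w.head hw, List.head_mem hw⟩

/-- The last variable of a word, as an element of its subtype of occurring variables. -/
def lastVar (w : List V) (hw : w ≠ []) : {x // x ∈ w} := ⟨w.getLast hw, List.getLast_mem hw⟩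

/-- The vertices in whose component `ShortestFirstLast` gives 1 to the left copies. -/
def Flipped (w : List V) (W : V → Prop) (hw : w ≠ []) (c : Vertex w) : Prop :=
  (∃ x : {x // x ∈ w}, W x.1 ∧ (adjGraph w).Reachable (Sum.inl x) c) ∨
  ((∀ x : {x // x ∈ w}, W x.1 →
      ¬ (adjGraph w).Reachable (Sum.inl x) (Sum.inr (firstVar w hw)) ∧
      ¬ (adjGraph w).Reachable (Sum.inr x) (Sum.inr (firstVar w hw))) ∧
    (adjGraph w).Reachable (Sum.inr (firstVar w hw)) c)

/-- Both copies of new variables lie in one component. -/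
def Conflict (w : List V) (W : V → Prop) : Prop :=
  ∃ x y : {x // x ∈ w}, W x.1 ∧ W y.1 ∧ (adjGraph w).Reachable (Sum.inl x) (Sum.inr y)

lemma shortestFirstLast_eq_none (W : V → Prop) [DecidablePred W] (h : Conflict w W) :
    shortestFirstLast w W = none := by
  obtain ⟨x, y, hx, hy, h⟩ := h
  have := (foldlM_valuate_new (w.attach.filter fun x => W x.1) (A := fun _ => False)
    (N := fun _ => False) ⟨by simp, by simp, by simp⟩).1
    (.inr ⟨x, by simp [hx], y, by simp [hy], h⟩)
  rw [shortestFirstLast, valuateNew]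
  have e' : (fun _ => none : PartialVal w) = orientedVal (fun _ => False) (fun _ => False) := by
    funext c; simp [orientedVal]
  rw [e', this]
  rfl

open scoped Classical in
-- The components with a new left copy, and that of the right copy of the first variable if it was
-- undecided, are oriented as in `A`; all remaining ones end up in `N`. In particular no vertex
-- stays without a value.
lemma shortestFirstLast_eq_some (W : V → Prop) [DecidablePred W] (hw : w ≠ [])
    (h : ¬ Conflict w W) : shortestFirstLast w W =
      some fun c => some (if Flipped w W hw c then c.isLeft else !c.isLeft) := by
  have hnew := (foldlM_valuate_new (w.attach.filter fun x => W x.1) (A := fun _ => False)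
    (N := fun _ => False) ⟨by simp, by simp, by simp⟩).2 (by simp) (by
      rintro ⟨x, hx, y, hy, r⟩
      simp at hx hy
      exact h ⟨x, y, hx, hy, r⟩)
  rw [shortestFirstLast, valuateNew]
  simp only [List.mem_filter, List.mem_attach, true_and, decide_eq_true_eq, false_or] at hnew
  set A : Vertex w → Prop := fun c => ∃ x : {x // x ∈ w}, W x.1 ∧ (adjGraph w).Reachable (Sum.inl x) c
    with hA
  set N : Vertex w → Prop := fun c => ∃ x : {x // x ∈ w}, W x.1 ∧ (adjGraph w).Reachable (Sum.inr x) c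
    with hN
  obtain ⟨ho, e⟩ := hnew
  have e' : (fun _ => none : PartialVal w) = orientedVal (fun _ => False) (fun _ => False) := by
    funext c; simp [orientedVal]
  rw [e', e, Option.bind_some]
  have hhead : w.attach.head? = some (firstVar w hw) := by
    rw [List.head?_attach, firstVar]
    obtain ⟨a, w, rfl⟩ := List.exists_cons_of_ne_nil hw
    simp
  have hlast : ∃ l, w.attach.getLast? = some l :=
    ⟨_, List.getLast?_eq_some_getLast (by simpa using hw)⟩
  obtain ⟨l, hl⟩ := hlast
  rw [hhead, hl]
  simp only [Option.toList_some, List.map_cons, List.map_nil, List.nil_append,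
    List.cons_append, List.foldlM_cons]
  set f := firstVar w hw
  have hfirst : ∃ A', (∀ c, A' c ↔ A c ∨ (¬ A (Sum.inr f) ∧ ¬ N (Sum.inr f)) ∧
      (adjGraph w).Reachable (Sum.inr f) c) ∧ Oriented A' N ∧
      valuateIfUnset (orientedVal A N) (Sum.inr f) = some (orientedVal A' N) := by
    by_cases hf : A (Sum.inr f) ∨ N (Sum.inr f)
    · refine ⟨A, fun c => by simp [← not_or, hf], ho, ?_⟩
      rw [valuateIfUnset, if_neg]
      by_cases hA : A (Sum.inr f)
      · simp [orientedVal, hA]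
      · simp [orientedVal, hA, hf.resolve_left hA]
    · rw [not_or] at hf
      refine ⟨_, fun c => ?_, ho.insert_left hf.2, ?_⟩
      · simp [hf]
      · rw [valuateIfUnset, if_pos (by simp [orientedVal, hf])]
        exact valuate_left_eq_some hf.2
  obtain ⟨A', hA', ho', e₁⟩ := hfirst
  rw [e₁, Option.bind_eq_bind, Option.bind_some]
  -- The treatment of the last variable is the same operation as the final loop, so its left copy is
  -- simply one more entry of the list.
  obtain ⟨N', hN', -, e₂⟩ := foldlM_valuateIfUnset_left (l :: w.attach) ho'
  rw [List.map_cons, List.foldlM_cons] at e₂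
  simp only [Option.bind_eq_bind] at e₂
  rw [e₂]
  congr 1
  funext c
  have hflip : Flipped w W hw c ↔ A' c := by
    rw [hA', Flipped]
    simp only [hA, hN, not_exists, not_and, ← forall_and]
    refine or_congr_right (and_congr_left' (forall_congr' fun x => ?_))
    tauto
  simp only [orientedVal, hflip]
  by_cases hc : A' c
  · simp [hc]
  -- A left copy is on the list; a right copy has a left neighbour on the list, unless it belongs to
  -- the first variable, whose component was decided before.
  · have : N' c := by
      rw [hN']
      rcases c with x | y
      · exact .inr ⟨hc, x, by simp, .rfl⟩
      · by_cases hy : y.1 = w.head hw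
        · have : y = f := Subtype.ext hy
          subst this
          by_cases hN : N (Sum.inr f)
          · exact .inl hN
          · have := fun h => hc ((hA' _).2 h)
            by_cases hA : A (Sum.inr f)
            · exact absurd (.inl hA) this
            · exact absurd (.inr ⟨⟨hA, hN⟩, .rfl⟩) this
        · obtain ⟨x, hx, hxy⟩ := exists_pair_infix hw y.2 hy
          exact .inr ⟨hc, ⟨x, hx⟩, by simp, (adj_inl_inr (x := ⟨x, hx⟩) hxy).reachable⟩
    simp [hc, this]

end Valuate

end ZiminMatching

namespace ZiminMatching

/-! ### Concatenations of alternating words -/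

section Concat

variable {V : Type} {i : ℕ} {w : List V} {h : V → List ℕ}

/-- No value is empty, so two neighbouring letters lie inside one value, or they are the last letter
of `h x` and the first letter of `h y` for a factor `xy`. The second kind gives the edges of the
adjacency graph. -/
lemma alternating_flatMap_iff (hne : ∀ x ∈ w, h x ≠ []) : Alternating i (w.flatMap h) ↔
    (∀ x ∈ w, Alternating i (h x)) ∧
      ∀ x y, [x, y] <:+: w → ((h x).getLast? = some i ↔ (h y).head? ≠ some i) := by
  rw [List.flatMap_def, Alternating, List.isChain_flatten (by
    simp only [List.mem_map, not_exists, not_and]; exact hne), List.isChain_map,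
    List.isChain_iff_forall_rel_of_append_cons_cons]
  simp only [List.forall_mem_map, Alternating]
  refine and_congr_right fun _ => ⟨fun H x y hxy => ?_, fun H x y s t e => ?_⟩
  · have hx : x ∈ w := hxy.mem (by simp)
    have hy : y ∈ w := hxy.mem (by simp)
    obtain ⟨s, t, e⟩ := hxy
    have := H (a := x) (b := y) (l₁ := s) (l₂ := t) (by rw [← e]; simp)
    rw [List.getLast?_eq_some_getLast (hne x hx), List.head?_eq_some_head (hne y hy)] at this ⊢
    simpa using this
  · have hxy : [x, y] <:+: w := ⟨s, t, by rw [e]; simp⟩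
    have hx : x ∈ w := hxy.mem (by simp)
    have hy : y ∈ w := hxy.mem (by simp)
    have := H x y hxy
    rw [List.getLast?_eq_some_getLast (hne x hx), List.head?_eq_some_head (hne y hy)] at this ⊢
    simpa using this

lemma head?_flatMap_of_ne_nil (hw : w ≠ []) (hne : ∀ x ∈ w, h x ≠ []) :
    (w.flatMap h).head? = (h (w.head hw)).head? := by
  obtain ⟨a, w, rfl⟩ := List.exists_cons_of_ne_nil hw
  rw [List.flatMap_cons, List.head?_append_of_ne_nil _ (hne a (by simp))]
  simp

lemma getLast?_flatMap_of_ne_nil (hw : w ≠ []) (hne : ∀ x ∈ w, h x ≠ []) :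
    (w.flatMap h).getLast? = (h (w.getLast hw)).getLast? := by
  obtain ⟨s, a, rfl⟩ := (List.eq_nil_or_concat w).resolve_left hw
  have := hne a (by simp)
  simp [List.getLast?_eq_some_getLast this]

lemma Alternating.eq_singleton {u : List ℕ} (hu : Alternating i u) (hne : u ≠ [])
    (hi : ∀ a ∈ u, a = i) : u = [i] := by
  rcases u with _ | ⟨a, _ | ⟨b, u⟩⟩
  · exact absurd rfl hne
  · rw [hi a (by simp)]
  · have := (alternating_cons_cons.1 hu).1
    simp [hi a (by simp), hi b (by simp)] at this

lemma eq_of_reachable {V α : Type*} {G : SimpleGraph V} {f : V → α}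
    (h : ∀ a b, G.Adj a b → f a = f b) {a b : V} (hab : G.Reachable a b) : f a = f b := by
  obtain ⟨p⟩ := hab
  induction p with
  | nil => rfl
  | cons hadj _ ih => exact (h _ _ hadj).trans ih

lemma Flipped.of_reachable {V : Type} {w : List V} {W : V → Prop} {hw : w ≠ []} {a b : Vertex w}
    (h : Flipped w W hw a) (hab : (adjGraph w).Reachable a b) : Flipped w W hw b :=
  h.imp (fun ⟨x, hx, r⟩ => ⟨x, hx, r.trans hab⟩) fun ⟨h₁, h₂⟩ => ⟨h₁, h₂.trans hab⟩

end Concat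

namespace RankedPattern

variable {m : ℕ} (P : RankedPattern m)

/-! ### Levels -/

lemma rank_le_maxRank (x : Fin m) : P.rank x ≤ P.maxRank := Finset.le_sup (Finset.mem_univ x)

lemma exists_rank_eq_maxRank : ∃ x, P.rank x = P.maxRank := by
  obtain ⟨x, -⟩ := List.exists_mem_of_ne_nil _ P.pat_ne_nil
  obtain ⟨y, -, hy⟩ := Finset.exists_mem_eq_sup Finset.univ ⟨x, Finset.mem_univ x⟩ P.rank
  exact ⟨y, hy.symm⟩

lemma one_le_maxRank : 1 ≤ P.maxRank := by
  obtain ⟨x, hx⟩ := P.exists_rank_eq_maxRank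
  rw [← hx]
  exact P.rank_pos x

lemma mem_restrict {i : ℕ} {x : Fin m} : x ∈ P.restrict i ↔ i ≤ P.rank x := by
  simp [restrict, P.occurs]

lemma restrict_ne_nil {i : ℕ} (hi : i ≤ P.maxRank) : P.restrict i ≠ [] := by
  obtain ⟨x, hx⟩ := P.exists_rank_eq_maxRank
  exact List.ne_nil_of_mem (P.mem_restrict.2 (hx ▸ hi))

lemma image_eq_flatMap_restrict {i : ℕ} {h : Fin m → List ℕ} (hh : ∀ x, P.rank x < i → h x = []) :
    P.image h = (P.restrict i).flatMap h := by
  rw [image, restrict]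
  induction P.pat with
  | nil => rfl
  | cons x w ih =>
    by_cases hx : i ≤ P.rank x
    · rw [List.filter_cons_of_pos (by simpa using hx), List.flatMap_cons, List.flatMap_cons, ih]
    · rw [List.filter_cons_of_neg (by simpa using hx), List.flatMap_cons, ih,
        hh x (by omega), List.nil_append]

lemma mem_image {h : Fin m → List ℕ} {a : ℕ} : a ∈ P.image h ↔ ∃ x, a ∈ h x := by
  simp [image, P.occurs]

/-- The instances of the pattern in the Zimin word, without the letters smaller than `i`. -/
def levelInstances (i : ℕ) : Set (Fin m → List ℕ) :=
  {h | (∀ x, P.rank x < i → h x = []) ∧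
    (∀ x, i ≤ P.rank x → IsGreatest {a | a ∈ h x} (P.rank x)) ∧
    P.image h <:+: ziminFrom P.maxRank i}

variable {P}

lemma le_of_mem_level {i a : ℕ} {h : Fin m → List ℕ} (hh : h ∈ P.levelInstances i) {x : Fin m}
    (ha : a ∈ h x) : i ≤ a := by
  have := hh.2.2.mem (P.mem_image.2 ⟨x, ha⟩)
  simpa using (List.mem_filter.1 this).2

lemma ne_nil_of_level {i : ℕ} {h : Fin m → List ℕ} (hh : h ∈ P.levelInstances i) {x : Fin m}
    (hx : i ≤ P.rank x) : h x ≠ [] :=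
  List.ne_nil_of_mem (hh.2.1 x hx).1

lemma image_ne_nil_of_level {i : ℕ} {h : Fin m → List ℕ} (hh : h ∈ P.levelInstances i)
    (hi : i ≤ P.maxRank) : P.image h ≠ [] := by
  obtain ⟨x, hx⟩ := P.exists_rank_eq_maxRank
  exact List.ne_nil_of_mem (P.mem_image.2 ⟨x, (hh.2.1 x (hx ▸ hi)).1⟩)

/-- No letter of the image exceeds the maximal rank, so $Z_k$ may be replaced by $Z_K$; and no
variable has rank below 1. -/
lemma instances_eq_levelInstances {k : ℕ} (hk : ∀ x, P.rank x ≤ k) :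
    P.instances k = P.levelInstances 1 := by
  have hK : P.maxRank ≤ k := Finset.sup_le fun x _ => hk x
  ext h
  simp only [instances, IsInstance, levelInstances, Set.mem_ofPred_eq, ziminFrom_one]
  have key : (∀ x, IsGreatest {a | a ∈ h x} (P.rank x)) → ∀ a ∈ P.image h, a ≤ P.maxRank := by
    intro hh a ha
    obtain ⟨x, hx⟩ := P.mem_image.1 ha
    exact ((hh x).2 hx).trans (P.rank_le_maxRank x)
  constructor
  · rintro ⟨h₁, h₂⟩
    exact ⟨fun x hx => absurd hx (by have := P.rank_pos x; omega), fun x _ => h₂ x,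
      (infix_zimin_iff (key h₂) hK).1 h₁⟩
  · rintro ⟨-, h₂, h₁⟩
    have h₂ := fun x => h₂ x (P.rank_pos x)
    exact ⟨(infix_zimin_iff (key h₂) hK).2 h₁, h₂⟩

variable (P) in
/-- The valuation that gives the maximal rank to the variables of maximal rank. -/
def topVal (x : Fin m) : List ℕ := if P.rank x = P.maxRank then [P.maxRank] else []

lemma flatMap_const_of_forall {V : Type} {w : List V} {h : V → List ℕ} {a : ℕ}
    (hh : ∀ x ∈ w, h x = [a]) : w.flatMap h = List.replicate w.length a := by
  induction w with
  | nil => rfl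
  | cons x w ih =>
    rw [List.flatMap_cons, hh x (by simp), ih fun y hy => hh y (List.mem_cons_of_mem _ hy)]
    rfl

lemma image_topVal : P.image P.topVal =
    List.replicate (P.restrict P.maxRank).length P.maxRank := by
  rw [P.image_eq_flatMap_restrict (i := P.maxRank) fun x hx => by simp [topVal, hx.ne]]
  apply flatMap_const_of_forall
  intro x hx
  have := P.mem_restrict.1 hx
  have := P.rank_le_maxRank x
  simp [topVal, show P.rank x = P.maxRank by omega]

/-- Here the Zimin word is a single letter, and a nonempty value is a factor of it. -/
lemma eq_topVal_of_level {h : Fin m → List ℕ} (hh : h ∈ P.levelInstances P.maxRank) :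
    h = P.topVal := by
  have hinf := hh.2.2
  rw [ziminFrom_self P.one_le_maxRank] at hinf
  funext x
  by_cases hx : P.rank x = P.maxRank
  · have hne := ne_nil_of_level hh hx.ge
    obtain ⟨s, t, e⟩ := List.append_of_mem (P.occurs x)
    have : h x <:+: [P.maxRank] := by
      refine List.IsInfix.trans ⟨s.flatMap h, t.flatMap h, ?_⟩ hinf
      simp [image, e]
    have hl := this.length_le
    simp only [List.length_singleton] at hl
    have := List.length_pos_iff.2 hne
    simp only [topVal, hx, if_true]
    exact List.IsInfix.eq_of_length (by assumption) (by simp; omega)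
  · rw [topVal, if_neg hx]
    exact hh.1 x (lt_of_le_of_ne (P.rank_le_maxRank x) hx)

lemma topVal_mem_level (hl : (P.restrict P.maxRank).length = 1) :
    P.topVal ∈ P.levelInstances P.maxRank := by
  refine ⟨fun x hx => by simp [topVal, hx.ne], fun x hx => ?_, ?_⟩
  · have : P.rank x = P.maxRank := le_antisymm (P.rank_le_maxRank x) hx
    simp [topVal, this]
  · rw [image_topVal, hl, ziminFrom_self P.one_le_maxRank]
    exact List.infix_rfl

lemma length_restrict_of_level {h : Fin m → List ℕ} (hh : h ∈ P.levelInstances P.maxRank) :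
    (P.restrict P.maxRank).length = 1 := by
  have hinf := hh.2.2
  rw [eq_topVal_of_level hh, image_topVal, ziminFrom_self P.one_le_maxRank] at hinf
  have hl := hinf.length_le
  have := List.length_pos_iff.2 (P.restrict_ne_nil le_rfl)
  simp at hl
  omega

/-! ### One level from the next -/

variable (P) in
/-- The labelings of the components of the adjacency graph that the new variables allow. -/
def levelLabels (i : ℕ) : Set ((adjGraph (P.restrict i)).ConnectedComponent → Bool) :=
  {φ | ∀ x : {x // x ∈ P.restrict i}, P.rank x.1 = i →
    φ ((adjGraph _).connectedComponentMk (Sum.inl x)) = true ∧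
    φ ((adjGraph _).connectedComponentMk (Sum.inr x)) = false}

variable (P) in
/-- Extend a valuation of level `i + 1` to level `i` according to a labeling. -/
def levelExtend (i : ℕ) (φ : (adjGraph (P.restrict i)).ConnectedComponent → Bool)
    (h : Fin m → List ℕ) (x : Fin m) : List ℕ :=
  if P.rank x = i then [i]
  else if hx : x ∈ P.restrict i then
    expand i (!φ ((adjGraph _).connectedComponentMk (Sum.inr ⟨x, hx⟩)))
      (φ ((adjGraph _).connectedComponentMk (Sum.inl ⟨x, hx⟩))) (h x)
  else []

section Extend

variable {i : ℕ} {φ : (adjGraph (P.restrict i)).ConnectedComponent → Bool} {h : Fin m → List ℕ}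

lemma not_mem_level_succ (hh : h ∈ P.levelInstances (i + 1)) (x : Fin m) : i ∉ h x :=
  fun hx => absurd (le_of_mem_level hh hx) (by omega)

lemma levelExtend_of_lt {x : Fin m} (hx : P.rank x < i) : P.levelExtend i φ h x = [] := by
  rw [levelExtend, if_neg hx.ne, dif_neg]
  rw [P.mem_restrict]
  omega

lemma filter_levelExtend (hh : h ∈ P.levelInstances (i + 1)) (x : Fin m) :
    (P.levelExtend i φ h x).filter (· ≠ i) = h x := by
  unfold levelExtend
  split_ifs with h₁ h₂
  · rw [hh.1 x (by omega)]; simp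
  · exact filter_expand _ _ (not_mem_level_succ hh x)
  · rw [hh.1 x (by rw [P.mem_restrict] at h₂; omega)]; simp

lemma filter_image {g : Fin m → List ℕ} (p : ℕ → Bool) :
    (P.image g).filter p = P.image fun x => (g x).filter p := by
  rw [image, List.filter_flatMap, image]

lemma alternating_levelExtend (hh : h ∈ P.levelInstances (i + 1)) (x : Fin m) :
    Alternating i (P.levelExtend i φ h x) := by
  unfold levelExtend
  split_ifs with h₁ h₂
  · simp [Alternating]
  · rw [P.mem_restrict] at h₂
    exact alternating_expand _ _ (not_mem_level_succ hh x) (ne_nil_of_level hh (by omega))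
  · simp [Alternating]

/-- On right copies the label is the negation of "begins with `i`"; this sign makes labels equal
along edges. For a variable of rank `i`, whose value begins and ends with `i`, the two labels are
those required by `levelLabels`. -/
lemma head?_levelExtend (hφ : φ ∈ P.levelLabels i) (hh : h ∈ P.levelInstances (i + 1))
    (x : {x // x ∈ P.restrict i}) : (P.levelExtend i φ h x.1).head? = some i ↔
      φ ((adjGraph _).connectedComponentMk (Sum.inr x)) = false := by
  unfold levelExtend
  split_ifs with h₁ h₂
  · simp [(hφ x h₁).2]
  · rw [P.mem_restrict] at h₂
    rw [head?_expand _ _ (not_mem_level_succ hh _) (ne_nil_of_level hh (by omega))]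
    simp
  · exact absurd x.2 h₂

lemma getLast?_levelExtend (hφ : φ ∈ P.levelLabels i) (hh : h ∈ P.levelInstances (i + 1))
    (x : {x // x ∈ P.restrict i}) : (P.levelExtend i φ h x.1).getLast? = some i ↔
      φ ((adjGraph _).connectedComponentMk (Sum.inl x)) = true := by
  unfold levelExtend
  split_ifs with h₁ h₂
  · simp [(hφ x h₁).1]
  · rw [P.mem_restrict] at h₂
    rw [getLast?_expand _ _ (not_mem_level_succ hh _) (ne_nil_of_level hh (by omega))]
  · exact absurd x.2 h₂

lemma not_mem_ziminFrom_succ (k : ℕ) : i ∉ ziminFrom k (i + 1) := by simp [ziminFrom]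

lemma isGreatest_levelExtend (hh : h ∈ P.levelInstances (i + 1)) {x : Fin m} (hx : i ≤ P.rank x) :
    IsGreatest {a | a ∈ P.levelExtend i φ h x} (P.rank x) := by
  by_cases h₁ : P.rank x = i
  · simp [levelExtend, h₁]
  · have hg := hh.2.1 x (by omega)
    have hf : ∀ a, a ≠ i → (a ∈ P.levelExtend i φ h x ↔ a ∈ h x) := by
      intro a ha
      rw [← filter_levelExtend (φ := φ) hh x]
      simp [ha]
    refine ⟨(hf _ h₁).2 hg.1, fun a ha => ?_⟩
    by_cases hai : a = i
    · rw [hai]; exact hx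
    · exact hg.2 ((hf a hai).1 ha)

/-- For a factor `xy` the vertices x^L and y^R lie in one component and have the same label, which
is the alternation across the boundary. Deleting `i` gives back `h`, which takes care of the other
letters. -/
lemma levelExtend_mem (hi : 1 ≤ i) (hiK : i < P.maxRank) (hφ : φ ∈ P.levelLabels i)
    (hh : h ∈ P.levelInstances (i + 1)) : P.levelExtend i φ h ∈ P.levelInstances i := by
  refine ⟨fun x hx => levelExtend_of_lt hx, fun x hx => isGreatest_levelExtend hh hx, ?_⟩
  rw [ziminFrom_eq_pad hi hiK.le, infix_cons_pad_iff (not_mem_ziminFrom_succ _)]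
  constructor
  · rw [P.image_eq_flatMap_restrict (i := i) fun x hx => levelExtend_of_lt hx,
      alternating_flatMap_iff fun x hx => List.ne_nil_of_mem
        (isGreatest_levelExtend hh (P.mem_restrict.1 hx)).1]
    refine ⟨fun x _ => alternating_levelExtend hh x, fun x y hxy => ?_⟩
    have hx : x ∈ P.restrict i := hxy.mem (by simp)
    have hy : y ∈ P.restrict i := hxy.mem (by simp)
    have e : (adjGraph (P.restrict i)).connectedComponentMk (Sum.inl ⟨x, hx⟩) =
        (adjGraph (P.restrict i)).connectedComponentMk (Sum.inr ⟨y, hy⟩) :=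
      SimpleGraph.ConnectedComponent.eq.2 (adj_inl_inr hxy).reachable
    rw [getLast?_levelExtend hφ hh ⟨x, hx⟩, Ne, head?_levelExtend hφ hh ⟨y, hy⟩, e]
    simp
  · rw [filter_image]
    simp only [filter_levelExtend hh]
    exact hh.2.2

/-- The labeling can be read off from the ends of the values, and the valuation of the higher level
is what remains after deleting `i`. -/
lemma levelExtend_injOn : Set.InjOn (fun p : _ × _ => P.levelExtend i p.1 p.2)
    (P.levelLabels i ×ˢ P.levelInstances (i + 1)) := by
  rintro ⟨φ, h⟩ ⟨hφ, hh⟩ ⟨ψ, g⟩ ⟨hψ, hg⟩ e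
  simp only at e hφ hh hψ hg
  refine Prod.ext ?_ ?_
  · funext c
    induction c using SimpleGraph.ConnectedComponent.ind with
    | _ v =>
      rcases v with x | x
      · have h₁ := getLast?_levelExtend hφ hh x
        have h₂ := getLast?_levelExtend hψ hg x
        rw [e, h₂] at h₁
        simp only
        rw [Bool.eq_iff_iff, h₁]
      · have h₁ := head?_levelExtend hφ hh x
        have h₂ := head?_levelExtend hψ hg x
        rw [e, h₂] at h₁
        simp only
        rw [← Bool.not_inj_iff, Bool.eq_iff_iff]
        simpa using h₁.symm
  · funext x
    simp only
    rw [← filter_levelExtend (φ := φ) hh x, ← filter_levelExtend (φ := ψ) hg x, e]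

/-- The inverse construction: delete `i` from all values and take the labels from their ends.
Alternation makes them constant along edges, hence on components. A value of rank `i` contains no
letter other than `i`, so alternation leaves it only one letter. -/
lemma exists_eq_levelExtend (hi : 1 ≤ i) (hiK : i < P.maxRank) {g : Fin m → List ℕ}
    (hg : g ∈ P.levelInstances i) : ∃ φ ∈ P.levelLabels i, ∃ h ∈ P.levelInstances (i + 1),
      P.levelExtend i φ h = g := by
  have hinf := hg.2.2
  rw [ziminFrom_eq_pad hi hiK.le, infix_cons_pad_iff (not_mem_ziminFrom_succ _), filter_image] at hinf
  obtain ⟨halt, hinf⟩ := hinf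
  rw [P.image_eq_flatMap_restrict hg.1,
    alternating_flatMap_iff fun x hx => ne_nil_of_level hg (P.mem_restrict.1 hx)] at halt
  have hsing : ∀ x, P.rank x = i → g x = [i] := by
    intro x hx
    refine (halt.1 x (P.mem_restrict.2 hx.ge)).eq_singleton (ne_nil_of_level hg hx.ge) ?_
    intro a ha
    exact le_antisymm (hx ▸ (hg.2.1 x hx.ge).2 ha) (le_of_mem_level hg ha)
  let f : Vertex (P.restrict i) → Bool := Sum.elim
    (fun x => decide ((g x.1).getLast? = some i)) (fun x => !decide ((g x.1).head? = some i))
  have hf : ∀ a b, (adjGraph (P.restrict i)).Adj a b → f a = f b := by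
    intro a b hab
    obtain ⟨x, y, hxy, ⟨rfl, rfl⟩ | ⟨rfl, rfl⟩⟩ := adj_iff.1 hab
    · have := halt.2 x y hxy
      simp [f, this]
    · have := halt.2 x y hxy
      simp [f, this]
  let φ : (adjGraph (P.restrict i)).ConnectedComponent → Bool := fun c => f c.out
  have hφ : ∀ v, φ ((adjGraph _).connectedComponentMk v) = f v := fun v =>
    eq_of_reachable hf (SimpleGraph.ConnectedComponent.eq.1 (Quot.out_eq _))
  have hφmem : φ ∈ P.levelLabels i := by
    intro x hx
    rw [hφ, hφ]
    simp [f, hsing x.1 hx]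
  have hmem : (fun x => (g x).filter (· ≠ i)) ∈ P.levelInstances (i + 1) := by
    refine ⟨fun x hx => ?_, fun x hx => ⟨?_, fun a ha => ?_⟩, hinf⟩
    · by_cases h₁ : P.rank x = i
      · simp [hsing x h₁]
      · simp [hg.1 x (by omega)]
    · simpa using ⟨(hg.2.1 x (by omega)).1, by omega⟩
    · exact (hg.2.1 x (by omega)).2 (List.mem_filter.1 ha).1
  refine ⟨φ, hφmem, _, hmem, ?_⟩
  funext x
  rcases lt_trichotomy (P.rank x) i with hx | hx | hx
  · rw [levelExtend_of_lt hx, hg.1 x hx]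
  · simp [levelExtend, hx, hsing x hx]
  · have hxr : x ∈ P.restrict i := P.mem_restrict.2 hx.le
    -- For rank above `i` something remains after deleting `i`, so an alternating word is determined
    -- by the rest and by its two ends.
    refine (alternating_levelExtend hmem x).ext (halt.1 x hxr) ?_ ?_ ?_ ?_
    · rw [filter_levelExtend hmem]
      exact ne_nil_of_level hmem hx
    · rw [filter_levelExtend hmem]
    · rw [head?_levelExtend hφmem hmem ⟨x, hxr⟩, hφ]
      simp [f]
    · rw [getLast?_levelExtend hφmem hmem ⟨x, hxr⟩, hφ]
      simp [f]

lemma levelInstances_eq_image (hi : 1 ≤ i) (hiK : i < P.maxRank) :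
    P.levelInstances i = (fun p : _ × _ => P.levelExtend i p.1 p.2) ''
      (P.levelLabels i ×ˢ P.levelInstances (i + 1)) := by
  ext g
  constructor
  · intro hg
    obtain ⟨φ, hφ, h, hh, e⟩ := exists_eq_levelExtend hi hiK hg
    exact ⟨(φ, h), ⟨hφ, hh⟩, e⟩
  · rintro ⟨⟨φ, h⟩, ⟨hφ, hh⟩, rfl⟩
    exact levelExtend_mem hi hiK hφ hh

lemma encard_levelInstances (hi : 1 ≤ i) (hiK : i < P.maxRank) :
    (P.levelInstances i).encard = (P.levelLabels i).encard * (P.levelInstances (i + 1)).encard := by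
  rw [levelInstances_eq_image hi hiK, levelExtend_injOn.encard_image, Set.encard_prod]

/-- The valuation `h` enters only through the length of its image, and the labeling only through two
bits. Hence minimal length at level `i` can be achieved by minimising the two independently. -/
lemma length_image_levelExtend (hiK : i < P.maxRank) (hi : 1 ≤ i) (hφ : φ ∈ P.levelLabels i)
    (hh : h ∈ P.levelInstances (i + 1)) (hw : P.restrict i ≠ []) :
    (P.image (P.levelExtend i φ h)).length + 1 = 2 * (P.image h).length +
      ((if φ ((adjGraph _).connectedComponentMk (Sum.inr (firstVar _ hw))) = false then 1 else 0) +
        if φ ((adjGraph _).connectedComponentMk (Sum.inl (lastVar _ hw))) = true then 1 else 0) := by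
  have hm := levelExtend_mem hi hiK hφ hh
  have hinf := hm.2.2
  rw [ziminFrom_eq_pad hi hiK.le, infix_cons_pad_iff (not_mem_ziminFrom_succ _), filter_image] at hinf
  have e : (P.image (P.levelExtend i φ h)).filter (· ≠ i) = P.image h := by
    rw [filter_image]
    simp only [filter_levelExtend hh]
  have hlen := hinf.1.length_eq (by rw [e]; exact image_ne_nil_of_level hh hiK)
  have hne : ∀ x ∈ P.restrict i, P.levelExtend i φ h x ≠ [] := fun x hx =>
    ne_nil_of_level hm (P.mem_restrict.1 hx)
  have h₁ := head?_flatMap_of_ne_nil hw hne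
  have h₂ := getLast?_flatMap_of_ne_nil hw hne
  rw [← P.image_eq_flatMap_restrict hm.1] at h₁ h₂
  have h₃ := head?_levelExtend hφ hh (firstVar _ hw)
  have h₄ := getLast?_levelExtend hφ hh (lastVar _ hw)
  rw [hlen, e, h₁, h₂]
  exact congrArg _ (congrArg₂ _ (if_congr h₃ rfl rfl) (if_congr h₄ rfl rfl))

end Extend

/-! ### Labelings -/

section Labels

variable {i : ℕ}

lemma levelLabels_eq_empty (hc : Conflict (P.restrict i) (fun x => P.rank x = i)) :
    P.levelLabels i = ∅ := by
  obtain ⟨x, y, hx, hy, hxy⟩ := hc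
  rw [Set.eq_empty_iff_forall_notMem]
  intro φ hφ
  have h₁ := (hφ x hx).1
  rw [SimpleGraph.ConnectedComponent.eq.2 hxy, (hφ y hy).2] at h₁
  exact absurd h₁ (by simp)

variable (P) in
open scoped Classical in
/-- The labeling chosen by `ShortestFirstLast`. -/
noncomputable def shortestLabel (i : ℕ) (hw : P.restrict i ≠ [])
    (c : (adjGraph (P.restrict i)).ConnectedComponent) : Bool :=
  decide (Flipped (P.restrict i) (fun x => P.rank x = i) hw c.out)

lemma shortestLabel_mk {hw : P.restrict i ≠ []} (v : Vertex (P.restrict i)) :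
    P.shortestLabel i hw ((adjGraph _).connectedComponentMk v) = true ↔
      Flipped (P.restrict i) (fun x => P.rank x = i) hw v := by
  have : (adjGraph (P.restrict i)).Reachable
      ((adjGraph (P.restrict i)).connectedComponentMk v).out v :=
    SimpleGraph.ConnectedComponent.eq.1 (Quot.out_eq _)
  rw [shortestLabel, @decide_eq_true_eq _ (_)]
  exact ⟨fun h => h.of_reachable this, fun h => h.of_reachable this.symm⟩

lemma shortestLabel_mem (hw : P.restrict i ≠ [])
    (hc : ¬ Conflict (P.restrict i) (fun x => P.rank x = i)) :
    P.shortestLabel i hw ∈ P.levelLabels i := by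
  intro x hx
  refine ⟨(shortestLabel_mk _).2 (.inl ⟨x, hx, .rfl⟩), ?_⟩
  rw [← Bool.not_eq_true, shortestLabel_mk]
  rintro (⟨y, hy, r⟩ | ⟨h, r⟩)
  · exact hc ⟨y, x, hy, hx, r⟩
  · exact (h x hx).2 r.symm

/-- If the chosen labeling lets the image begin with `i`, a new right copy lies in the component of
the first right copy and forces this on every labeling. If it lets the image end with `i`, either a
new left copy forces this too, or the last left copy lies in the same free component as the first
right copy. In the latter case these two vertices always have equal labels, so every labeling pays
for exactly one end. -/
lemma shortestLabel_minimal (hw : P.restrict i ≠ [])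
    {φ : (adjGraph (P.restrict i)).ConnectedComponent → Bool} (hφ : φ ∈ P.levelLabels i) :
    ((if P.shortestLabel i hw ((adjGraph _).connectedComponentMk (Sum.inr (firstVar _ hw))) = false
        then 1 else 0) +
      if P.shortestLabel i hw ((adjGraph _).connectedComponentMk (Sum.inl (lastVar _ hw))) = true
        then 1 else 0) ≤
    ((if φ ((adjGraph _).connectedComponentMk (Sum.inr (firstVar _ hw))) = false then 1 else 0) +
      if φ ((adjGraph _).connectedComponentMk (Sum.inl (lastVar _ hw))) = true then 1 else 0) := by
  have e₁ := shortestLabel_mk (hw := hw) (Sum.inr (firstVar _ hw))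
  have e₂ := shortestLabel_mk (hw := hw) (Sum.inl (lastVar _ hw))
  generalize P.shortestLabel i hw _ = b₁ at e₁ ⊢
  generalize P.shortestLabel i hw _ = b₂ at e₂ ⊢
  have hr : ∀ {a b}, (adjGraph (P.restrict i)).Reachable a b →
      φ ((adjGraph _).connectedComponentMk a) = φ ((adjGraph _).connectedComponentMk b) :=
    fun h => congrArg φ (SimpleGraph.ConnectedComponent.eq.2 h)
  have hfirst : b₁ = false →
      φ ((adjGraph _).connectedComponentMk (Sum.inr (firstVar _ hw))) = false := by
    intro hb
    have hF := mt e₁.2 (by simp [hb])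
    by_contra hcon
    refine hF (.inr ⟨fun x hx => ⟨fun r => hF (.inl ⟨x, hx, r⟩), fun r => ?_⟩, .rfl⟩)
    rw [← hr r, (hφ x hx).2] at hcon
    exact hcon rfl
  have hlast : b₂ = true →
      φ ((adjGraph _).connectedComponentMk (Sum.inl (lastVar _ hw))) = true ∨
      (b₁ = true ∧ φ ((adjGraph _).connectedComponentMk (Sum.inr (firstVar _ hw))) =
        φ ((adjGraph _).connectedComponentMk (Sum.inl (lastVar _ hw)))) := by
    intro hb
    rcases e₂.1 hb with ⟨x, hx, r⟩ | ⟨h, r⟩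
    · exact .inl (by rw [← hr r, (hφ x hx).1])
    · exact .inr ⟨e₁.2 (.inr ⟨h, .rfl⟩), hr r⟩
  generalize φ _ = c₁ at hfirst hlast ⊢
  generalize φ _ = c₂ at hlast ⊢
  cases b₁ <;> cases b₂ <;> cases c₁ <;> cases c₂ <;> simp_all

/-- All admissible labelings agree on the components that contain a copy of a new variable, where
`φ₀` supplies the values, and are arbitrary elsewhere. -/
lemma encard_levelLabels {φ₀ : (adjGraph (P.restrict i)).ConnectedComponent → Bool}
    (h₀ : φ₀ ∈ P.levelLabels i) : (P.levelLabels i).encard = 2 ^ P.unvaluated i := by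
  classical
  let Q : (adjGraph (P.restrict i)).ConnectedComponent → Prop := fun c =>
    ∀ x : {x // x ∈ P.restrict i}, P.rank x.1 = i → Sum.inl x ∉ c.supp ∧ Sum.inr x ∉ c.supp
  have key : ∀ φ ∈ P.levelLabels i, ∀ c, ¬ Q c → φ c = φ₀ c := by
    intro φ hφ c hc
    simp only [Q, not_forall] at hc
    obtain ⟨x, hx, hc⟩ := hc
    rw [not_and_or, not_not, not_not] at hc
    rcases hc with rfl | rfl
    · rw [(hφ x hx).1, (h₀ x hx).1]
    · rw [(hφ x hx).2, (h₀ x hx).2]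
  let e : P.levelLabels i ≃ ({c // Q c} → Bool) :=
    { toFun := fun φ c => φ.1 c.1
      invFun := fun f => ⟨fun c => if hc : Q c then f ⟨c, hc⟩ else φ₀ c, by
        intro x hx
        have h₁ : ¬ Q ((adjGraph _).connectedComponentMk (Sum.inl x)) := fun h => (h x hx).1 rfl
        have h₂ : ¬ Q ((adjGraph _).connectedComponentMk (Sum.inr x)) := fun h => (h x hx).2 rfl
        simpa only [dif_neg h₁, dif_neg h₂] using h₀ x hx⟩
      left_inv := by
        rintro ⟨φ, hφ⟩
        ext c
        by_cases hc : Q c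
        · simp [hc]
        · simp [hc, key φ hφ c hc]
      right_inv := by
        intro f
        funext c
        simp [c.2] }
  rw [Set.encard, ENat.card_congr e, ENat.card_fun, unvaluated, ENat.card_eq_coe_natCard,
    ENat.card_eq_coe_natCard]
  simp [Q]

end Labels

end RankedPattern

end ZiminMatching

/-! ### Correctness of the algorithm and the number of instances, by descent on the level. -/

namespace ZiminMatching

lemma mem_of_mem_compressFrom {a : ℕ} : ∀ {u pre : List ℕ}, a ∈ compressFrom pre u → a ∈ u
  | [], _, h => by simp [compressFrom] at h
  | b :: u, pre, h => by
    rw [compressFrom] at h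
    split_ifs at h with hc
    · exact List.mem_cons_of_mem _ (mem_of_mem_compressFrom h)
    · rcases List.mem_cons.1 h with rfl | h
      · exact List.mem_cons_self
      · exact List.mem_cons_of_mem _ (mem_of_mem_compressFrom h)

lemma mem_of_mem_compress {a : ℕ} {u : List ℕ} (h : a ∈ compress u) : a ∈ u :=
  mem_of_mem_compressFrom h

lemma compress_ne_nil {u : List ℕ} (h : u ≠ []) : compress u ≠ [] := by
  obtain ⟨a, u, rfl⟩ := List.exists_cons_of_ne_nil h
  simp [compress, compressFrom]

namespace RankedPattern

variable {m : ℕ} {P : RankedPattern m}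

lemma embeddingStep_eq_none {i : ℕ} (val : Fin m → List ℕ)
    (hc : Conflict (P.restrict i) (fun x => P.rank x = i)) : P.embeddingStep val i = none := by
  rw [embeddingStep, shortestFirstLast_eq_none _ hc]
  rfl

open scoped Classical in
lemma embeddingStep_eq_some {i : ℕ} {val : Fin m → List ℕ} (hw : P.restrict i ≠ [])
    (hc : ¬ Conflict (P.restrict i) (fun x => P.rank x = i))
    (hval : ∀ x, i < P.rank x → val x ≠ [] ∧ ∀ a ∈ val x, i < a) :
    P.embeddingStep val i = some fun x =>
      if P.rank x = i then [i]
      else if hx : x ∈ P.restrict i then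
        (if Flipped (P.restrict i) (fun x => P.rank x = i) hw (Sum.inr ⟨x, hx⟩) then [] else [i]) ++
          (val x ++
            if Flipped (P.restrict i) (fun x => P.rank x = i) hw (Sum.inl ⟨x, hx⟩) then [i] else [])
      else val x := by
  rw [embeddingStep, shortestFirstLast_eq_some _ hw hc, Option.map_some]
  congr 1
  funext x
  by_cases h₁ : P.rank x = i
  · rw [if_pos h₁, if_pos h₁]
  rw [if_neg h₁, if_neg h₁]
  by_cases h₂ : x ∈ P.restrict i
  · rw [dif_pos h₂, dif_pos h₂]
    have hx := P.mem_restrict.1 h₂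
    obtain ⟨hne, hgt⟩ := hval x (by omega)
    have hhead : (val x).head? ≠ some i := fun h =>
      absurd (hgt i (List.mem_of_mem_head? h)) (lt_irrefl _)
    have hlast : (val x).getLast? ≠ some i := fun h =>
      absurd (hgt i (List.mem_of_mem_getLast? h)) (lt_irrefl _)
    -- Since `val x` is nonempty, an `i` put in front of it is not mistaken for a final `i` by
    -- `lastInsert`.
    have hlast' : (i :: val x).getLast? ≠ some i := by
      obtain ⟨b, v, e⟩ := List.exists_cons_of_ne_nil hne
      rw [e, List.getLast?_cons_cons, ← e]
      exact hlast
    by_cases a : Flipped (P.restrict i) (fun x => P.rank x = i) hw (Sum.inr ⟨x, h₂⟩) <;>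
      by_cases b : Flipped (P.restrict i) (fun x => P.rank x = i) hw (Sum.inl ⟨x, h₂⟩) <;>
      simp [a, b, firstInsert, lastInsert, hhead, hlast, hlast']
  · rw [dif_neg h₂, dif_neg h₂]

open scoped Classical in
-- A step on compressed values computes the compression of the extension by `shortestLabel`: the
-- letters it omits are just those which compression deletes.
lemma embeddingStep_compress {i : ℕ} {h : Fin m → List ℕ} (hh : h ∈ P.levelInstances (i + 1))
    (hw : P.restrict i ≠ []) (hc : ¬ Conflict (P.restrict i) (fun x => P.rank x = i)) :
    P.embeddingStep (fun x => compress (h x)) i =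
      some fun x => compress (P.levelExtend i (P.shortestLabel i hw) h x) := by
  rw [embeddingStep_eq_some hw hc]
  · congr 1
    funext x
    unfold levelExtend
    by_cases h₁ : P.rank x = i
    · rw [if_pos h₁, if_pos h₁]
      exact (compress_singleton i).symm
    rw [if_neg h₁, if_neg h₁]
    by_cases h₂ : x ∈ P.restrict i
    · rw [dif_pos h₂, dif_pos h₂]
      have hx := P.mem_restrict.1 h₂
      rw [compress_expand _ _ (ne_nil_of_level hh (by omega)) fun a ha => le_of_mem_level hh ha]
      have e₁ := shortestLabel_mk (hw := hw) (Sum.inr ⟨x, h₂⟩)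
      have e₂ := shortestLabel_mk (hw := hw) (Sum.inl ⟨x, h₂⟩)
      congr 1
      · by_cases a : Flipped (P.restrict i) (fun x => P.rank x = i) hw (Sum.inr ⟨x, h₂⟩)
        · rw [if_pos a, e₁.2 a]; rfl
        · rw [if_neg a, Bool.eq_false_iff.2 (mt e₁.1 a)]; rfl
      · congr 1
        by_cases b : Flipped (P.restrict i) (fun x => P.rank x = i) hw (Sum.inl ⟨x, h₂⟩)
        · rw [if_pos b, e₂.2 b]; rfl
        · rw [if_neg b, Bool.eq_false_iff.2 (mt e₂.1 b)]; rfl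
    · rw [dif_neg h₂, dif_neg h₂, hh.1 x (by rw [P.mem_restrict] at h₂; omega)]
  · intro x hx
    exact ⟨compress_ne_nil (ne_nil_of_level hh hx),
      fun a ha => le_of_mem_level hh (mem_of_mem_compress ha)⟩

variable (P) in
/-- The valuation after the steps down to `i`. -/
noncomputable def embeddingUpTo (i : ℕ) : Option (Fin m → List ℕ) :=
  (List.range' i (P.maxRank - i)).reverse.foldlM P.embeddingStep P.topVal

lemma embeddingUpTo_maxRank : P.embeddingUpTo P.maxRank = some P.topVal := by
  simp [embeddingUpTo]

lemma embeddingUpTo_of_lt {i : ℕ} (hi : i < P.maxRank) : P.embeddingUpTo i =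
    (P.embeddingUpTo (i + 1)).bind fun val => P.embeddingStep val i := by
  rw [embeddingUpTo, embeddingUpTo, show P.maxRank - i = P.maxRank - (i + 1) + 1 by omega,
    List.range'_succ, List.reverse_cons, List.foldlM_append]
  simp

lemma compressedEmbedding_eq : P.compressedEmbedding =
    if (P.restrict P.maxRank).length = 1 then P.embeddingUpTo 1 else none := rfl

/-- What the algorithm knows after the steps down to `i`. -/
structure LevelCorrect (P : RankedPattern m) (i : ℕ) (h : Fin m → List ℕ) : Prop where
  mem : h ∈ P.levelInstances i
  eq : P.embeddingUpTo i = some fun x => compress (h x)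
  minimal : ∀ g ∈ P.levelInstances i, (P.image h).length ≤ (P.image g).length
  encard : (P.levelInstances i).encard = 2 ^ ∑ j ∈ Finset.Ico i P.maxRank, P.unvaluated j

/-- Any competitor is itself an extension of an instance of level `i + 1` by a labeling, so it loses
or draws on the doubled length and on the two ends separately. The count is multiplied by the number
of labelings. -/
lemma LevelCorrect.step {i : ℕ} (hi : 1 ≤ i) (hiK : i < P.maxRank) {h : Fin m → List ℕ}
    (hh : P.LevelCorrect (i + 1) h)
    (hc : ¬ Conflict (P.restrict i) (fun x => P.rank x = i)) :
    ∃ g, P.LevelCorrect i g := by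
  have hw := P.restrict_ne_nil hiK.le
  have hφ := shortestLabel_mem hw hc
  refine ⟨P.levelExtend i (P.shortestLabel i hw) h, levelExtend_mem hi hiK hφ hh.mem, ?_, ?_, ?_⟩
  · rw [embeddingUpTo_of_lt hiK, hh.eq, Option.bind_some, embeddingStep_compress hh.mem hw hc]
  · rw [levelInstances_eq_image hi hiK]
    rintro _ ⟨⟨ψ, g⟩, ⟨hψ, hg⟩, rfl⟩
    have h₁ := length_image_levelExtend hiK hi hφ hh.mem hw
    have h₂ := length_image_levelExtend hiK hi hψ hg hw
    have h₃ := hh.minimal g hg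
    have h₄ := shortestLabel_minimal hw hψ
    simp only at h₁ h₂ h₃ h₄ ⊢
    omega
  · rw [encard_levelInstances hi hiK, encard_levelLabels hφ, hh.encard, ← pow_add,
      Finset.sum_eq_sum_Ico_succ_bot hiK]

/-- A conflict leaves no labeling at that level, and then no instance at it or at any lower level,
just as a failure of the algorithm is never repaired. -/
lemma levelCorrect_or_empty (hl : (P.restrict P.maxRank).length = 1) (n : ℕ) :
    ∀ i, 1 ≤ i → i + n = P.maxRank →
    (∃ h, P.LevelCorrect i h) ∨ (P.embeddingUpTo i = none ∧ P.levelInstances i = ∅) := by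
  induction n with
  | zero =>
    rintro i hi rfl
    have huniq : P.levelInstances P.maxRank = {P.topVal} :=
      Set.eq_singleton_iff_unique_mem.2 ⟨topVal_mem_level hl, fun h hh => eq_topVal_of_level hh⟩
    refine .inl ⟨P.topVal, topVal_mem_level hl, ?_, ?_, ?_⟩
    · rw [embeddingUpTo_maxRank]
      congr 1
      funext x
      unfold topVal
      split_ifs
      · exact (compress_singleton _).symm
      · rfl
    · rw [huniq]; simp
    · rw [huniq]; simp
  | succ n ih =>
    intro i hi hin
    have hiK : i < P.maxRank := by omega
    rcases ih (i + 1) (by omega) (by omega) with ⟨h, hh⟩ | ⟨h₁, h₂⟩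
    · by_cases hc : Conflict (P.restrict i) (fun x => P.rank x = i)
      · right
        rw [embeddingUpTo_of_lt hiK, hh.eq, Option.bind_some, embeddingStep_eq_none _ hc,
          levelInstances_eq_image hi hiK, levelLabels_eq_empty hc]
        simp
      · exact .inl (hh.step hi hiK hc)
    · right
      rw [embeddingUpTo_of_lt hiK, h₁, levelInstances_eq_image hi hiK, h₂]
      simp

lemma embedding_correct {k : ℕ} (hk : ∀ x, P.rank x ≤ k) :
    (∃ h, P.IsShortestInstance k h ∧ P.compressedEmbedding = some (fun x => compress (h x)) ∧
      (P.instances k).encard = 2 ^ P.totalUnvaluated) ∨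
    (P.compressedEmbedding = none ∧ P.instances k = ∅) := by
  rw [instances_eq_levelInstances hk, compressedEmbedding_eq]
  have hK := P.one_le_maxRank
  by_cases hl : (P.restrict P.maxRank).length = 1
  · rw [if_pos hl]
    rcases levelCorrect_or_empty hl (P.maxRank - 1) 1 le_rfl (by omega) with ⟨h, hh⟩ | h
    · left
      have hi : ∀ g, P.IsInstance k g ↔ g ∈ P.levelInstances 1 := fun g => by
        rw [← instances_eq_levelInstances hk]; rfl
      exact ⟨h, ⟨(hi h).2 hh.mem, fun g hg => hh.minimal g ((hi g).1 hg)⟩, hh.eq, hh.encard⟩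
    · exact .inr h
  · right
    rw [if_neg hl]
    refine ⟨rfl, ?_⟩
    -- If the maximal rank does not occur exactly once, the top level is empty, and emptiness passes
    -- down.
    have : ∀ n i, 1 ≤ i → i + n = P.maxRank → P.levelInstances i = ∅ := by
      intro n
      induction n with
      | zero =>
        rintro i - rfl
        exact Set.eq_empty_iff_forall_notMem.2 fun h hh => hl (length_restrict_of_level hh)
      | succ n ih =>
        intro i hi hin
        rw [levelInstances_eq_image hi (by omega), ih (i + 1) (by omega) (by omega)]
        simp
    exact this (P.maxRank - 1) 1 le_rfl (by omega)

theorem embedding_and_count {k : ℕ} (hk : ∀ x, P.rank x ≤ k) :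
    (P.compressedEmbedding = none ↔ P.instances k = ∅) ∧
      (∀ val, P.compressedEmbedding = some val →
        ∃ h, P.IsShortestInstance k h ∧ ∀ x, val x = compress (h x)) ∧
      ((P.instances k).Nonempty → (P.instances k).encard = 2 ^ P.totalUnvaluated) := by
  rcases embedding_correct hk with ⟨h, h₁, h₂, h₃⟩ | ⟨h₁, h₂⟩
  · have hne : (P.instances k).Nonempty := ⟨h, h₁.1⟩
    refine ⟨by simp [h₂, hne.ne_empty], fun val hv => ⟨h, h₁, fun x => ?_⟩, fun _ => h₃⟩
    rw [h₂, Option.some.injEq] at hv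
    rw [← hv]
  · simp [h₁, h₂]

lemma ncard_instances_of_eq_none {k : ℕ} (hk : ∀ x, P.rank x ≤ k)
    (h : P.compressedEmbedding = none) : (P.instances k).ncard = 0 := by
  rw [(embedding_and_count hk).1.1 h, Set.ncard_empty]

lemma ncard_instances_of_eq_some {k : ℕ} (hk : ∀ x, P.rank x ≤ k) {val : Fin m → List ℕ}
    (h : P.compressedEmbedding = some val) :
    (P.instances k).ncard = 2 ^ P.totalUnvaluated := by
  have hne : (P.instances k).Nonempty := by
    rw [Set.nonempty_iff_ne_empty, Ne, ← (embedding_and_count hk).1, h]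
    simp
  rw [Set.ncard, (embedding_and_count hk).2.2 hne]
  exact ENat.toNat_natCast (2 ^ P.totalUnvaluated)

end RankedPattern

end ZiminMatching

namespace ZiminMatching

/-! ### Programs over several arrays -/

/-- Contents of the registers and of the arrays. -/
structure Mach : Type where
  reg : ℕ → ℕ
  arr : ℕ → ℕ → ℕ

namespace Mach

/-- Write a register. -/
def setR (h : Mach) (r v : ℕ) : Mach := ⟨Function.update h.reg r v, h.arr⟩

/-- Write an entry of an array. -/
def setA (h : Mach) (a j v : ℕ) : Mach :=
  ⟨h.reg, Function.update h.arr a (Function.update (h.arr a) j v)⟩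

@[simp] lemma setR_reg (h : Mach) (r v r' : ℕ) :
    (h.setR r v).reg r' = if r' = r then v else h.reg r' := by
  simp [setR, Function.update_apply]

@[simp] lemma setR_arr (h : Mach) (r v : ℕ) : (h.setR r v).arr = h.arr := rfl

@[simp] lemma setA_reg (h : Mach) (a j v : ℕ) : (h.setA a j v).reg = h.reg := rfl

lemma setA_arr (h : Mach) (a j v a' j' : ℕ) :
    (h.setA a j v).arr a' j' = if a' = a ∧ j' = j then v else h.arr a' j' := by
  by_cases ha : a' = a
  · subst ha
    by_cases hj : j' = j <;> simp [setA, hj]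
  · simp [setA, ha]

@[simp] lemma setA_arr_self (h : Mach) (a j v j' : ℕ) :
    (h.setA a j v).arr a j' = if j' = j then v else h.arr a j' := by
  simp [setA_arr]

@[simp] lemma setA_arr_of_ne (h : Mach) {a a' : ℕ} (j v : ℕ) (ha : a' ≠ a) :
    (h.setA a j v).arr a' = h.arr a' := by
  funext j'
  simp [setA_arr, ha]

/-- The registers outside `R` and the arrays outside `A` agree. -/
def Same (R A : List ℕ) (h h' : Mach) : Prop :=
  (∀ r, r ∉ R → h'.reg r = h.reg r) ∧ ∀ a, a ∉ A → h'.arr a = h.arr a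

lemma Same.rfl {R A : List ℕ} {h : Mach} : Same R A h h := ⟨fun _ _ => .refl _, fun _ _ => .refl _⟩

lemma Same.trans {R A : List ℕ} {h h' h'' : Mach} (H : Same R A h h') (H' : Same R A h' h'') :
    Same R A h h'' :=
  ⟨fun r hr => (H'.1 r hr).trans (H.1 r hr), fun a ha => (H'.2 a ha).trans (H.2 a ha)⟩

lemma Same.mono {R A R' A' : List ℕ} {h h' : Mach} (H : Same R A h h') (hR : R ⊆ R')
    (hA : A ⊆ A') : Same R' A' h h' :=
  ⟨fun r hr => H.1 r fun h => hr (hR h), fun a ha => H.2 a fun h => ha (hA h)⟩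

lemma Same.setR {R A : List ℕ} {h h' : Mach} (H : Same R A h h') {r : ℕ} (hr : r ∈ R) (v : ℕ) :
    Same R A h (h'.setR r v) :=
  ⟨fun r' hr' => by
    rw [setR_reg, if_neg (by rintro rfl; exact hr' hr)]; exact H.1 r' hr', fun a ha => H.2 a ha⟩

lemma Same.setA {R A : List ℕ} {h h' : Mach} (H : Same R A h h') {a : ℕ} (ha : a ∈ A) (j v : ℕ) :
    Same R A h (h'.setA a j v) :=
  ⟨fun r hr => H.1 r hr, fun a' ha' => by
    rw [setA_arr_of_ne _ _ _ (by rintro rfl; exact ha' ha)]; exact H.2 a' ha'⟩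

/-- The memory is divided into 16 arrays of length `N`. -/
def Rel (N : ℕ) (h : Mach) (s : State) : Prop :=
  s.reg = h.reg ∧ ∀ a < 16, ∀ j < N, s.mem (a * N + j) = h.arr a j

end Mach

lemma array_address_inj {N a a' j j' : ℕ} (hj : j < N) (hj' : j' < N)
    (e : a * N + j = a' * N + j') : a = a' ∧ j = j' := by
  have hN : 0 < N := by omega
  have h₁ : (a * N + j) / N = a := by
    rw [mul_comm, Nat.mul_add_div hN, Nat.div_eq_of_lt hj, add_zero]
  have h₂ : (a' * N + j') / N = a' := by
    rw [mul_comm, Nat.mul_add_div hN, Nat.div_eq_of_lt hj', add_zero]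
  have : a = a' := by rw [← h₁, ← h₂, e]
  subst this
  exact ⟨rfl, by omega⟩

/-- The program halts from every state that represents `h`; the postcondition gets the part of the
time `T` that is left. -/
def Run (B N : ℕ) (c : Prog) (h : Mach) (T : ℕ) (Q : ℕ → Mach → Prop) : Prop :=
  ∀ s, h.Rel N s → ∃ t s' h' T', Exec B c s t s' ∧ t + T' ≤ T ∧ h'.Rel N s' ∧ Q T' h'

/-- The address of an entry of an array; register 15 holds the length of the arrays. -/
def arrayAddress (a : ℕ) (e : Expr) : Expr := .add (.mul (.lit a) (.reg 15)) e

/-- Read an entry of an array. -/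
def loadA (r a : ℕ) (e : Expr) : Prog := .load r (arrayAddress a e)

/-- Write an entry of an array. -/
def storeA (a : ℕ) (e v : Expr) : Prog := .store (arrayAddress a e) v

/-- Execute the programs of a list one after the other. -/
def block (l : List Prog) : Prog := l.foldr .seq .skip

/-- Execute a program while the register `j` runs from 0 to the value of the register `b`. -/
def forLoop (j b : ℕ) (c : Prog) : Prog :=
  .seq (.assign j (.lit 0)) (.whileNonzero (.sub (.reg b) (.reg j))
    (.seq c (.assign j (.add (.reg j) (.lit 1)))))

namespace Run

variable {B N T T' : ℕ} {h : Mach} {Q Q' : ℕ → Mach → Prop} {c d : Prog} {e : Expr} {l : List Prog}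

lemma mono (H : Run B N c h T Q) (hT : T ≤ T') (hQ : ∀ t h', Q t h' → Q' t h') :
    Run B N c h T' Q' := fun s hs => by
  obtain ⟨t, s', h', t', h₁, h₂, h₃, h₄⟩ := H s hs
  exact ⟨t, s', h', t', h₁, h₂.trans hT, h₃, hQ _ _ h₄⟩

lemma skip (H : Q T h) : Run B N .skip h T Q := fun s hs =>
  ⟨0, s, h, T, .skip s, by omega, hs, H⟩

lemma assign {r : ℕ} (he : e.eval h.reg < B) (H : Q T (h.setR r (e.eval h.reg))) :
    Run B N (.assign r e) h (T + 1) Q := fun s hs => by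
  refine ⟨1, _, h.setR r _, T, .assign r e s (by rwa [hs.1]), by omega, ⟨?_, hs.2⟩, H⟩
  rw [hs.1]
  rfl

lemma load {r a : ℕ} (hB : 16 * N ≤ B) (h15 : h.reg 15 = N) (ha : a < 16) (he : e.eval h.reg < N)
    (H : Q T (h.setR r (h.arr a (e.eval h.reg)))) : Run B N (loadA r a e) h (T + 1) Q := by
  intro s hs
  have hev : (arrayAddress a e).eval s.reg = a * N + e.eval h.reg := by
    simp [arrayAddress, Expr.eval, hs.1, h15]
  refine ⟨1, _, h.setR r _, T, .load r _ s ?_, by omega, ⟨?_, hs.2⟩, H⟩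
  · rw [hev]
    have : a * N ≤ 15 * N := Nat.mul_le_mul_right _ (by omega)
    omega
  · rw [hev, hs.2 a ha _ he, hs.1]
    rfl

lemma store {a : ℕ} {v : Expr} (hB : 16 * N ≤ B) (h15 : h.reg 15 = N) (ha : a < 16)
    (he : e.eval h.reg < N) (hv : v.eval h.reg < B)
    (H : Q T (h.setA a (e.eval h.reg) (v.eval h.reg))) : Run B N (storeA a e v) h (T + 1) Q := by
  intro s hs
  have hev : (arrayAddress a e).eval s.reg = a * N + e.eval h.reg := by
    simp [arrayAddress, Expr.eval, hs.1, h15]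
  refine ⟨1, _, h.setA a _ _, T, .store _ _ s ?_ (by rwa [hs.1]), by omega, ⟨hs.1, fun a' ha' j hj => ?_⟩, H⟩
  · rw [hev]
    have : a * N ≤ 15 * N := Nat.mul_le_mul_right _ (by omega)
    omega
  · simp only [hev, Function.update_apply]
    rw [Mach.setA_arr, hs.1, hs.2 a' ha' j hj]
    refine if_congr ⟨fun e => array_address_inj hj he e, ?_⟩ rfl rfl
    rintro ⟨rfl, rfl⟩
    rfl

lemma seq (H : Run B N c h T fun T' h' => Run B N d h' T' Q) : Run B N (.seq c d) h T Q := by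
  intro s hs
  obtain ⟨t₁, s₁, h₁, T₁, a₁, a₂, a₃, a₄⟩ := H s hs
  obtain ⟨t₂, s₂, h₂, T₂, b₁, b₂, b₃, b₄⟩ := a₄ s₁ a₃
  exact ⟨_, s₂, h₂, T₂, .seq a₁ b₁, by omega, b₃, b₄⟩

lemma ite (H₁ : e.eval h.reg ≠ 0 → Run B N c h T Q) (H₂ : e.eval h.reg = 0 → Run B N d h T Q) :
    Run B N (.ifNonzero e c d) h (T + 1) Q := by
  intro s hs
  by_cases he : e.eval h.reg = 0
  · obtain ⟨t, s', h', T', a₁, a₂, a₃, a₄⟩ := H₂ he s hs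
    exact ⟨_, s', h', T', .ifFalse (by rwa [hs.1]) a₁, by omega, a₃, a₄⟩
  · obtain ⟨t, s', h', T', a₁, a₂, a₃, a₄⟩ := H₁ he s hs
    exact ⟨_, s', h', T', .ifTrue (by rwa [hs.1]) a₁, by omega, a₃, a₄⟩

/-- Every test costs one unit, so the time left decreases and serves as the termination measure.
Letting the invariant depend on it allows amortized bounds. -/
lemma whileLoop {I : ℕ → Mach → Prop}
    (hI : ∀ T h, I T h → ∃ T₀, T = T₀ + 1 ∧ (e.eval h.reg ≠ 0 → Run B N c h T₀ I) ∧
      (e.eval h.reg = 0 → Q T₀ h)) (H : I T h) : Run B N (.whileNonzero e c) h T Q := by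
  induction T using Nat.strong_induction_on generalizing h with
  | _ T ih =>
    intro s hs
    obtain ⟨T₀, rfl, h₁, h₂⟩ := hI T h H
    by_cases he : e.eval h.reg = 0
    · exact ⟨1, s, h, T₀, .whileFalse (by rwa [hs.1]), by omega, hs, h₂ he⟩
    · obtain ⟨t, s', h', T', a₁, a₂, a₃, a₄⟩ := h₁ he s hs
      obtain ⟨u, s'', h'', T'', b₁, b₂, b₃, b₄⟩ := ih T' (by omega) a₄ s' a₃
      exact ⟨_, s'', h'', T'', .whileTrue (by rwa [hs.1]) a₁ b₁, by omega, b₃, b₄⟩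

/-- Time that is not needed is left. -/
lemma frame (H : Run B N c h T Q) (R : ℕ) :
    Run B N c h (T + R) fun T' h' => ∃ t, T' = t + R ∧ Q t h' := fun s hs => by
  obtain ⟨t, s', h', T', a₁, a₂, a₃, a₄⟩ := H s hs
  exact ⟨t, s', h', T' + R, a₁, by omega, a₃, T', rfl, a₄⟩

lemma nil (H : Q T h) : Run B N (block []) h T Q := skip H

lemma cons (H : Run B N c h T fun T' h' => Run B N (block l) h' T' Q) :
    Run B N (block (c :: l)) h T Q := seq H

lemma cons_of {P : Mach → Prop} (H : Run B N c h T' fun _ h' => P h')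
    (H' : ∀ h', P h' → Run B N (block l) h' T Q) : Run B N (block (c :: l)) h (T + T') Q := by
  refine cons ((H.frame T).mono (by omega) ?_)
  rintro t h' ⟨u, rfl, hP⟩
  exact (H' h' hP).mono (by omega) fun _ _ h => h

lemma assign_cons {r : ℕ} (he : e.eval h.reg < B)
    (H : Run B N (block l) (h.setR r (e.eval h.reg)) T Q) :
    Run B N (block (.assign r e :: l)) h (T + 1) Q := cons (assign he H)

lemma load_cons {r a : ℕ} (hB : 16 * N ≤ B) (h15 : h.reg 15 = N) (ha : a < 16)
    (he : e.eval h.reg < N)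
    (H : Run B N (block l) (h.setR r (h.arr a (e.eval h.reg))) T Q) :
    Run B N (block (loadA r a e :: l)) h (T + 1) Q := cons (load hB h15 ha he H)

lemma store_cons {a : ℕ} {v : Expr} (hB : 16 * N ≤ B) (h15 : h.reg 15 = N) (ha : a < 16)
    (he : e.eval h.reg < N) (hv : v.eval h.reg < B)
    (H : Run B N (block l) (h.setA a (e.eval h.reg) (v.eval h.reg)) T Q) :
    Run B N (block (storeA a e v :: l)) h (T + 1) Q := cons (store hB h15 ha he hv H)

lemma ite_cons (H₁ : e.eval h.reg ≠ 0 → Run B N c h T fun T' h' => Run B N (block l) h' T' Q)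
    (H₂ : e.eval h.reg = 0 → Run B N d h T fun T' h' => Run B N (block l) h' T' Q) :
    Run B N (block (.ifNonzero e c d :: l)) h (T + 1) Q := cons (ite H₁ H₂)

/-- Loops with amortized time: the invariant depends on the time that is left. -/
lemma forLoop_credit {j b n : ℕ} {I : ℕ → ℕ → Mach → Prop} (hn : n < B)
    (hb : ∀ i T h, I i T h → h.reg b = n)
    (hbody : ∀ i < n, ∀ T h, I i T h → h.reg j = i →
      ∃ T₀, T = T₀ + 2 ∧ Run B N c h T₀ fun T' h' =>
        h'.reg j = i ∧ I (i + 1) T' (h'.setR j (i + 1)))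
    (hend : ∀ T h, I n T h → h.reg j = n → ∃ T₀, T = T₀ + 1 ∧ Q T₀ h)
    (H : I 0 T (h.setR j 0)) : Run B N (forLoop j b c) h (T + 1) Q := by
  refine seq (assign (by simp [Expr.eval]; omega) ?_)
  refine Run.whileLoop (I := fun T h => ∃ i ≤ n, h.reg j = i ∧ I i T h) ?_ ⟨0, by omega, by simp [Expr.eval], H⟩
  rintro T h ⟨i, hi, hj, hI⟩
  have hbi := hb i T h hI
  rcases Nat.lt_or_ge i n with hlt | hge
  · obtain ⟨T₀, rfl, hr⟩ := hbody i hlt T h hI hj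
    refine ⟨T₀ + 1, rfl, fun _ => seq ?_, fun h0 => ?_⟩
    · refine (hr.frame 1).mono le_rfl ?_
      rintro t h' ⟨t', rfl, hj', hI'⟩
      refine assign ?_ ⟨i + 1, hlt, by simp [Expr.eval, hj'], ?_⟩
      · simp [Expr.eval, hj']; omega
      · simpa [Expr.eval, hj'] using hI'
    · simp [Expr.eval, hbi, hj] at h0; omega
  · have : i = n := by omega
    subst this
    obtain ⟨T₀, rfl, hq⟩ := hend T h hI hj
    exact ⟨T₀, rfl, fun h0 => by simp [Expr.eval, hbi, hj] at h0, fun _ => hq⟩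

/-- Loops with a uniform time bound for the body. -/
lemma forLoop {j b n Tb : ℕ} {I : ℕ → Mach → Prop} {P : Mach → Prop} (hn : n < B)
    (hb : ∀ i h, I i h → h.reg b = n)
    (hbody : ∀ i < n, ∀ h, I i h → h.reg j = i →
      Run B N c h Tb fun _ h' => h'.reg j = i ∧ I (i + 1) (h'.setR j (i + 1)))
    (hend : ∀ h, I n h → h.reg j = n → P h)
    (H : I 0 (h.setR j 0)) : Run B N (forLoop j b c) h (n * (Tb + 2) + 2) fun _ h' => P h' := by
  -- Each of the remaining `n - i` rounds needs two units besides the body, for the test and the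
  -- increment; the last unit pays for the failing test.
  refine forLoop_credit (T := n * (Tb + 2) + 1)
    (I := fun i T h => T = (n - i) * (Tb + 2) + 1 ∧ I i h) hn
    (fun i T h hI => hb i h hI.2) ?_ ?_ ⟨by simp, H⟩
  · rintro i hi T h ⟨rfl, hI⟩ hj
    obtain ⟨k, hk⟩ : ∃ k, n - i = k + 1 := ⟨n - i - 1, by omega⟩
    refine ⟨k * (Tb + 2) + 1 + Tb, by rw [hk]; ring, ?_⟩
    intro s hs
    obtain ⟨t, s', h', T', a₁, a₂, a₃, a₄, a₅⟩ := hbody i hi h hI hj s hs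
    refine ⟨t, s', h', k * (Tb + 2) + 1, a₁, by omega, a₃, a₄, ?_, a₅⟩
    rw [show n - (i + 1) = k by omega]
  · rintro T h ⟨rfl, hI⟩ hj
    exact ⟨0, by simp, hend h hI hj⟩

end Run

end ZiminMatching

namespace ZiminMatching

/-! ### Breadth-first search on the adjacency graph of a word over `{0, …, m - 1}`

The left copy of `x` is the number `x`, the right copy is `m + x`; the word is given by its length
`len` and its letters `W j`. -/

namespace BFS

/-- The variable of a vertex. -/
def base (m v : ℕ) : ℕ := if v < m then v else v - m

/-- The occurrence `p` of the variable of `u` makes `v` a neighbour of `u`. -/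
def EdgeAt (m len : ℕ) (W : ℕ → ℕ) (u p v : ℕ) : Prop :=
  (u < m ∧ W p = u ∧ p + 1 < len ∧ v = m + W (p + 1)) ∨
    (m ≤ u ∧ m + W p = u ∧ 1 ≤ p ∧ p < len ∧ v = W (p - 1))

/-- Adjacency. -/
def Edge (m len : ℕ) (W : ℕ → ℕ) (u v : ℕ) : Prop := ∃ p, EdgeAt m len W u p v

/-- The vertices of the variables that occur. -/
def Present (m len : ℕ) (W : ℕ → ℕ) (v : ℕ) : Prop := ∃ j < len, v = W j ∨ v = m + W j

/-- `p` is the last occurrence of `y` before position `e`, counted from 1, or 0. -/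
def IsLast (W : ℕ → ℕ) (e y p : ℕ) : Prop :=
  p ≤ e ∧ (p = 0 ∨ W (p - 1) = y) ∧ ∀ j, p ≤ j → j < e → W j ≠ y

/-- The number of occurrences of `y` before position `e`. -/
def occ (W : ℕ → ℕ) (e y : ℕ) : ℕ := ∑ j ∈ Finset.range e, if W j = y then 1 else 0

variable {m len : ℕ} {W : ℕ → ℕ}

lemma Present.lt (hW : ∀ j < len, W j < m) {v : ℕ} (h : Present m len W v) : v < 2 * m := by
  obtain ⟨j, hj, h⟩ := h
  have := hW j hj
  omega

lemma EdgeAt.present {u p v : ℕ} (h : EdgeAt m len W u p v) : Present m len W v := by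
  rcases h with ⟨-, -, h, rfl⟩ | ⟨-, -, h₁, h, rfl⟩
  · exact ⟨p + 1, h, .inr rfl⟩
  · exact ⟨p - 1, by omega, .inl rfl⟩

lemma EdgeAt.base_eq {u p v : ℕ} (h : EdgeAt m len W u p v) : W p = base m u := by
  unfold base
  rcases h with ⟨h, rfl, -, -⟩ | ⟨h, h', -, -, -⟩
  · rw [if_pos h]
  · rw [if_neg (by omega)]; omega

lemma EdgeAt.lt {u p v : ℕ} (h : EdgeAt m len W u p v) : p < len := by
  rcases h with ⟨-, -, h, -⟩ | ⟨-, -, -, h, -⟩ <;> omega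

lemma Edge.symm (hW : ∀ j < len, W j < m) {u v : ℕ} (h : Edge m len W u v) : Edge m len W v u := by
  obtain ⟨p, ⟨h₁, h₂, h₃, rfl⟩ | ⟨h₁, h₂, h₃, h₄, rfl⟩⟩ := h
  · exact ⟨p + 1, .inr ⟨by omega, rfl, by omega, h₃, by simpa using h₂.symm⟩⟩
  · exact ⟨p - 1, .inl ⟨hW _ (by omega), rfl, by omega, by rw [Nat.sub_add_cancel h₃, h₂]⟩⟩

lemma occ_succ (e y : ℕ) : occ W (e + 1) y = occ W e y + if W e = y then 1 else 0 :=
  Finset.sum_range_succ _ _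

/-- Jumping from `e` back to the linked position skips no occurrence, so walking through the list of
a variable takes as many rounds as the variable has occurrences. -/
lemma occ_eq_of_isLast {e y p : ℕ} (h : IsLast W e y p) : occ W e y = occ W p y := by
  obtain ⟨hp, -, h⟩ := h
  rw [occ, occ, ← Finset.sum_range_add_sum_Ico _ hp, Nat.add_eq_left]
  refine Finset.sum_eq_zero fun j hj => ?_
  rw [Finset.mem_Ico] at hj
  rw [if_neg (h j hj.1 hj.2)]

lemma sum_occ (hW : ∀ j < len, W j < m) : ∑ y ∈ Finset.range m, occ W len y = len := by
  simp only [occ]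
  rw [Finset.sum_comm]
  have : ∀ j ∈ Finset.range len, (∑ y ∈ Finset.range m, if W j = y then 1 else 0) = 1 := by
    intro j hj
    rw [Finset.sum_ite_eq, if_pos]
    exact Finset.mem_range.2 (hW j (Finset.mem_range.1 hj))
  rw [Finset.sum_congr rfl this]
  simp

/-- The state of the search between two visits: `lab` are the labels, `Q` the queue with `qt`
entries, `c` the number of components so far. -/
structure Core (m len : ℕ) (W lab Q : ℕ → ℕ) (c qt : ℕ) : Prop where
  inj : ∀ i < qt, ∀ j < qt, Q i = Q j → i = j
  present : ∀ j < qt, Present m len W (Q j)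
  pos : ∀ j < qt, lab (Q j) ≠ 0
  mem : ∀ v < 2 * m, lab v ≠ 0 → ∃ j < qt, Q j = v
  le : ∀ v < 2 * m, lab v ≤ c
  conn : ∀ u < 2 * m, ∀ v < 2 * m, lab u ≠ 0 → lab u = lab v →
    Relation.EqvGen (Edge m len W) u v
  surj : ∀ d, 1 ≤ d → d ≤ c → ∃ j < qt, lab (Q j) = d
  le_qt : c ≤ qt

/-- The first `qh` vertices of the queue have all their neighbours in their component. -/
def Closed (m len : ℕ) (W lab Q : ℕ → ℕ) (qh : ℕ) : Prop :=
  ∀ j < qh, ∀ v, Edge m len W (Q j) v → lab v = lab (Q j)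

/-- The vertices of the queue from `qh` on belong to the current component. -/
def Current (lab Q : ℕ → ℕ) (c qh qt : ℕ) : Prop := ∀ j, qh ≤ j → j < qt → lab (Q j) = c

/-- The time reserved for a vertex. -/
def cost (m len : ℕ) (W : ℕ → ℕ) (v : ℕ) : ℕ := 10 + 20 * occ W len (base m v)

/-- The time reserved for the vertices that have not been dequeued. -/
def pot (m len : ℕ) (W lab Q : ℕ → ℕ) (qh qt : ℕ) : ℕ :=
  (∑ v ∈ Finset.range (2 * m), if lab v = 0 then cost m len W v else 0) +
    ∑ j ∈ Finset.Ico qh qt, cost m len W (Q j)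

lemma Core.qt_le {lab Q : ℕ → ℕ} {c qt : ℕ} (hW : ∀ j < len, W j < m)
    (h : Core m len W lab Q c qt) : qt ≤ 2 * m := by
  have := Finset.card_le_card_of_injOn (s := Finset.range qt) (t := Finset.range (2 * m)) Q
    (fun j hj => by
      have := (h.present j (by simpa using hj)).lt hW
      simpa using this)
    (fun i hi j hj e => h.inj i (by simpa using hi) j (by simpa using hj) e)
  simpa using this

lemma Core.empty {lab Q : ℕ → ℕ} (h : ∀ v < 2 * m, lab v = 0) : Core m len W lab Q 0 0 where
  inj := by simp
  present := by simp
  pos := by simp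
  mem v hv h' := absurd (h v hv) h'
  le v hv := by simp [h v hv]
  conn u hu _ _ h' := absurd (h u hu) h'
  surj d h₁ h₂ := by omega
  le_qt := le_rfl

section Push

variable {lab Q : ℕ → ℕ} {c d qt v : ℕ}

lemma Core.queue_ne (h : Core m len W lab Q c qt) (h0 : lab v = 0) {j : ℕ} (hj : j < qt) :
    Q j ≠ v := fun e => h.pos j hj (e ▸ h0)

/-- Label a new vertex and append it to the queue. -/
lemma Core.push (h : Core m len W lab Q c qt)
    (hv : Present m len W v) (h0 : lab v = 0)
    (hd : d = c + 1 ∨ d = c ∧ 1 ≤ c ∧ ∃ u < 2 * m, lab u = c ∧ Relation.EqvGen (Edge m len W) u v) :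
    Core m len W (Function.update lab v d) (Function.update Q qt v) d (qt + 1) := by
  have hd0 : d ≠ 0 := by omega
  have hQ : ∀ j < qt, Function.update Q qt v j = Q j := fun j hj =>
    Function.update_of_ne hj.ne _ _
  have hQt : Function.update Q qt v qt = v := Function.update_self _ _ _
  have hlv : Function.update lab v d v = d := Function.update_self _ _ _
  have hl : ∀ x, x ≠ v → Function.update lab v d x = lab x := fun x hx =>
    Function.update_of_ne hx _ _
  -- A fresh label has no other bearer; with the current label every bearer is connected to `u`,
  -- hence to `v`.
  have hcon : ∀ x < 2 * m, x ≠ v → lab x = d → Relation.EqvGen (Edge m len W) x v := by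
    intro x hx hxv hxd
    rcases hd with rfl | ⟨rfl, h1, u, hu, hu', r⟩
    · have := h.le x hx
      omega
    · exact (h.conn x hx u hu (by omega) (by omega)).trans _ _ _ r
  refine ⟨?_, ?_, ?_, ?_, ?_, ?_, ?_, ?_⟩
  · intro i hi j hj e
    rcases Nat.lt_succ_iff_lt_or_eq.1 hi with hi | rfl <;>
      rcases Nat.lt_succ_iff_lt_or_eq.1 hj with hj | rfl
    · rw [hQ i hi, hQ j hj] at e
      exact h.inj i hi j hj e
    · rw [hQ i hi, hQt] at e
      exact absurd e (h.queue_ne h0 hi)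
    · rw [hQ j hj, hQt] at e
      exact absurd e.symm (h.queue_ne h0 hj)
    · rfl
  · intro j hj
    rcases Nat.lt_succ_iff_lt_or_eq.1 hj with hj | rfl
    · rw [hQ j hj]; exact h.present j hj
    · rwa [hQt]
  · intro j hj
    rcases Nat.lt_succ_iff_lt_or_eq.1 hj with hj | rfl
    · rw [hQ j hj, hl _ (h.queue_ne h0 hj)]; exact h.pos j hj
    · rwa [hQt, hlv]
  · intro x hx hx0
    by_cases hxv : x = v
    · exact ⟨qt, by omega, by rw [hQt, hxv]⟩
    · rw [hl x hxv] at hx0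
      obtain ⟨j, hj, e⟩ := h.mem x hx hx0
      exact ⟨j, by omega, by rw [hQ j hj, e]⟩
  · intro x hx
    by_cases hxv : x = v
    · rw [hxv, hlv]
    · rw [hl x hxv]
      have := h.le x hx
      omega
  · intro x hx y hy hx0 e
    by_cases hxv : x = v <;> by_cases hyv : y = v
    · subst hxv; subst hyv; exact .refl _
    · subst hxv
      rw [hlv, hl y hyv] at e
      exact (hcon y hy hyv e.symm).symm
    · subst hyv
      rw [hlv, hl x hxv] at e
      exact hcon x hx hxv e
    · rw [hl x hxv] at hx0 e
      rw [hl y hyv] at e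
      exact h.conn x hx y hy hx0 e
  · intro b hb1 hbd
    by_cases hb : b ≤ c
    · obtain ⟨j, hj, e⟩ := h.surj b hb1 hb
      exact ⟨j, by omega, by rw [hQ j hj, hl _ (h.queue_ne h0 hj), e]⟩
    · exact ⟨qt, by omega, by rw [hQt, hlv]; omega⟩
  · have := h.le_qt
    omega

/-- Neighbours of a closed vertex already share its nonzero label, so the unlabelled `v` is none of
them. -/
lemma Closed.push {qh : ℕ} (h : Core m len W lab Q c qt) (hq : qh ≤ qt)
    (hcl : Closed m len W lab Q qh) (h0 : lab v = 0) :
    Closed m len W (Function.update lab v d) (Function.update Q qt v) qh := by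
  intro j hj x hx
  rw [Function.update_of_ne (by omega : j ≠ qt)] at hx ⊢
  have hne := h.queue_ne h0 (j := j) (by omega)
  have := hcl j hj x hx
  rw [Function.update_of_ne hne, Function.update_of_ne, this]
  rintro rfl
  exact h.pos j (by omega) (by omega)

lemma Current.push {qh : ℕ} (h : Core m len W lab Q c qt)
    (hcur : Current lab Q c qh qt) (h0 : lab v = 0) :
    Current (Function.update lab v c) (Function.update Q qt v) c qh (qt + 1) := by
  intro j hj hjt
  rcases Nat.lt_succ_iff_lt_or_eq.1 hjt with hjt | rfl
  · rw [Function.update_of_ne hjt.ne, Function.update_of_ne (h.queue_ne h0 hjt)]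
    exact hcur j hj hjt
  · rw [Function.update_self, Function.update_self]

/-- The reserve of `v` moves from the sum over unlabelled vertices to the sum over the queue.
Enqueuing is thus free, and the reserve is released when the vertex is dequeued. -/
lemma pot_push {qh : ℕ} (hv : v < 2 * m) (h0 : lab v = 0) (hd : d ≠ 0) (hq : qh ≤ qt) :
    pot m len W (Function.update lab v d) (Function.update Q qt v) qh (qt + 1) =
      pot m len W lab Q qh qt := by
  have hmem : v ∈ Finset.range (2 * m) := Finset.mem_range.2 hv
  have h₁ : ∑ x ∈ Finset.range (2 * m),
      (if Function.update lab v d x = 0 then cost m len W x else 0) + cost m len W v =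
      ∑ x ∈ Finset.range (2 * m), if lab x = 0 then cost m len W x else 0 := by
    rw [← Finset.sum_erase_add _ _ hmem, ← Finset.sum_erase_add (Finset.range (2 * m))
      (fun x => if lab x = 0 then cost m len W x else 0) hmem]
    simp only [Function.update_self, hd, h0, if_true, if_false, add_zero]
    congr 1
    refine Finset.sum_congr rfl fun x hx => ?_
    rw [Function.update_of_ne (Finset.ne_of_mem_erase hx)]
  have h₂ : ∑ j ∈ Finset.Ico qh (qt + 1), cost m len W (Function.update Q qt v j) =
      ∑ j ∈ Finset.Ico qh qt, cost m len W (Q j) + cost m len W v := by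
    rw [Finset.sum_Ico_succ_top hq, Function.update_self]
    congr 1
    refine Finset.sum_congr rfl fun j hj => ?_
    rw [Finset.mem_Ico] at hj
    rw [Function.update_of_ne (by omega)]
  rw [pot, pot, h₂]
  omega

end Push

lemma pot_pop {lab Q : ℕ → ℕ} {qh qt : ℕ} (hq : qh < qt) : pot m len W lab Q qh qt =
    pot m len W lab Q (qh + 1) qt + cost m len W (Q qh) := by
  rw [pot, pot, Finset.sum_eq_sum_Ico_succ_bot hq]
  omega

/-- There are 2m vertices with a constant share of 10, and each occurrence is counted with weight 20
for both copies of its variable. -/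
lemma pot_empty {lab Q : ℕ → ℕ} (hW : ∀ j < len, W j < m) (h : ∀ v < 2 * m, lab v = 0) :
    pot m len W lab Q 0 0 = 20 * m + 40 * len := by
  have h₁ : ∑ v ∈ Finset.range (2 * m), (if lab v = 0 then cost m len W v else 0) =
      ∑ v ∈ Finset.range (2 * m), cost m len W v :=
    Finset.sum_congr rfl fun v hv => if_pos (h v (Finset.mem_range.1 hv))
  have h₂ : ∑ v ∈ Finset.range (2 * m), occ W len (base m v) = 2 * len := by
    rw [two_mul m, Finset.sum_range_add, two_mul]
    congr 1
    · refine (Finset.sum_congr rfl fun v hv => ?_).trans (sum_occ hW)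
      rw [base, if_pos (Finset.mem_range.1 hv)]
    · refine (Finset.sum_congr rfl fun v hv => ?_).trans (sum_occ hW)
      rw [base, if_neg (by omega), Nat.add_sub_cancel_left]
  rw [pot, h₁]
  simp only [cost, Finset.sum_add_distrib, ← Finset.mul_sum, h₂]
  simp
  ring

/-- A labelled neighbour of a vertex of the current component belongs to it. -/
lemma lab_eq_of_edge {lab Q : ℕ → ℕ} {c qh qt u v : ℕ} (hW : ∀ j < len, W j < m)
    (h : Core m len W lab Q c qt) (hcl : Closed m len W lab Q qh)
    (hcur : Current lab Q c qh qt) (hu : lab u = c) (e : Edge m len W u v) (hv : lab v ≠ 0) :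
    lab v = c := by
  obtain ⟨j, hj, rfl⟩ := h.mem v (by obtain ⟨p, e⟩ := e; exact e.present.lt hW) hv
  rcases Nat.lt_or_ge j qh with hlt | hge
  · rw [← hcl j hlt u (e.symm hW), hu]
  · exact hcur j hge hj

end BFS

end ZiminMatching

namespace ZiminMatching

namespace BFS

/-! ### The search as a program -/

/-- Nonzero iff the vertex in register 13 is a right copy. -/
def isRight : Expr := .sub (.add (.reg 13) (.lit 1)) (.reg 1)

/-- Put into register 14 the neighbour of the vertex in register 13 that belongs to the occurrence
in register 12, or the vertex itself if there is none. -/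
def neighbourProg : Prog := block [
  .assign 14 (.reg 13),
  .ifNonzero isRight
    (.ifNonzero (.sub (.reg 12) (.lit 1)) (loadA 14 1 (.sub (.reg 12) (.lit 2))) .skip)
    (.ifNonzero (.sub (.reg 7) (.reg 12))
      (block [loadA 14 1 (.reg 12), .assign 14 (.add (.reg 14) (.reg 1))]) .skip)]

/-- Append the vertex in register 14 to the queue with the label in register 8. -/
def pushProg : Prog := block [
  storeA 4 (.reg 14) (.reg 8), storeA 5 (.reg 17) (.reg 14), .assign 17 (.add (.reg 17) (.lit 1))]

/-- Dequeue a vertex and visit its neighbours. -/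
def expandProg : Prog := block [
  loadA 13 5 (.reg 16),
  .assign 16 (.add (.reg 16) (.lit 1)),
  .ifNonzero isRight (loadA 12 3 (.sub (.reg 13) (.reg 1))) (loadA 12 3 (.reg 13)),
  .whileNonzero (.reg 12) (block [
    neighbourProg,
    loadA 18 4 (.reg 14),
    .ifNonzero (.reg 18) .skip pushProg,
    loadA 12 2 (.sub (.reg 12) (.lit 1))])]

/-- Search the component of the vertex in register 14 unless it has a label. -/
def rootProg : Prog := block [
  loadA 18 4 (.reg 14),
  .ifNonzero (.reg 18) .skip (block [
    .assign 8 (.add (.reg 8) (.lit 1)),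
    pushProg,
    .whileNonzero (.sub (.reg 17) (.reg 16)) expandProg])]

/-- Label the connected components. -/
def componentsProg : Prog := block [
  .assign 8 (.lit 0), .assign 16 (.lit 0), .assign 17 (.lit 0),
  forLoop 10 7 (block [
    loadA 11 1 (.reg 10),
    .assign 14 (.reg 11), rootProg,
    .assign 14 (.add (.reg 11) (.reg 1)), rootProg])]

/-- The data of the search: the word and the lists of occurrences. -/
structure Input (B N m len : ℕ) (W prv lst : ℕ → ℕ) : Prop where
  hB : 16 * N ≤ B
  m_lt : 2 * m < N
  len_lt : len < N
  lt_m : ∀ j < len, W j < m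
  prv_last : ∀ j < len, IsLast W j (W j) (prv j)
  lst_last : ∀ y < m, IsLast W len y (lst y)

/-- The machine holds the data of the search. -/
structure Holds (N m len : ℕ) (W prv lst : ℕ → ℕ) (h : Mach) : Prop where
  reg15 : h.reg 15 = N
  reg1 : h.reg 1 = m
  reg7 : h.reg 7 = len
  arr1 : h.arr 1 = W
  arr2 : h.arr 2 = prv
  arr3 : h.arr 3 = lst

lemma Holds.same {N m len : ℕ} {W prv lst : ℕ → ℕ} {h h' : Mach} {R A : List ℕ}
    (H : Holds N m len W prv lst h) (S : Mach.Same R A h h')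
    (hR : 15 ∉ R ∧ 1 ∉ R ∧ 7 ∉ R) (hA : 1 ∉ A ∧ 2 ∉ A ∧ 3 ∉ A) : Holds N m len W prv lst h' :=
  ⟨(S.1 _ hR.1).trans H.reg15, (S.1 _ hR.2.1).trans H.reg1, (S.1 _ hR.2.2).trans H.reg7,
    (S.2 _ hA.1).trans H.arr1, (S.2 _ hA.2.1).trans H.arr2, (S.2 _ hA.2.2).trans H.arr3⟩

variable {B N m len : ℕ} {W prv lst : ℕ → ℕ}

/-- At an end of the word the required neighbour may be missing. Then `u` itself is returned, which
the caller finds labelled, so no separate case is needed in the loop. -/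
lemma run_neighbourProg {h : Mach} (D : Input B N m len W prv lst) (H : Holds N m len W prv lst h)
    {u e : ℕ} (hu : h.reg 13 = u) (hu2 : u < 2 * m) (he : h.reg 12 = e + 1) (hel : e < len)
    (hb : W e = base m u) :
    Run B N neighbourProg h 6 fun _ h' => Mach.Same [14] [] h h' ∧
      (h'.reg 14 = u ∧ (∀ v, ¬ EdgeAt m len W u e v) ∨ EdgeAt m len W u e (h'.reg 14)) := by
  have hN := D.hB
  have h2 := D.m_lt
  have h3 := D.len_lt
  have h15 := H.reg15
  have h1 := H.reg1
  have h7 := H.reg7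
  have ha := H.arr1
  refine (Run.assign_cons (T := 5) ?_ ?_).mono le_rfl fun _ _ h => h
  · simp [Expr.eval, hu]; omega
  have hS : Mach.Same [14] [] h (h.setR 14 (Expr.eval h.reg (.reg 13))) := Mach.Same.rfl.setR (by simp) _
  refine Run.ite_cons (T := 4) (fun hc => ?_) (fun hc => ?_)
  · simp [isRight, Expr.eval, hu, h1] at hc
    refine Run.ite (T := 3) (fun hd => ?_) (fun hd => ?_)
    · simp [Expr.eval, he] at hd
      refine Run.load (T := 2) hN (by simpa using h15) (by norm_num) ?_ (Run.nil ⟨hS.setR (by simp) _, .inr ?_⟩)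
      · simp [Expr.eval, he]; omega
      · simp only [Expr.eval, Mach.setR_reg, Mach.setR_arr, ha, he, if_true]
        norm_num
        refine .inr ⟨by omega, ?_, by omega, hel, by congr 1⟩
        rw [hb, base, if_neg (by omega)]
        omega
    · simp [Expr.eval, he] at hd
      refine Run.skip (Run.nil ⟨hS, .inl ⟨by simp [Expr.eval, hu], fun v hv => ?_⟩⟩)
      rcases hv with ⟨h, -⟩ | ⟨-, -, h, -⟩ <;> omega
  · simp [isRight, Expr.eval, hu, h1] at hc
    refine Run.ite (T := 3) (fun hd => ?_) (fun hd => ?_)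
    · simp [Expr.eval, he, h7] at hd
      refine Run.load_cons (T := 2) hN (by simpa using h15) (by norm_num) ?_ ?_
      · simp [Expr.eval, he]; omega
      have hwlt := D.lt_m (e + 1) (by omega)
      refine Run.assign_cons (T := 1) ?_ (Run.nil (Run.nil ⟨(hS.setR (by simp) _).setR (by simp) _, .inr ?_⟩))
      · simp [Expr.eval, he, ha, h1]
        omega
      · simp [Expr.eval, he, ha, h1]
        refine .inl ⟨by omega, ?_, by omega, by omega⟩
        rw [hb, base, if_pos (by omega)]
    · simp [Expr.eval, he, h7] at hd
      refine Run.skip (Run.nil ⟨hS, .inl ⟨by simp [Expr.eval, hu], fun v hv => ?_⟩⟩)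
      rcases hv with ⟨-, -, h, -⟩ | ⟨h, -⟩ <;> omega

lemma run_pushProg {h : Mach} {v c qt : ℕ} (hB : 16 * N ≤ B) (h15 : h.reg 15 = N)
    (hv : h.reg 14 = v) (hc : h.reg 8 = c) (hq : h.reg 17 = qt) (hvN : v < N) (hcN : c < N)
    (hqN : qt < N) : Run B N pushProg h 3 fun _ h' => Mach.Same [17] [4, 5] h h' ∧
      h'.reg 17 = qt + 1 ∧ h'.arr 4 = Function.update (h.arr 4) v c ∧
      h'.arr 5 = Function.update (h.arr 5) qt v := by
  refine Run.store_cons hB h15 (by norm_num) ?_ ?_ (Run.store_cons hB h15 (by norm_num) ?_ ?_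
    (Run.assign_cons (T := 0) ?_ (Run.nil ⟨?_, ?_, ?_, ?_⟩)))
  · simp [Expr.eval, hv]; omega
  · simp [Expr.eval, hc]; omega
  · simp [Expr.eval, hq]; omega
  · simp [Expr.eval, hv]; omega
  · simp [Expr.eval, hq]; omega
  · exact ((Mach.Same.rfl.setA (by simp) _ _).setA (by simp) _ _).setR (by simp) _
  · simp [Expr.eval, hq]
  · funext j; simp [Expr.eval, hv, hc, Function.update_apply]
  · funext j; simp [Expr.eval, hv, hq, Function.update_apply]

/-- The search inside a component. -/
structure Inside (N m len : ℕ) (W prv lst : ℕ → ℕ) (h₀ h : Mach) (c qh qt : ℕ) : Prop where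
  same : Mach.Same [12, 13, 14, 16, 17, 18] [4, 5] h₀ h
  holds : Holds N m len W prv lst h
  reg8 : h.reg 8 = c
  reg16 : h.reg 16 = qh
  reg17 : h.reg 17 = qt
  le : qh ≤ qt
  c_pos : 1 ≤ c
  core : Core m len W (h.arr 4) (h.arr 5) c qt
  mono : ∀ v, h₀.arr 4 v ≠ 0 → h.arr 4 v ≠ 0

/-- The loop over the occurrences of a variable. -/
lemma run_neighbours {h₀ h : Mach} (D : Input B N m len W prv lst) {c qh qt u R T : ℕ}
    (H : Inside N m len W prv lst h₀ h c (qh + 1) qt)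
    (hcl : Closed m len W (h.arr 4) (h.arr 5) qh)
    (hcur : Current (h.arr 4) (h.arr 5) c qh qt)
    (hu : h.reg 13 = u) (hQ : h.arr 5 qh = u)
    (he : IsLast W len (base m u) (h.reg 12))
    (hT : pot m len W (h.arr 4) (h.arr 5) (qh + 1) qt + 20 * occ W len (base m u) + R + 1 ≤ T) :
    Run B N (.whileNonzero (.reg 12) (block [neighbourProg, loadA 18 4 (.reg 14),
      .ifNonzero (.reg 18) .skip pushProg, loadA 12 2 (.sub (.reg 12) (.lit 1))])) h T
      fun T' h' => ∃ qt', Inside N m len W prv lst h₀ h' c (qh + 1) qt' ∧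
        Closed m len W (h'.arr 4) (h'.arr 5) (qh + 1) ∧
        Current (h'.arr 4) (h'.arr 5) c (qh + 1) qt' ∧
        pot m len W (h'.arr 4) (h'.arr 5) (qh + 1) qt' + R ≤ T' := by
  have hN := D.hB
  have h2 := D.m_lt
  have h3 := D.len_lt
  -- Invariant: the neighbours of `u` through the occurrences from position `e` on carry the label
  -- `c`, and 20 units are still available for each earlier occurrence.
  refine Run.whileLoop (I := fun T h => ∃ qt e, Inside N m len W prv lst h₀ h c (qh + 1) qt ∧
    Closed m len W (h.arr 4) (h.arr 5) qh ∧ Current (h.arr 4) (h.arr 5) c qh qt ∧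
    h.reg 13 = u ∧ h.arr 5 qh = u ∧ h.reg 12 = e ∧ e ≤ len ∧ (e = 0 ∨ W (e - 1) = base m u) ∧
    (∀ p, e ≤ p → ∀ v, EdgeAt m len W u p v → h.arr 4 v = c) ∧
    pot m len W (h.arr 4) (h.arr 5) (qh + 1) qt + 20 * occ W e (base m u) + R + 1 ≤ T) ?_
    ⟨qt, _, H, hcl, hcur, hu, hQ, rfl, he.1, he.2.1,
      fun p hp v hv => absurd hv.base_eq (he.2.2 p hp hv.lt), by
        rw [← occ_eq_of_isLast he]; exact hT⟩
  clear hT he hQ hu hcur hcl H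
  rintro T h ⟨qt, e, H, hcl, hcur, hu, hQ, he, hel, hb, hpart, hT⟩
  have hle := H.le
  have hlu : h.arr 4 u = c := by rw [← hQ]; exact hcur qh le_rfl (by omega)
  have hu2 : u < 2 * m := by
    rw [← hQ]; exact (H.core.present qh (by omega)).lt D.lt_m
  obtain ⟨T, rfl⟩ : ∃ T', T = T' + 1 := ⟨T - 1, by omega⟩
  refine ⟨T, rfl, fun h0 => ?_, fun h0 => ?_⟩
  · simp [Expr.eval, he] at h0
    obtain ⟨e, rfl⟩ : ∃ e', e = e' + 1 := ⟨e - 1, by omega⟩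
    have hb := hb.resolve_left h0
    simp only [Nat.add_sub_cancel] at hb
    have hlast := D.prv_last e (by omega)
    have hocc : occ W (e + 1) (base m u) = occ W (prv e) (base m u) + 1 := by
      rw [occ_succ, if_pos hb, ← hb, occ_eq_of_isLast hlast]
    obtain ⟨T, rfl⟩ : ∃ T', T = T' + 12 := ⟨T - 12, by omega⟩
    refine (Run.cons_of (T := T + 6) (run_neighbourProg D H.holds hu hu2 he hel hb) ?_)
    rintro h₁ ⟨hS₁, hv⟩
    set v := h₁.reg 14 with hvdef
    have hv2 : v < 2 * m := by
      rcases hv with ⟨hv, -⟩ | hv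
      · omega
      · exact hv.present.lt D.lt_m
    have hH₁ := H.holds.same hS₁ (by decide) (by decide)
    have hq2 := H.core.qt_le D.lt_m
    have hc2 := H.core.le_qt
    have a4 : h₁.arr 4 = h.arr 4 := hS₁.2 4 (by decide)
    have a5 : h₁.arr 5 = h.arr 5 := hS₁.2 5 (by decide)
    refine Run.load_cons (T := T + 5) hN hH₁.reg15 (by norm_num) (by simp [Expr.eval]; omega) ?_
    set h₂ := h₁.setR 18 (h₁.arr 4 (Expr.eval h₁.reg (.reg 14))) with hh₂
    have hS₂ : Mach.Same [14, 18] [] h h₂ := (hS₁.mono (by simp) (by simp)).setR (by simp) _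
    have hH₂ := H.holds.same hS₂ (by decide) (by decide)
    have r18 : h₂.reg 18 = h.arr 4 v := by simp only [hh₂, Expr.eval, a4, Mach.setR_reg, if_true]; rfl
    have b4 : h₂.arr 4 = h.arr 4 := hS₂.2 4 (by decide)
    have b5 : h₂.arr 5 = h.arr 5 := hS₂.2 5 (by decide)
    -- An occurrence gives `u` at most one neighbour, so the occurrence is settled once `v` is
    -- labelled.
    have hEdge : ∀ x, EdgeAt m len W u e x → x = v := by
      rcases hv with ⟨-, hv⟩ | hv
      · exact fun x hx => absurd hx (hv x)
      · intro x hx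
        rcases hv with ⟨_, _, _, e₁⟩ | ⟨_, _, _, _, e₁⟩ <;>
          rcases hx with ⟨_, _, _, e₂⟩ | ⟨_, _, _, _, e₂⟩ <;> omega
    have hfin : ∀ h₃ qt' T', Inside N m len W prv lst h₀ h₃ c (qh + 1) qt' →
        Closed m len W (h₃.arr 4) (h₃.arr 5) qh → Current (h₃.arr 4) (h₃.arr 5) c qh qt' →
        h₃.reg 13 = u → h₃.arr 5 qh = u → h₃.reg 12 = e + 1 → h₃.arr 4 v = c →
        (∀ x, h.arr 4 x ≠ 0 → h₃.arr 4 x = h.arr 4 x) →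
        pot m len W (h₃.arr 4) (h₃.arr 5) (qh + 1) qt' =
          pot m len W (h.arr 4) (h.arr 5) (qh + 1) qt → T + 1 ≤ T' →
        Run B N (block [loadA 12 2 (.sub (.reg 12) (.lit 1))]) h₃ T' fun T h => ∃ qt e,
          Inside N m len W prv lst h₀ h c (qh + 1) qt ∧
          Closed m len W (h.arr 4) (h.arr 5) qh ∧ Current (h.arr 4) (h.arr 5) c qh qt ∧
          h.reg 13 = u ∧ h.arr 5 qh = u ∧ h.reg 12 = e ∧ e ≤ len ∧
          (e = 0 ∨ W (e - 1) = base m u) ∧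
          (∀ p, e ≤ p → ∀ v, EdgeAt m len W u p v → h.arr 4 v = c) ∧
          pot m len W (h.arr 4) (h.arr 5) (qh + 1) qt + 20 * occ W e (base m u) + R + 1 ≤ T := by
      intro h₃ qt' T' H₃ cl₃ cur₃ r13 q5 r12 lv hlab hpot hTT
      refine Run.mono (T := T + 1) ?_ hTT fun _ _ h => h
      refine Run.load_cons (T := T) hN H₃.holds.reg15 (by norm_num)
        (by simp [Expr.eval, r12]; omega) (Run.nil ?_)
      have hE : h₃.arr 2 (Expr.eval h₃.reg (.sub (.reg 12) (.lit 1))) = prv e := by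
        simp [Expr.eval, r12, H₃.holds.arr2]
      rw [hE]
      have hS := Mach.Same.rfl (R := [12]) (A := []) (h := h₃) |>.setR (r := 12) (by simp) (prv e)
      refine ⟨qt', prv e, ⟨H₃.same.setR (by simp) _, H₃.holds.same hS (by decide) (by decide),
        H₃.reg8, H₃.reg16, H₃.reg17, H₃.le, H₃.c_pos, H₃.core, H₃.mono⟩, cl₃, cur₃, r13, q5,
        by simp, by have := hlast.1; omega, by rw [← hb]; exact hlast.2.1, ?_, ?_⟩
      · intro p hp x hx
        simp only [Mach.setR_arr]
        rcases Nat.lt_trichotomy p e with hlt | rfl | hgt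
        · exact absurd (hx.base_eq.trans hb.symm) (hlast.2.2 p hp hlt)
        · rw [hEdge x hx, lv]
        · have := hpart p (by omega) x hx
          rw [hlab x (by rw [this]; have := H.c_pos; omega), this]
      · simp only [Mach.setR_arr]
        rw [hpot]
        omega
    refine Run.ite_cons (T := T + 4) (fun hc => ?_) (fun hc => ?_)
    · simp only [Expr.eval, r18] at hc
      refine Run.skip (hfin h₂ qt _ ⟨H.same.trans (hS₂.mono (by simp) (by simp)), hH₂, ?_, ?_, ?_,
        hle, H.c_pos, ?_, ?_⟩ ?_ ?_ ?_ ?_ ?_ ?_ ?_ ?_ (by omega))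
      · rw [hS₂.1 8 (by decide), H.reg8]
      · rw [hS₂.1 16 (by decide), H.reg16]
      · rw [hS₂.1 17 (by decide), H.reg17]
      · rw [b4, b5]; exact H.core
      · rw [b4]; exact H.mono
      · rw [b4, b5]; exact hcl
      · rw [b4, b5]; exact hcur
      · rw [hS₂.1 13 (by decide), hu]
      · rw [b5, hQ]
      · rw [hS₂.1 12 (by decide), he]
      · rw [b4]
        rcases hv with ⟨hv, -⟩ | hv
        · rw [hv, hlu]
        · exact lab_eq_of_edge D.lt_m H.core hcl hcur hlu ⟨_, hv⟩ hc
      · intro x _; rw [b4]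
      · rw [b4, b5]
    · simp only [Expr.eval, r18] at hc
      have hvE : EdgeAt m len W u e v := by
        rcases hv with ⟨hv, -⟩ | hv
        · rw [hv, hlu] at hc
          have := H.c_pos
          omega
        · exact hv
      have r8 : h₂.reg 8 = c := by rw [hS₂.1 8 (by decide), H.reg8]
      have r17 : h₂.reg 17 = qt := by rw [hS₂.1 17 (by decide), H.reg17]
      have hpush := run_pushProg (B := B) (N := N) (h := h₂) (v := v) (c := c) (qt := qt) hN hH₂.reg15
        (by simp [hh₂, hvdef]) r8 r17 (by omega) (by omega) (by omega)
      refine ((hpush.frame (T + 1)).mono (by omega) ?_)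
      rintro t h₃ ⟨t', rfl, hS₃, r17', d4, d5⟩
      rw [b4] at d4
      rw [b5] at d5
      have hS₃' : Mach.Same [14, 17, 18] [4, 5] h h₃ :=
        (hS₂.mono (by simp) (by simp)).trans (hS₃.mono (by simp) (by simp))
      refine hfin h₃ (qt + 1) _ ⟨H.same.trans (hS₃'.mono (by simp) (by simp)),
        H.holds.same hS₃' (by decide) (by decide), ?_, ?_, r17',
        by omega, H.c_pos, ?_, ?_⟩ ?_ ?_ ?_ ?_ ?_ ?_ ?_ ?_ (by omega)
      · rw [hS₃'.1 8 (by decide), H.reg8]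
      · rw [hS₃'.1 16 (by decide), H.reg16]
      · rw [d4, d5]
        exact H.core.push hvE.present hc
          (.inr ⟨rfl, H.c_pos, u, hu2, hlu, .rel _ _ ⟨_, hvE⟩⟩)
      · intro x hx
        rw [d4, Function.update_apply]
        split_ifs
        · have := H.c_pos; omega
        · exact H.mono x hx
      · rw [d4, d5]; exact hcl.push H.core (by omega) hc
      · rw [d4, d5]; exact hcur.push H.core hc
      · rw [hS₃'.1 13 (by decide), hu]
      · rw [d5, Function.update_of_ne (by omega), hQ]
      · rw [hS₃'.1 12 (by decide), he]
      · rw [d4, Function.update_self]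
      · intro x hx
        rw [d4, Function.update_of_ne]
        rintro rfl
        exact hx hc
      · rw [d4, d5]
        exact pot_push hv2 hc (by have := H.c_pos; omega) hle
  · simp [Expr.eval, he] at h0
    subst h0
    -- At the end of the list all neighbours of `u` carry its label, so `u` joins the closed part of
    -- the queue.
    refine ⟨qt, H, ?_, fun j hj hjt => hcur j (by omega) hjt, by omega⟩
    intro j hj x hx
    rcases Nat.lt_succ_iff_lt_or_eq.1 hj with hj | rfl
    · exact hcl j hj x hx
    · rw [hQ] at hx ⊢
      obtain ⟨p, hp⟩ := hx
      rw [hpart p (by omega) x hp, hlu]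

end BFS

end ZiminMatching

/-! ### Exploration of whole components, and the total time of the search. -/

namespace ZiminMatching

namespace BFS

variable {B N m len : ℕ} {W prv lst : ℕ → ℕ}

/-- Dequeuing releases the cost of the vertex: 20 units per occurrence for the inner loop, and 10
for everything else. -/
lemma run_expandProg {h₀ h : Mach} (D : Input B N m len W prv lst) {c qh qt R T : ℕ}
    (H : Inside N m len W prv lst h₀ h c qh qt)
    (hcl : Closed m len W (h.arr 4) (h.arr 5) qh)
    (hcur : Current (h.arr 4) (h.arr 5) c qh qt) (hq : qh < qt)
    (hT : pot m len W (h.arr 4) (h.arr 5) qh qt + R ≤ T + 1) :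
    Run B N expandProg h T fun T' h' => ∃ qt', Inside N m len W prv lst h₀ h' c (qh + 1) qt' ∧
      Closed m len W (h'.arr 4) (h'.arr 5) (qh + 1) ∧
      Current (h'.arr 4) (h'.arr 5) c (qh + 1) qt' ∧
      pot m len W (h'.arr 4) (h'.arr 5) (qh + 1) qt' + R ≤ T' := by
  have hN := D.hB
  have h2 := D.m_lt
  have hq2 := H.core.qt_le D.lt_m
  have h15 := H.holds.reg15
  have h1 := H.holds.reg1
  have h16 := H.reg16
  rw [pot_pop hq, cost] at hT
  set u := h.arr 5 qh with hu
  have hu2 : u < 2 * m := (H.core.present qh hq).lt D.lt_m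
  obtain ⟨T, rfl⟩ : ∃ T', T = T' + 4 := ⟨T - 4, by omega⟩
  refine Run.load_cons (T := T + 3) hN h15 (by norm_num) (by simp [Expr.eval, h16]; omega) ?_
  refine Run.assign_cons (T := T + 2) (by simp [Expr.eval, h16]; omega) ?_
  set h₁ := (h.setR 13 (h.arr 5 (Expr.eval h.reg (.reg 16)))).setR 16
    (Expr.eval (h.setR 13 (h.arr 5 (Expr.eval h.reg (.reg 16)))).reg (.add (.reg 16) (.lit 1)))
    with hh₁
  have hS₁ : Mach.Same [13, 16] [] h h₁ := (Mach.Same.rfl.setR (by simp) _).setR (by simp) _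
  have r13 : h₁.reg 13 = u := by simp [hh₁, Expr.eval, h16, hu]
  have r16 : h₁.reg 16 = qh + 1 := by simp [hh₁, Expr.eval, h16]
  have a4 : h₁.arr 4 = h.arr 4 := hS₁.2 4 (by decide)
  have a5 : h₁.arr 5 = h.arr 5 := hS₁.2 5 (by decide)
  have hH₁ := H.holds.same hS₁ (by decide) (by decide)
  have hfin : ∀ e, e = lst (base m u) → Run B N (block [.whileNonzero (.reg 12) (block
      [neighbourProg, loadA 18 4 (.reg 14), .ifNonzero (.reg 18) .skip pushProg,
        loadA 12 2 (.sub (.reg 12) (.lit 1))])]) (h₁.setR 12 e) T fun T' h' => ∃ qt',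
      Inside N m len W prv lst h₀ h' c (qh + 1) qt' ∧
      Closed m len W (h'.arr 4) (h'.arr 5) (qh + 1) ∧
      Current (h'.arr 4) (h'.arr 5) c (qh + 1) qt' ∧
      pot m len W (h'.arr 4) (h'.arr 5) (qh + 1) qt' + R ≤ T' := by
    rintro _ rfl
    set h₂ := h₁.setR 12 (lst (base m u))
    have hS₂ : Mach.Same [12, 13, 16] [] h h₂ := (hS₁.mono (by simp) (by simp)).setR (by simp) _
    have b4 : h₂.arr 4 = h.arr 4 := a4
    have b5 : h₂.arr 5 = h.arr 5 := a5
    refine Run.cons (Run.mono (run_neighbours (u := u) (R := R) (T := T) (qt := qt) D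
      ⟨H.same.trans (hS₂.mono (by simp) (by simp)), H.holds.same hS₂ (by decide) (by decide),
        ?_, ?_, ?_, by omega, H.c_pos, ?_, ?_⟩ ?_ ?_ ?_ ?_ ?_ ?_) le_rfl fun T' h' h => Run.nil h)
    · rw [hS₂.1 8 (by decide), H.reg8]
    · exact r16
    · rw [hS₂.1 17 (by decide), H.reg17]
    · rw [b4, b5]; exact H.core
    · rw [b4]; exact H.mono
    · rw [b4, b5]; exact hcl
    · rw [b4, b5]; exact hcur
    · exact r13
    · rw [b5]
    · have : h₂.reg 12 = lst (base m u) := by simp [h₂]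
      rw [this]
      exact D.lst_last _ (by unfold base; split_ifs <;> omega)
    · rw [b4, b5]; omega
  refine Run.ite_cons (T := T + 1) (fun hc => ?_) (fun hc => ?_)
  · have hc' : ¬ u < m := by
      simp [isRight, Expr.eval, r13, hH₁.reg1] at hc
      omega
    refine Run.load hN hH₁.reg15 (by norm_num) (by simp [Expr.eval, r13, hH₁.reg1]; omega)
      (hfin _ ?_)
    simp [Expr.eval, r13, hH₁.reg1, hH₁.arr3, base, hc']
  · have hc' : u < m := by
      simp [isRight, Expr.eval, r13, hH₁.reg1] at hc
      omega
    refine Run.load hN hH₁.reg15 (by norm_num) (by simp [Expr.eval, r13]; omega) (hfin _ ?_)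
    simp [Expr.eval, r13, hH₁.arr3, base, hc']

/-- When the queue runs empty all of its entries are closed, that is, the current component is
complete. -/
lemma run_queue {h₀ h : Mach} (D : Input B N m len W prv lst) {c qh qt R T : ℕ}
    (H : Inside N m len W prv lst h₀ h c qh qt)
    (hcl : Closed m len W (h.arr 4) (h.arr 5) qh)
    (hcur : Current (h.arr 4) (h.arr 5) c qh qt)
    (hT : pot m len W (h.arr 4) (h.arr 5) qh qt + R + 1 ≤ T) :
    Run B N (.whileNonzero (.sub (.reg 17) (.reg 16)) expandProg) h T fun T' h' =>
      ∃ q, Inside N m len W prv lst h₀ h' c q q ∧ Closed m len W (h'.arr 4) (h'.arr 5) q ∧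
        pot m len W (h'.arr 4) (h'.arr 5) q q + R ≤ T' := by
  refine Run.whileLoop (I := fun T h => ∃ qh qt, Inside N m len W prv lst h₀ h c qh qt ∧
    Closed m len W (h.arr 4) (h.arr 5) qh ∧ Current (h.arr 4) (h.arr 5) c qh qt ∧
    pot m len W (h.arr 4) (h.arr 5) qh qt + R + 1 ≤ T) ?_ ⟨qh, qt, H, hcl, hcur, hT⟩
  clear H hcl hcur hT
  rintro T h ⟨qh, qt, H, hcl, hcur, hT⟩
  obtain ⟨T, rfl⟩ : ∃ T', T = T' + 1 := ⟨T - 1, by omega⟩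
  have hle := H.le
  refine ⟨T, rfl, fun h0 => ?_, fun h0 => ?_⟩
  · simp [Expr.eval, H.reg16, H.reg17] at h0
    refine (run_expandProg (R := R + 1) D H hcl hcur (by omega) (by omega)).mono le_rfl ?_
    rintro T' h' ⟨qt', H', hcl', hcur', hT'⟩
    exact ⟨_, qt', H', hcl', hcur', by omega⟩
  · simp [Expr.eval, H.reg16, H.reg17] at h0
    have : qh = qt := by omega
    subst this
    exact ⟨qh, H, hcl, by omega⟩

/-- The search between two components. -/
structure Between (N m len : ℕ) (W prv lst : ℕ → ℕ) (h₀ h : Mach) (c q : ℕ) : Prop where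
  same : Mach.Same [8, 10, 11, 12, 13, 14, 16, 17, 18] [4, 5] h₀ h
  holds : Holds N m len W prv lst h
  reg8 : h.reg 8 = c
  reg16 : h.reg 16 = q
  reg17 : h.reg 17 = q
  core : Core m len W (h.arr 4) (h.arr 5) c q
  closed : Closed m len W (h.arr 4) (h.arr 5) q

lemma Between.step {h₀ h h' : Mach} {c q : ℕ} {R : List ℕ}
    (H : Between N m len W prv lst h₀ h c q) (S : Mach.Same R [] h h')
    (hR : R ⊆ [10, 11, 12, 13, 14, 18]) : Between N m len W prv lst h₀ h' c q := by
  have S' := S.mono hR (List.Subset.refl [])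
  refine ⟨H.same.trans (S'.mono (by simp) (by simp)), H.holds.same S' (by decide) (by decide),
    (S'.1 8 (by decide)).trans H.reg8, (S'.1 16 (by decide)).trans H.reg16,
    (S'.1 17 (by decide)).trans H.reg17, ?_, ?_⟩
  · rw [S.2 4 (by decide), S.2 5 (by decide)]; exact H.core
  · rw [S.2 4 (by decide), S.2 5 (by decide)]; exact H.closed

/-- A labelled root leaves the search untouched. Otherwise the push keeps the potential constant and
the exploration is paid for by it, so a call costs only the constant 8 beyond the potential. -/
lemma run_rootProg {h₀ h : Mach} (D : Input B N m len W prv lst) {c q v R T : ℕ}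
    (H : Between N m len W prv lst h₀ h c q) (hv : h.reg 14 = v) (hp : Present m len W v)
    (hT : pot m len W (h.arr 4) (h.arr 5) q q + R + 8 ≤ T) :
    Run B N rootProg h T fun T' h' => ∃ c' q', Between N m len W prv lst h₀ h' c' q' ∧
      Mach.Same [8, 12, 13, 14, 16, 17, 18] [4, 5] h h' ∧
      h'.arr 4 v ≠ 0 ∧ (∀ x, h.arr 4 x ≠ 0 → h'.arr 4 x ≠ 0) ∧
      pot m len W (h'.arr 4) (h'.arr 5) q' q' + R ≤ T' := by
  have hN := D.hB
  have h2 := D.m_lt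
  have hv2 := hp.lt D.lt_m
  have hq2 := H.core.qt_le D.lt_m
  have hc2 := H.core.le_qt
  obtain ⟨T, rfl⟩ : ∃ T', T = T' + 8 := ⟨T - 8, by omega⟩
  refine Run.load_cons (T := T + 7) hN H.holds.reg15 (by norm_num)
    (by simp [Expr.eval, hv]; omega) ?_
  set h₁ := h.setR 18 (h.arr 4 (Expr.eval h.reg (.reg 14))) with hh₁
  have hS₁ : Mach.Same [18] [] h h₁ := Mach.Same.rfl.setR (by simp) _
  have r18 : h₁.reg 18 = h.arr 4 v := by simp [hh₁, Expr.eval, hv]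
  refine Run.ite_cons (T := T + 6) (fun hc => ?_) (fun hc => ?_)
  · simp only [Expr.eval, r18] at hc
    refine Run.skip (Run.nil ⟨c, q, H.step hS₁ (by simp), hS₁.mono (by simp) (by simp), hc,
      fun x hx => hx, ?_⟩)
    have a4 : h₁.arr 4 = h.arr 4 := rfl
    have a5 : h₁.arr 5 = h.arr 5 := rfl
    rw [a4, a5]
    omega
  · simp only [Expr.eval, r18] at hc
    have e8 : h₁.reg 8 = c := H.reg8
    -- The size bound is taken for the queue after the push, to see that there is room for another
    -- entry and another label.
    have hq3 := (H.core.push hp hc (.inl rfl)).qt_le D.lt_m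
    refine Run.assign_cons (T := T + 5) (by simp [Expr.eval, e8]; omega) ?_
    set h₂ := h₁.setR 8 (Expr.eval h₁.reg (.add (.reg 8) (.lit 1))) with hh₂
    have hS₂ : Mach.Same [8, 18] [] h h₂ := (hS₁.mono (by simp) (by simp)).setR (by simp) _
    have r8 : h₂.reg 8 = c + 1 := by simp [hh₂, Expr.eval, e8]
    have hpush := run_pushProg (B := B) (N := N) (h := h₂) (v := v) (c := c + 1) (qt := q) hN
      ((hS₂.1 15 (by decide)).trans H.holds.reg15) ((hS₂.1 14 (by decide)).trans hv) r8
      ((hS₂.1 17 (by decide)).trans H.reg17) (by omega) (by omega) (by omega)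
    refine (Run.cons_of (T := T + 2) hpush ?_)
    rintro h₃ ⟨hS₃, r17, d4, d5⟩
    rw [hS₂.2 4 (by decide)] at d4
    rw [hS₂.2 5 (by decide)] at d5
    have hS₃' : Mach.Same [8, 17, 18] [4, 5] h h₃ :=
      (hS₂.mono (by simp) (by simp)).trans (hS₃.mono (by simp) (by simp))
    have hin : Inside N m len W prv lst h₃ h₃ (c + 1) q (q + 1) := by
      refine ⟨Mach.Same.rfl, H.holds.same hS₃' (by decide) (by decide), ?_, ?_, r17, by omega,
        by omega, ?_, fun _ h => h⟩
      · rw [hS₃.1 8 (by decide), r8]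
      · rw [hS₃'.1 16 (by decide), H.reg16]
      · rw [d4, d5]
        exact H.core.push hp hc (.inl rfl)
    refine Run.cons (Run.mono (run_queue (R := R) (T := T + 2) D hin ?_ ?_ ?_) le_rfl ?_)
    · rw [d4, d5]
      exact H.closed.push H.core le_rfl hc
    · intro j hj hj'
      have : j = q := by omega
      subst this
      rw [d5, Function.update_self, d4, Function.update_self]
    · rw [d4, d5, pot_push hv2 hc (by omega) le_rfl]
      omega
    · rintro T' h' ⟨q', H', hcl', hT'⟩
      have hS' : Mach.Same [8, 12, 13, 14, 16, 17, 18] [4, 5] h h' :=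
        (hS₃'.mono (by simp) (by simp)).trans (H'.same.mono (by simp) (by simp))
      refine Run.nil (Run.nil ⟨c + 1, q', ⟨H.same.trans (hS'.mono (by simp) (by simp)), H'.holds, H'.reg8,
        H'.reg16, H'.reg17, H'.core, hcl'⟩, hS', ?_, ?_, hT'⟩)
      · refine H'.mono v ?_
        rw [d4, Function.update_self]
        omega
      · intro x hx
        refine H'.mono x ?_
        rw [d4, Function.update_apply]
        split_ifs
        · omega
        · exact hx

/-- The labels `1, …, c` are the connected components. -/
structure Labels (m len : ℕ) (W lab : ℕ → ℕ) (c : ℕ) : Prop where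
  c_le : c ≤ 2 * m
  pos : ∀ v, Present m len W v → 1 ≤ lab v
  le : ∀ v, Present m len W v → lab v ≤ c
  edge : ∀ u v, Present m len W u → Edge m len W u v → lab v = lab u
  conn : ∀ u v, Present m len W u → Present m len W v → lab u = lab v →
    Relation.EqvGen (Edge m len W) u v
  surj : ∀ d, 1 ≤ d → d ≤ c → ∃ v, Present m len W v ∧ lab v = d

/-- The initial potential 20m + 40 `len` pays for all expansions; a further 30 units per position
cover the loop and the two root calls, for the left and the right copy. -/
lemma run_componentsProg {h : Mach} (D : Input B N m len W prv lst)
    (H : Holds N m len W prv lst h) (h0 : ∀ v < 2 * m, h.arr 4 v = 0) :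
    Run B N componentsProg h (20 * m + 80 * len + 10) fun _ h' =>
      Mach.Same [8, 10, 11, 12, 13, 14, 16, 17, 18] [4, 5] h h' ∧
      Labels m len W (h'.arr 4) (h'.reg 8) := by
  have hN := D.hB
  have h2 := D.m_lt
  have h3 := D.len_lt
  refine Run.mono (T := 20 * m + 70 * len + 2 + 3) ?_ (by omega) fun _ _ h => h
  refine Run.assign_cons (T := 20 * m + 70 * len + 2 + 2) (by simp [Expr.eval]; omega) ?_
  refine Run.assign_cons (T := 20 * m + 70 * len + 2 + 1) (by simp [Expr.eval]; omega) ?_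
  refine Run.assign_cons (T := 20 * m + 70 * len + 2) (by simp [Expr.eval]; omega) ?_
  simp only [Expr.eval]
  set h₁ := ((h.setR 8 0).setR 16 0).setR 17 0 with hh₁
  have hS₁ : Mach.Same [8, 16, 17] [] h h₁ :=
    ((Mach.Same.rfl.setR (by simp) _).setR (by simp) _).setR (by simp) _
  refine Run.cons ?_
  refine Run.forLoop_credit (n := len) (T := 20 * m + 70 * len + 1) (I := fun i T g => ∃ c q, Between N m len W prv lst h g c q ∧
    (∀ j < i, g.arr 4 (W j) ≠ 0 ∧ g.arr 4 (m + W j) ≠ 0) ∧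
    pot m len W (g.arr 4) (g.arr 5) q q + (len - i) * 30 + 1 ≤ T) (by omega) ?_ ?_ ?_ ?_
  · rintro i T g ⟨c, q, hb, -⟩
    exact hb.holds.reg7
  · rintro i hi T g ⟨c, q, hb, hl, hT⟩ r10
    obtain ⟨T, rfl⟩ : ∃ T', T = T' + 5 := ⟨T - 5, by omega⟩
    refine ⟨T + 3, by omega, ?_⟩
    have hWi := D.lt_m i hi
    refine Run.load_cons (T := T + 2) hN hb.holds.reg15 (by norm_num) (by simp [Expr.eval, r10]; omega) ?_
    have eW : g.arr 1 (Expr.eval g.reg (.reg 10)) = W i := by simp [Expr.eval, r10, hb.holds.arr1]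
    rw [eW]
    refine Run.assign_cons (T := T + 1) (by simp [Expr.eval]; omega) ?_
    have ev : Expr.eval (g.setR 11 (W i)).reg (.reg 11) = W i := by simp [Expr.eval]
    rw [ev]
    set g₁ := (g.setR 11 (W i)).setR 14 (W i) with hg₁
    have hS : Mach.Same [11, 14] [] g g₁ := (Mach.Same.rfl.setR (by simp) _).setR (by simp) _
    refine Run.cons (Run.mono (run_rootProg (v := W i) (R := (len - i) * 30 - 12) (T := T + 1) D
      (hb.step hS (by simp)) (by simp [hg₁]) ⟨i, hi, .inl rfl⟩ ?_) le_rfl ?_)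
    · have a4 : g₁.arr 4 = g.arr 4 := rfl
      have a5 : g₁.arr 5 = g.arr 5 := rfl
      rw [a4, a5]
      omega
    rintro T₂ g₂ ⟨c₂, q₂, hb₂, hS₂, hv₂, hm₂, hT₂⟩
    have r11 : g₂.reg 11 = W i := by rw [hS₂.1 11 (by decide)]; simp [hg₁]
    have r10₂ : g₂.reg 10 = i := by rw [hS₂.1 10 (by decide)]; simp [hg₁, r10]
    obtain ⟨T₂, rfl⟩ : ∃ T', T₂ = T' + 1 := ⟨T₂ - 1, by omega⟩
    refine Run.assign_cons (T := T₂) (by simp [Expr.eval, r11, hb₂.holds.reg1]; omega) ?_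
    have ev₂ : Expr.eval g₂.reg (.add (.reg 11) (.reg 1)) = m + W i := by
      simp [Expr.eval, r11, hb₂.holds.reg1, add_comm]
    rw [ev₂]
    set g₃ := g₂.setR 14 (m + W i) with hg₃
    have hS₃ : Mach.Same [14] [] g₂ g₃ := Mach.Same.rfl.setR (by simp) _
    refine Run.cons (Run.mono (run_rootProg (v := m + W i) (R := (len - i) * 30 - 21) (T := T₂) D
      (hb₂.step hS₃ (by simp)) (by simp [hg₃]) ⟨i, hi, .inr rfl⟩ ?_) le_rfl ?_)
    · have a4 : g₃.arr 4 = g₂.arr 4 := rfl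
      have a5 : g₃.arr 5 = g₂.arr 5 := rfl
      rw [a4, a5]
      omega
    rintro T₄ g₄ ⟨c₄, q₄, hb₄, hS₄, hv₄, hm₄, hT₄⟩
    have r10₄ : g₄.reg 10 = i := by rw [hS₄.1 10 (by decide)]; simp [hg₃, r10₂]
    refine Run.nil ⟨r10₄, c₄, q₄, hb₄.step (Mach.Same.rfl.setR (R := [10]) (by simp) _) (by simp),
      ?_, ?_⟩
    · intro j hj
      rcases Nat.lt_succ_iff_lt_or_eq.1 hj with hj | rfl
      · exact ⟨hm₄ _ (hm₂ _ (hl j hj).1), hm₄ _ (hm₂ _ (hl j hj).2)⟩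
      · exact ⟨hm₄ _ hv₂, hv₄⟩
    · simp only [Mach.setR_arr]
      omega
  · rintro T g ⟨c, q, hb, hl, hT⟩ -
    refine ⟨T - 1, by omega, Run.nil ⟨hb.same, ?_⟩⟩
    rw [hb.reg8]
    have hq2 := hb.core.qt_le D.lt_m
    have hc2 := hb.core.le_qt
    have hne : ∀ v, Present m len W v → g.arr 4 v ≠ 0 := by
      rintro v ⟨j, hj, rfl | rfl⟩
      · exact (hl j hj).1
      · exact (hl j hj).2
    refine ⟨by omega, fun v hv => Nat.one_le_iff_ne_zero.2 (hne v hv),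
      fun v hv => hb.core.le v (hv.lt D.lt_m), ?_, ?_, ?_⟩
    · intro u v hu huv
      obtain ⟨j, hj, rfl⟩ := hb.core.mem u (hu.lt D.lt_m) (hne u hu)
      exact hb.closed j hj v huv
    · exact fun u v hu hv e => hb.core.conn u (hu.lt D.lt_m) v (hv.lt D.lt_m) (hne u hu) e
    · intro d h1 hd
      obtain ⟨j, hj, e⟩ := hb.core.surj d h1 hd
      exact ⟨_, hb.core.present j hj, e⟩
  · have hS₂ : Mach.Same [8, 10, 16, 17] [] h (h₁.setR 10 0) :=
      (hS₁.mono (by simp) (by simp)).setR (by simp) _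
    have a4 : (h₁.setR 10 0).arr 4 = h.arr 4 := rfl
    have a5 : (h₁.setR 10 0).arr 5 = h.arr 5 := rfl
    refine ⟨0, 0, ⟨hS₂.mono (by simp) (by simp), H.same hS₂ (by decide) (by decide),
      by simp [hh₁], by simp [hh₁], by simp [hh₁], ?_, ?_⟩, by simp, ?_⟩
    · rw [a4]; exact Core.empty h0
    · intro j hj
      omega
    · rw [a4, a5, pot_empty D.lt_m h0]
      omega

end BFS

end ZiminMatching

namespace ZiminMatching

namespace BFS

/-! ### The labels are the components of the adjacency graph -/

variable {m : ℕ} {w : List (Fin m)} {W lab : ℕ → ℕ} {c : ℕ}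

/-- The number of a vertex. -/
def vertexNumber {m : ℕ} {w : List (Fin m)} : Vertex w → ℕ :=
  Sum.elim (fun x => (x.1 : ℕ)) fun x => m + x.1

lemma present_iff (hW : ∀ (j : ℕ) (hj : j < w.length), W j = w[j]) {v : ℕ} :
    Present m w.length W v ↔ ∃ a : Vertex w, vertexNumber a = v := by
  constructor
  · rintro ⟨j, hj, rfl | rfl⟩
    · exact ⟨Sum.inl ⟨w[j], List.getElem_mem hj⟩, (hW j hj).symm⟩
    · exact ⟨Sum.inr ⟨w[j], List.getElem_mem hj⟩, by simp [vertexNumber, hW j hj]⟩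
  · rintro ⟨⟨x, hx⟩ | ⟨x, hx⟩, rfl⟩
    all_goals
      obtain ⟨j, hj, rfl⟩ := List.getElem_of_mem hx
      refine ⟨j, hj, ?_⟩
      simp [vertexNumber, hW j hj]

lemma pair_infix_iff {V : Type} {w : List V} {x y : V} :
    [x, y] <:+: w ↔ ∃ (j : ℕ) (h : j + 1 < w.length), w[j] = x ∧ w[j + 1] = y := by
  constructor
  · rintro ⟨s, t, rfl⟩
    refine ⟨s.length, by simp, ?_, ?_⟩
    · simp
    · rw [List.getElem_append_left (by simp)]
      simp
  · rintro ⟨j, h, rfl, rfl⟩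
    refine ⟨w.take j, w.drop (j + 2), ?_⟩
    conv_rhs => rw [← List.take_append_drop j w]
    rw [List.drop_eq_getElem_cons (i := j) (l := w) (by omega), List.drop_eq_getElem_cons h]
    simp

lemma edge_iff_adj (hW : ∀ (j : ℕ) (hj : j < w.length), W j = w[j]) {a b : Vertex w} :
    Edge m w.length W (vertexNumber a) (vertexNumber b) ↔ (adjGraph w).Adj a b := by
  rw [adj_iff]
  constructor
  · rintro ⟨p, ⟨h₁, h₂, h₃, h₄⟩ | ⟨h₁, h₂, h₃, h₄, h₅⟩⟩
    · rcases a with x | x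
      swap
      · simp [vertexNumber] at h₁
      rcases b with y | y
      · have := y.1.2
        simp only [vertexNumber, Sum.elim_inl] at h₄
        omega
      refine ⟨x, y, pair_infix_iff.2 ⟨p, h₃, ?_, ?_⟩, .inl ⟨rfl, rfl⟩⟩
      · rw [hW p (by omega)] at h₂
        exact Fin.ext h₂
      · rw [hW _ h₃] at h₄
        simp only [vertexNumber, Sum.elim_inr] at h₄
        exact Fin.ext (by omega)
    · rcases a with x | x
      · have := x.1.2
        simp only [vertexNumber, Sum.elim_inl] at h₁
        omega
      rw [hW _ (by omega)] at h₅
      rcases b with y | y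
      swap
      · have := (w[p - 1]).2
        simp only [vertexNumber, Sum.elim_inr] at h₅
        omega
      refine ⟨y, x, pair_infix_iff.2 ⟨p - 1, by omega, ?_, ?_⟩, .inr ⟨rfl, rfl⟩⟩
      · exact Fin.ext h₅.symm
      · rw [hW p h₄] at h₂
        simp only [vertexNumber, Sum.elim_inr] at h₂
        apply Fin.ext
        simp only [Nat.sub_add_cancel h₃]
        omega
  · rintro ⟨x, y, hxy, h⟩
    obtain ⟨j, hj, ex, ey⟩ := pair_infix_iff.1 hxy
    have e₁ : W j = x.1 := by rw [hW j (by omega), ex]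
    have e₂ : W (j + 1) = y.1 := by rw [hW _ hj, ey]
    rcases h with ⟨rfl, rfl⟩ | ⟨rfl, rfl⟩
    · exact ⟨j, .inl ⟨x.1.2, e₁, hj, by simp [vertexNumber, e₂]⟩⟩
    · exact ⟨j + 1, .inr ⟨by simp [vertexNumber], by simp [vertexNumber, e₂], by omega, hj,
        by simp [vertexNumber, e₁]⟩⟩

lemma vertexNumber_injective : Function.Injective (vertexNumber : Vertex w → ℕ) := by
  rintro (⟨x, hx⟩ | ⟨x, hx⟩) (⟨y, hy⟩ | ⟨y, hy⟩) e <;> simp only [vertexNumber, Sum.elim_inl,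
    Sum.elim_inr] at e
  · have : x = y := Fin.ext e
    subst this; rfl
  · have := x.2; omega
  · have := y.2; omega
  · have : x = y := Fin.ext (by omega)
    subst this; rfl

/-- The chain runs through arbitrary numbers, but both ends of an edge are numbers of vertices, so a
chain that starts at a vertex can be lifted to the graph. Both directions are needed together,
because the symmetric case exchanges them. -/
lemma reachable_of_eqvGen (hW : ∀ (j : ℕ) (hj : j < w.length), W j = w[j]) {u v : ℕ}
    (h : Relation.EqvGen (Edge m w.length W) u v) :
    (∀ a : Vertex w, vertexNumber a = u → ∃ b : Vertex w, vertexNumber b = v ∧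
      (adjGraph w).Reachable a b) ∧
    (∀ b : Vertex w, vertexNumber b = v → ∃ a : Vertex w, vertexNumber a = u ∧
      (adjGraph w).Reachable a b) := by
  have hm : ∀ j < w.length, W j < m := fun j hj => by rw [hW j hj]; exact w[j].2
  induction h with
  | rel u v h =>
    constructor
    · rintro a rfl
      obtain ⟨p, hp⟩ := h
      obtain ⟨b, rfl⟩ := (present_iff hW).1 hp.present
      exact ⟨b, rfl, ((edge_iff_adj hW).1 ⟨p, hp⟩).reachable⟩
    · rintro b rfl
      obtain ⟨p, hp⟩ := h.symm hm
      obtain ⟨a, rfl⟩ := (present_iff hW).1 hp.present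
      exact ⟨a, rfl, ((edge_iff_adj hW).1 ⟨p, hp⟩).reachable.symm⟩
  | refl u => exact ⟨fun a h => ⟨a, h, .rfl⟩, fun a h => ⟨a, h, .rfl⟩⟩
  | symm u v _ ih =>
    exact ⟨fun a h => (ih.2 a h).imp fun b hb => ⟨hb.1, hb.2.symm⟩,
      fun a h => (ih.1 a h).imp fun b hb => ⟨hb.1, hb.2.symm⟩⟩
  | trans u v x _ _ ih₁ ih₂ =>
    constructor
    · intro a h
      obtain ⟨b, hb, r⟩ := ih₁.1 a h
      obtain ⟨d, hd, r'⟩ := ih₂.1 b hb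
      exact ⟨d, hd, r.trans r'⟩
    · intro a h
      obtain ⟨b, hb, r⟩ := ih₂.2 a h
      obtain ⟨d, hd, r'⟩ := ih₁.2 b hb
      exact ⟨d, hd, r'.trans r⟩

lemma Labels.reachable_iff (hW : ∀ (j : ℕ) (hj : j < w.length), W j = w[j])
    (H : Labels m w.length W lab c) {a b : Vertex w} : (adjGraph w).Reachable a b ↔
      lab (vertexNumber a) = lab (vertexNumber b) := by
  have hp : ∀ a : Vertex w, Present m w.length W (vertexNumber a) := fun a =>
    (present_iff hW).2 ⟨a, rfl⟩
  constructor
  · intro h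
    exact eq_of_reachable (f := fun a => lab (vertexNumber a))
      (fun a b hab => (H.edge _ _ (hp a) ((edge_iff_adj hW).2 hab)).symm) h
  · intro h
    obtain ⟨b', e, r⟩ := (reachable_of_eqvGen hW (H.conn _ _ (hp a) (hp b) h)).1 a rfl
    rwa [vertexNumber_injective e] at r

/-- Components correspond bijectively to the labels 1, …, c, which are shifted by one to fit
`Finset.range c`. -/
lemma Labels.card_components (hW : ∀ (j : ℕ) (hj : j < w.length), W j = w[j])
    (H : Labels m w.length W lab c) (S : ℕ → Prop) [DecidablePred S] :
    Nat.card {C : (adjGraph w).ConnectedComponent // ∀ a ∈ C.supp, S (lab (vertexNumber a))} =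
      ((Finset.range c).filter fun d => S (d + 1)).card := by
  have hp : ∀ a : Vertex w, Present m w.length W (vertexNumber a) := fun a =>
    (present_iff hW).2 ⟨a, rfl⟩
  rw [← Nat.card_eq_finsetCard]
  refine Nat.card_congr (Equiv.ofBijective (fun C => ⟨lab (vertexNumber C.1.out) - 1, ?_⟩) ⟨?_, ?_⟩)
  · have h₁ := H.pos _ (hp C.1.out)
    have h₂ := H.le _ (hp C.1.out)
    refine Finset.mem_filter.2 ⟨Finset.mem_range.2 (by omega), ?_⟩
    rw [Nat.sub_add_cancel h₁]
    exact C.2 _ (Quot.out_eq _)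
  · rintro ⟨C, hC⟩ ⟨D, hD⟩ e
    have h₁ := H.pos _ (hp C.out)
    have h₂ := H.pos _ (hp D.out)
    simp only [Subtype.mk.injEq] at e ⊢
    have := (H.reachable_iff hW).2 (show lab (vertexNumber C.out) = lab (vertexNumber D.out) by omega)
    rw [← SimpleGraph.ConnectedComponent.eq] at this
    exact (Quot.out_eq C).symm.trans (this.trans (Quot.out_eq D))
  · rintro ⟨d, hd⟩
    obtain ⟨hd, hS⟩ := Finset.mem_filter.1 hd
    rw [Finset.mem_range] at hd
    obtain ⟨v, hv, e⟩ := H.surj (d + 1) (by omega) (by omega)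
    obtain ⟨a, rfl⟩ := (present_iff hW).1 hv
    have key : ∀ b, (adjGraph w).connectedComponentMk b = (adjGraph w).connectedComponentMk a →
        lab (vertexNumber b) = d + 1 := fun b hb => by
      rw [← e]
      exact (H.reachable_iff hW).1 (SimpleGraph.ConnectedComponent.eq.1 hb)
    refine ⟨⟨(adjGraph w).connectedComponentMk a, fun b hb => ?_⟩, ?_⟩
    · rw [key b hb]; exact hS
    · apply Subtype.ext
      simp only
      rw [key _ (Quot.out_eq _), Nat.add_sub_cancel]

end BFS

end ZiminMatching

namespace ZiminMatching

open BFS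

/-! ### The program for one level -/

/-- Reset the lists of occurrences, the labels and the flags. -/
def clearProg : Prog := block [
  .assign 9 (.mul (.lit 2) (.reg 1)),
  forLoop 10 9 (block [
    storeA 3 (.reg 10) (.lit 0), storeA 4 (.reg 10) (.lit 0),
    storeA 6 (.add (.reg 10) (.lit 1)) (.lit 0), storeA 7 (.add (.reg 10) (.lit 1)) (.lit 0)])]

/-- Compute the pattern without the variables of rank less than register 4, and its lists of
occurrences. -/
def filterProg : Prog := block [
  .assign 7 (.lit 0),
  forLoop 10 0 (block [
    loadA 11 0 (.add (.reg 1) (.reg 10)),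
    loadA 12 0 (.reg 11),
    .ifNonzero (.sub (.add (.reg 12) (.lit 1)) (.reg 4)) (block [
      storeA 1 (.reg 7) (.reg 11),
      loadA 12 3 (.reg 11),
      storeA 2 (.reg 7) (.reg 12),
      .assign 7 (.add (.reg 7) (.lit 1)),
      storeA 3 (.reg 11) (.reg 7)]) .skip])]

/-- Mark the components of the left and of the right copies of the new variables. -/
def flagProg : Prog :=
  forLoop 10 1 (block [
    loadA 12 0 (.reg 10),
    .ifNonzero (.add (.sub (.reg 12) (.reg 4)) (.sub (.reg 4) (.reg 12))) .skip (block [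
      loadA 18 4 (.reg 10), storeA 6 (.reg 18) (.lit 1),
      loadA 18 4 (.add (.reg 1) (.reg 10)), storeA 7 (.reg 18) (.lit 1)])])

/-- Count the components without marks, and look for a component with both marks. -/
def countProg : Prog :=
  forLoop 10 8 (block [
    loadA 11 6 (.add (.reg 10) (.lit 1)),
    loadA 12 7 (.add (.reg 10) (.lit 1)),
    .assign 5 (.mul (.reg 5) (.sub (.lit 1) (.mul (.reg 11) (.reg 12)))),
    .assign 6 (.add (.reg 6) (.sub (.lit 1) (.add (.reg 11) (.reg 12))))])

variable {m : ℕ}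

/-- The parameters of the machine and the contents of the input array. -/
structure Setup (P : RankedPattern m) (k B N : ℕ) (A : ℕ → ℕ) : Prop where
  hB : 16 * N ≤ B
  hN : N = 8 * (P.pat.length + m * k)
  rank_le : ∀ x, P.rank x ≤ k
  rank : ∀ x : Fin m, A x = P.rank x
  pat : ∀ (j : ℕ) (hj : j < P.pat.length), A (m + j) = P.pat[j]

/-- The registers and the array that never change. -/
structure Env (P : RankedPattern m) (k N : ℕ) (A : ℕ → ℕ) (h : Mach) : Prop where
  reg0 : h.reg 0 = P.pat.length
  reg1 : h.reg 1 = m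
  reg2 : h.reg 2 = k
  reg15 : h.reg 15 = N
  arr0 : h.arr 0 = A

variable {P : RankedPattern m} {k B N : ℕ} {A : ℕ → ℕ}

lemma Env.same {h h' : Mach} {R L : List ℕ} (H : Env P k N A h) (S : Mach.Same R L h h')
    (hR : 0 ∉ R ∧ 1 ∉ R ∧ 2 ∉ R ∧ 15 ∉ R) (hA : 0 ∉ L) : Env P k N A h' :=
  ⟨(S.1 _ hR.1).trans H.reg0, (S.1 _ hR.2.1).trans H.reg1, (S.1 _ hR.2.2.1).trans H.reg2,
    (S.1 _ hR.2.2.2).trans H.reg15, (S.2 _ hA).trans H.arr0⟩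

namespace Setup

lemma le_length (P : RankedPattern m) : m ≤ P.pat.length := by
  have := List.toFinset_card_le P.pat
  rwa [(Finset.eq_univ_iff_forall.2 fun x => List.mem_toFinset.2 (P.occurs x)),
    Finset.card_univ, Fintype.card_fin] at this

lemma one_le_m (P : RankedPattern m) : 1 ≤ m := by
  obtain ⟨x, -⟩ := List.exists_mem_of_ne_nil _ P.pat_ne_nil
  have := x.2
  omega

lemma one_le_k (D : Setup P k B N A) : 1 ≤ k := by
  obtain ⟨x, hx⟩ := P.exists_rank_eq_maxRank
  have h₁ := D.rank_le x
  have h₂ := P.rank_pos x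
  omega

lemma maxRank_le (D : Setup P k B N A) : P.maxRank ≤ k := Finset.sup_le fun x _ => D.rank_le x

lemma bounds (D : Setup P k B N A) : 1 ≤ m ∧ 1 ≤ k ∧ m ≤ P.pat.length ∧ m ≤ m * k ∧ k ≤ m * k ∧
    N = 8 * (P.pat.length + m * k) ∧ 16 * N ≤ B := by
  have h₁ := one_le_m P
  have h₂ := D.one_le_k
  exact ⟨h₁, h₂, le_length P, Nat.le_mul_of_pos_right _ (by omega),
    Nat.le_mul_of_pos_left _ (by omega), D.hN, D.hB⟩

end Setup

lemma run_clearProg {h : Mach} (D : Setup P k B N A) (H : Env P k N A h) :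
    Run B N clearProg h (12 * m + 3) fun _ h' => Mach.Same [9, 10] [3, 4, 6, 7] h h' ∧
      (∀ v < 2 * m, h'.arr 3 v = 0) ∧ (∀ v < 2 * m, h'.arr 4 v = 0) ∧
      (∀ d, 1 ≤ d → d ≤ 2 * m → h'.arr 6 d = 0) ∧ (∀ d, 1 ≤ d → d ≤ 2 * m → h'.arr 7 d = 0) := by
  obtain ⟨b₁, b₂, b₃, b₄, b₅, b₆, b₇⟩ := D.bounds
  refine Run.mono (T := 12 * m + 2 + 1) ?_ (by omega) fun _ _ h => h
  refine Run.assign_cons (T := 12 * m + 2) (by simp [Expr.eval, H.reg1]; omega) ?_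
  have e : Expr.eval h.reg (.mul (.lit 2) (.reg 1)) = 2 * m := by simp [Expr.eval, H.reg1]
  rw [e]
  refine Run.cons (Run.mono (Run.forLoop (n := 2 * m) (Tb := 4) (I := fun i g =>
      Mach.Same [9, 10] [3, 4, 6, 7] h g ∧ g.reg 9 = 2 * m ∧
      (∀ v < i, g.arr 3 v = 0) ∧ (∀ v < i, g.arr 4 v = 0) ∧
      (∀ d, 1 ≤ d → d ≤ i → g.arr 6 d = 0) ∧ (∀ d, 1 ≤ d → d ≤ i → g.arr 7 d = 0))
      (P := fun h' => Mach.Same [9, 10] [3, 4, 6, 7] h h' ∧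
      (∀ v < 2 * m, h'.arr 3 v = 0) ∧ (∀ v < 2 * m, h'.arr 4 v = 0) ∧
      (∀ d, 1 ≤ d → d ≤ 2 * m → h'.arr 6 d = 0) ∧ (∀ d, 1 ≤ d → d ≤ 2 * m → h'.arr 7 d = 0))
      (by omega) ?_ ?_ ?_ ?_) (by omega) fun _ _ h => Run.nil h)
  · exact fun i g hg => hg.2.1
  · rintro i hi g ⟨S, r9, h₃, h₄, h₆, h₇⟩ r10
    have E := H.same S (by decide) (by decide)
    refine Run.store_cons (T := 3) b₇ E.reg15 (by norm_num) (by simp [Expr.eval, r10]; omega)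
      (by simp [Expr.eval]; omega) ?_
    refine Run.store_cons (T := 2) b₇ E.reg15 (by norm_num) (by simp [Expr.eval, r10]; omega)
      (by simp [Expr.eval]; omega) ?_
    refine Run.store_cons (T := 1) b₇ E.reg15 (by norm_num) (by simp [Expr.eval, r10]; omega)
      (by simp [Expr.eval]; omega) ?_
    refine Run.store_cons (T := 0) b₇ E.reg15 (by norm_num) (by simp [Expr.eval, r10]; omega)
      (by simp [Expr.eval]; omega) ?_
    refine Run.nil ⟨by simp [r10], ?_, by simp [r9], ?_, ?_, ?_, ?_⟩
    · exact ((((S.setA (by simp) _ _).setA (by simp) _ _).setA (by simp) _ _).setA (by simp) _ _).setR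
        (by simp) _
    · intro v hv
      simp only [Expr.eval, Mach.setA_reg, r10, Mach.setR_arr, Mach.setA_arr]
      by_cases hvi : v = i
      · simp [hvi]
      · simp [hvi, h₃ v (by omega)]
    · intro v hv
      simp only [Expr.eval, Mach.setA_reg, r10, Mach.setR_arr, Mach.setA_arr]
      by_cases hvi : v = i
      · simp [hvi]
      · simp [hvi, h₄ v (by omega)]
    · intro d hd hdi
      simp only [Expr.eval, Mach.setA_reg, r10, Mach.setR_arr, Mach.setA_arr]
      by_cases hvi : d = i + 1
      · simp [hvi]
      · simp [hvi, h₆ d hd (by omega)]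
    · intro d hd hdi
      simp only [Expr.eval, Mach.setA_reg, r10, Mach.setR_arr, Mach.setA_arr]
      by_cases hvi : d = i + 1
      · simp [hvi]
      · simp [hvi, h₇ d hd (by omega)]
  · rintro g ⟨S, -, h⟩ -
    exact ⟨S, h⟩
  · exact ⟨(Mach.Same.rfl.setR (by simp) _).setR (by simp) _, by simp, by simp, by simp,
      fun d h₁ h₂ => by omega, fun d h₁ h₂ => by omega⟩

lemma IsLast.congr {W W' : ℕ → ℕ} {e y p : ℕ} (h : IsLast W e y p) (hW : ∀ j < e, W' j = W j) :
    IsLast W' e y p := by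
  obtain ⟨h₁, h₂, h₃⟩ := h
  refine ⟨h₁, ?_, fun j hj hje => by rw [hW j hje]; exact h₃ j hj hje⟩
  rcases Nat.eq_zero_or_pos p with h0 | h0
  · exact .inl h0
  · rw [hW _ (by omega)]; exact h₂

/-- The arrays hold a word over the variables with its lists of occurrences. -/
structure WordInv (h : Mach) (w : List (Fin m)) : Prop where
  reg7 : h.reg 7 = w.length
  word : ∀ (j : ℕ) (hj : j < w.length), h.arr 1 j = w[j]
  prv : ∀ j < w.length, IsLast (h.arr 1) j (h.arr 1 j) (h.arr 2 j)
  lst : ∀ y < m, IsLast (h.arr 1) w.length y (h.arr 3 y)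

/-- Array 3 holds the last occurrence of each variable found so far. When a position is appended,
the old entry becomes its link, and the increased length, which is this position counted from 1,
replaces the entry. -/
lemma run_filterProg {h : Mach} {i : ℕ} (D : Setup P k B N A) (H : Env P k N A h)
    (h4 : h.reg 4 = i) (h3 : ∀ v < m, h.arr 3 v = 0) :
    Run B N filterProg h (10 * P.pat.length + 3) fun _ h' =>
      Mach.Same [7, 10, 11, 12] [1, 2, 3] h h' ∧ WordInv h' (P.restrict i) := by
  obtain ⟨b₁, b₂, b₃, b₄, b₅, b₆, b₇⟩ := D.bounds
  refine Run.mono (T := 10 * P.pat.length + 2 + 1) ?_ (by omega) fun _ _ h => h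
  refine Run.assign_cons (T := 10 * P.pat.length + 2) (by simp [Expr.eval]; omega) ?_
  refine Run.cons (Run.mono (Run.forLoop (n := P.pat.length) (Tb := 8) (I := fun j g =>
      Mach.Same [7, 10, 11, 12] [1, 2, 3] h g ∧
        WordInv g ((P.pat.take j).filter (fun x => i ≤ P.rank x)))
      (P := fun h' => Mach.Same [7, 10, 11, 12] [1, 2, 3] h h' ∧ WordInv h' (P.restrict i))
      (by omega) ?_ ?_ ?_ ?_) (by omega) fun _ _ h => Run.nil h)
  · exact fun i g hg => (hg.1.1 0 (by decide)).trans H.reg0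
  · rintro j hj g ⟨S, I⟩ r10
    have E := H.same S (by decide) (by decide)
    have r4 : g.reg 4 = i := (S.1 4 (by decide)).trans h4
    set w := (P.pat.take j).filter (fun x => i ≤ P.rank x) with hw
    set x := P.pat[j] with hx
    have hlen : w.length ≤ j := (List.length_filter_le _ _).trans (by simp)
    have hnext : (P.pat.take (j + 1)).filter (fun x => i ≤ P.rank x) =
        w ++ if i ≤ P.rank x then [x] else [] := by
      rw [List.take_succ_eq_append_getElem hj, List.filter_append]
      by_cases hr : i ≤ P.rank P.pat[j] <;> simp [hr, hx, hw]
    refine Run.load_cons (T := 7) b₇ E.reg15 (by norm_num)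
      (by simp [Expr.eval, r10, E.reg1]; omega) ?_
    have e₁ : g.arr 0 (Expr.eval g.reg (.add (.reg 1) (.reg 10))) = x := by
      simp [Expr.eval, r10, E.reg1, E.arr0, D.pat j hj, hx]
    rw [e₁]
    refine Run.load_cons (T := 6) b₇ (by simp [E.reg15]) (by norm_num)
      (by simp [Expr.eval]; omega) ?_
    have e₂ : (g.setR 11 x).arr 0 (Expr.eval (g.setR 11 x).reg (.reg 11)) = P.rank x := by
      simp [Expr.eval, E.arr0, D.rank]
    rw [e₂]
    set g₁ := (g.setR 11 x).setR 12 (P.rank x) with hg₁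
    have S₁ : Mach.Same [7, 10, 11, 12] [1, 2, 3] h g₁ := (S.setR (by simp) _).setR (by simp) _
    have E₁ := H.same S₁ (by decide) (by decide)
    refine Run.ite_cons (T := 5) (fun hc => ?_) (fun hc => ?_)
    · have hr : i ≤ P.rank x := by
        simp [Expr.eval, hg₁, r4] at hc
        omega
      rw [if_pos hr] at hnext
      have r7 : g₁.reg 7 = w.length := by simp [hg₁, I.reg7]
      have r11 : g₁.reg 11 = x := by simp [hg₁]
      refine Run.store_cons (T := 4) b₇ E₁.reg15 (by norm_num) (by simp [Expr.eval, r7]; omega)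
        (by simp [Expr.eval, r11]; omega) ?_
      set g₂ := g₁.setA 1 (Expr.eval g₁.reg (.reg 7)) (Expr.eval g₁.reg (.reg 11)) with hg₂
      refine Run.load_cons (T := 3) b₇ E₁.reg15 (by norm_num)
        (by simp [Expr.eval, hg₂, r11]; omega) ?_
      have hlx := I.lst x x.2
      have e₃ : g₂.arr 3 (Expr.eval g₂.reg (.reg 11)) = g.arr 3 x := by
        simp [Expr.eval, hg₂, hg₁]
      rw [e₃]
      have e₃' : g.arr 3 x ≤ w.length := hlx.1
      refine Run.store_cons (T := 2) b₇ (by simp [hg₂, E₁.reg15]) (by norm_num)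
        (by simp [Expr.eval, hg₂, r7]; omega) (by simp [Expr.eval]; omega) ?_
      refine Run.assign_cons (T := 1) (by simp [Expr.eval, hg₂, r7]; omega) ?_
      refine Run.store_cons (T := 0) b₇ (by simp [hg₂, E₁.reg15]) (by norm_num)
        (by simp [Expr.eval, hg₂, r11]; omega) (by simp [Expr.eval, hg₂, r7]; omega) ?_
      refine Run.nil (Run.nil ⟨by simp [hg₂, hg₁, r10], ?_, ?_⟩)
      · exact (((((S₁.setA (by simp) _ _).setR (by simp) _).setA (by simp) _ _).setR
          (by simp) _).setA (by simp) _ _).setR (by simp) _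
      rw [hnext]
      have q1 : ∀ p < w.length, Function.update (g.arr 1) w.length x p = g.arr 1 p := fun p hp =>
        Function.update_of_ne hp.ne _ _
      have a1 : g₂.arr 1 = Function.update (g.arr 1) w.length x := by
        funext p; simp [hg₂, hg₁, Expr.eval, I.reg7, Function.update_apply]
      refine ⟨by simp [hg₂, Expr.eval, r7], ?_, ?_, ?_⟩
      · intro p hp
        simp only [List.length_append, List.length_singleton] at hp
        simp only [Mach.setR_arr, ne_eq, OfNat.one_ne_ofNat, not_false_eq_true,
          Mach.setA_arr_of_ne, a1]
        rcases Nat.lt_succ_iff_lt_or_eq.1 hp with hp | rfl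
        · rw [q1 p hp, I.word p hp, List.getElem_append_left hp]
        · simp
      · intro p hp
        simp only [List.length_append, List.length_singleton] at hp
        simp only [Mach.setR_arr, ne_eq, OfNat.one_ne_ofNat, not_false_eq_true,
          Mach.setA_arr_of_ne, a1, Nat.reduceEqDiff, Expr.eval,
          Mach.setR_reg, Mach.setA_arr_self, if_true, if_false]
        have r7' : g₂.reg 7 = w.length := by simp [hg₂, r7]
        simp only [r7']
        rcases Nat.lt_succ_iff_lt_or_eq.1 hp with hp | rfl
        · rw [q1 p hp, if_neg hp.ne]
          have e₄ : g₂.arr 2 p = g.arr 2 p := by simp [hg₂, hg₁]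
          rw [e₄]
          exact IsLast.congr (I.prv p hp) fun q hq => q1 q (by omega)
        · rw [if_pos rfl, Function.update_self]
          exact IsLast.congr hlx q1
      · intro y hy
        have hlen' : (w ++ [x]).length = w.length + 1 := by simp
        rw [hlen']
        have r7' : g₂.reg 7 = w.length := by simp [hg₂, r7]
        have r11' : g₂.reg 11 = x := by simp [hg₂, r11]
        have e₄ : g₂.arr 3 y = g.arr 3 y := by simp [hg₂, hg₁]
        simp only [Mach.setR_arr, ne_eq, OfNat.one_ne_ofNat, not_false_eq_true,
          Mach.setA_arr_of_ne, a1, Nat.reduceEqDiff, Expr.eval,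
          Mach.setR_reg, Mach.setA_reg, Mach.setA_arr_self, if_true, if_false, r7', r11', e₄]
        by_cases hyx : y = x
        · rw [if_pos hyx]
          exact ⟨le_rfl, .inr (by simp [hyx]), fun p h₁ h₂ => by omega⟩
        · rw [if_neg hyx]
          have hl := IsLast.congr (I.lst y hy) q1
          refine ⟨hl.1.trans (by omega), hl.2.1, fun p h₁ h₂ => ?_⟩
          rcases Nat.lt_succ_iff_lt_or_eq.1 h₂ with h₂ | rfl
          · exact hl.2.2 p h₁ h₂
          · rw [Function.update_self]; exact Ne.symm hyx
    · have hr : ¬ i ≤ P.rank x := by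
        simp [Expr.eval, hg₁, r4] at hc
        omega
      rw [if_neg hr, List.append_nil] at hnext
      refine Run.skip (Run.nil ⟨by simp [hg₁, r10], S₁.setR (by simp) _, ?_⟩)
      rw [hnext]
      exact ⟨by simp [hg₁, I.reg7], I.word, I.prv, I.lst⟩
  · rintro g ⟨S, I⟩ -
    rw [List.take_length] at I
    exact ⟨S, I⟩
  · refine ⟨(Mach.Same.rfl.setR (by simp) _).setR (by simp) _, by simp [Expr.eval], by simp,
      by simp, fun y hy => ?_⟩
    simp only [Mach.setR_arr, h3 y hy]
    exact ⟨by simp, .inl rfl, fun j _ hj => by simp at hj⟩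

end ZiminMatching

/-! ### Marking the components of new variables, detecting conflicts, counting the rest. -/

namespace ZiminMatching

open BFS

variable {m : ℕ} {P : RankedPattern m} {k B N : ℕ} {A : ℕ → ℕ}

lemma run_flagProg {h : Mach} {i : ℕ} (D : Setup P k B N A) (H : Env P k N A h)
    (h4 : h.reg 4 = i)
    (hlab : ∀ x : Fin m, P.rank x = i → h.arr 4 x ≤ 2 * m ∧ h.arr 4 (m + x) ≤ 2 * m)
    (h6 : ∀ d, 1 ≤ d → d ≤ 2 * m → h.arr 6 d = 0)
    (h7 : ∀ d, 1 ≤ d → d ≤ 2 * m → h.arr 7 d = 0) :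
    Run B N flagProg h (8 * m + 2) fun _ h' =>
      Mach.Same [10, 12, 18] [6, 7] h h' ∧
      ∀ d, 1 ≤ d → d ≤ 2 * m →
        (h'.arr 6 d ≠ 0 ↔ ∃ x : Fin m, P.rank x = i ∧ h.arr 4 x = d) ∧
        (h'.arr 7 d ≠ 0 ↔ ∃ x : Fin m, P.rank x = i ∧ h.arr 4 (m + x) = d) := by
  obtain ⟨b₁, b₂, b₃, b₄, b₅, b₆, b₇⟩ := D.bounds
  refine Run.mono (Run.forLoop (n := m) (Tb := 6) (I := fun j g =>
      Mach.Same [10, 12, 18] [6, 7] h g ∧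
      ∀ d, 1 ≤ d → d ≤ 2 * m →
        (g.arr 6 d ≠ 0 ↔ ∃ x : Fin m, x < j ∧ P.rank x = i ∧ h.arr 4 x = d) ∧
        (g.arr 7 d ≠ 0 ↔ ∃ x : Fin m, x < j ∧ P.rank x = i ∧ h.arr 4 (m + x) = d))
      (P := fun h' => Mach.Same [10, 12, 18] [6, 7] h h' ∧
      ∀ d, 1 ≤ d → d ≤ 2 * m →
        (h'.arr 6 d ≠ 0 ↔ ∃ x : Fin m, P.rank x = i ∧ h.arr 4 x = d) ∧
        (h'.arr 7 d ≠ 0 ↔ ∃ x : Fin m, P.rank x = i ∧ h.arr 4 (m + x) = d))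
      (by omega) ?_ ?_ ?_ ?_) (by omega) fun _ _ h => h
  · exact fun i g hg => (hg.1.1 1 (by decide)).trans H.reg1
  · rintro j hj g ⟨S, I⟩ r10
    have E := H.same S (by decide) (by decide)
    have r4 : g.reg 4 = i := (S.1 4 (by decide)).trans h4
    have a4 : g.arr 4 = h.arr 4 := S.2 4 (by decide)
    obtain ⟨x, rfl⟩ : ∃ x : Fin m, (x : ℕ) = j := ⟨⟨j, hj⟩, rfl⟩
    have hex : ∀ p : Fin m → Prop, (∃ y : Fin m, (y : ℕ) < x + 1 ∧ p y) ↔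
        (∃ y : Fin m, (y : ℕ) < x ∧ p y) ∨ p x := by
      intro p
      constructor
      · rintro ⟨y, hy, h⟩
        rcases Nat.lt_succ_iff_lt_or_eq.1 hy with hy | hy
        · exact .inl ⟨y, hy, h⟩
        · rw [show y = x from Fin.ext hy] at h
          exact .inr h
      · rintro (⟨y, hy, h⟩ | h)
        · exact ⟨y, by omega, h⟩
        · exact ⟨x, by omega, h⟩
    refine Run.load_cons (T := 5) b₇ E.reg15 (by norm_num)
      (by simp [Expr.eval, r10]; omega) ?_
    have e₁ : g.arr 0 (Expr.eval g.reg (.reg 10)) = P.rank x := by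
      simp [Expr.eval, r10, E.arr0, ← D.rank x]
    rw [e₁]
    set g₁ := g.setR 12 (P.rank x) with hg₁
    have S₁ : Mach.Same [10, 12, 18] [6, 7] h g₁ := S.setR (by simp) _
    have r10' : g₁.reg 10 = x := by simp [hg₁, r10]
    have r1' : g₁.reg 1 = m := by simp [hg₁, E.reg1]
    have r4' : g₁.reg 4 = i := by simp [hg₁, r4]
    have r12' : g₁.reg 12 = P.rank x := by simp [hg₁]
    have a4' : g₁.arr 4 = h.arr 4 := a4
    have ha' : g₁.arr = g.arr := rfl
    clear_value g₁
    refine Run.ite_cons (T := 4) (fun hc => ?_) (fun hc => ?_)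
    · have hr : P.rank x ≠ i := by
        simp [Expr.eval, r12', r4'] at hc
        omega
      refine Run.skip (Run.nil ⟨r10', S₁.setR (by simp) _, fun d h₁ h₂ => ?_⟩)
      obtain ⟨I₁, I₂⟩ := I d h₁ h₂
      rw [hex, hex]
      simp only [Mach.setR_arr, ha', hr, false_and, or_false]
      exact ⟨I₁, I₂⟩
    · have hr : P.rank x = i := by
        simp [Expr.eval, r12', r4'] at hc
        omega
      obtain ⟨l₁, l₂⟩ := hlab x hr
      have E₁ := H.same S₁ (by decide) (by decide)
      refine Run.load_cons (T := 3) b₇ E₁.reg15 (by norm_num)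
        (by simp [Expr.eval, r10']; omega) ?_
      have e₂ : g₁.arr 4 (Expr.eval g₁.reg (.reg 10)) = h.arr 4 x := by
        simp [Expr.eval, r10', a4']
      rw [e₂]
      refine Run.store_cons (T := 2) b₇ (by simp [E₁.reg15]) (by norm_num)
        (by simp [Expr.eval]; omega) (by simp [Expr.eval]; omega) ?_
      have e₃ : Expr.eval (g₁.setR 18 (h.arr 4 x)).reg (.reg 18) = h.arr 4 x := by
        simp [Expr.eval]
      rw [e₃]
      refine Run.load_cons (T := 1) b₇ (by simp [E₁.reg15]) (by norm_num)
        (by simp [Expr.eval, r10', r1']; omega) ?_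
      have e₄ : ∀ v, ((g₁.setR 18 (h.arr 4 x)).setA 6 (h.arr 4 x) v).arr 4
          (Expr.eval ((g₁.setR 18 (h.arr 4 x)).setA 6 (h.arr 4 x) v).reg (.add (.reg 1) (.reg 10)))
          = h.arr 4 (m + x) := by
        simp [Expr.eval, r10', r1', a4']
      rw [e₄]
      refine Run.store_cons (T := 0) b₇ (by simp [E₁.reg15]) (by norm_num)
        (by simp [Expr.eval]; omega) (by simp [Expr.eval]; omega) ?_
      refine Run.nil (Run.nil ⟨by simp [r10'], ?_, fun d h₁ h₂ => ?_⟩)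
      · exact ((((S₁.setR (by simp) _).setA (by simp) _ _).setR (by simp) _).setA
          (by simp) _ _).setR (by simp) _
      obtain ⟨I₁, I₂⟩ := I d h₁ h₂
      rw [hex, hex]
      constructor
      · rw [← I₁]
        by_cases hd : d = h.arr 4 x
        · simp [Expr.eval, hd, hr]
        · simp [Expr.eval, hd, Ne.symm hd, ha']
      · rw [← I₂]
        by_cases hd : d = h.arr 4 (m + x)
        · simp [Expr.eval, hd, hr]
        · simp [Expr.eval, hd, Ne.symm hd, ha']
  · rintro g ⟨S, I⟩ -
    refine ⟨S, fun d h₁ h₂ => ?_⟩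
    obtain ⟨I₁, I₂⟩ := I d h₁ h₂
    simpa using And.intro I₁ I₂
  · refine ⟨Mach.Same.rfl.setR (by simp) _, fun d h₁ h₂ => ?_⟩
    simp [h6 d h₁ h₂, h7 d h₁ h₂]

/-- With truncated subtraction, 1 - f₆f₇ vanishes exactly when both marks are present, so register 5
becomes 0 at the first conflict and stays 0. Likewise 1 - (f₆ + f₇) is 1 exactly for a component
without marks. -/
lemma run_countProg {h : Mach} {c l : ℕ} (D : Setup P k B N A) (H : Env P k N A h)
    (h8 : h.reg 8 = c) (hc : c ≤ 2 * m) (h6 : h.reg 6 = l) (hl : l + 2 * m < B)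
    (h5 : h.reg 5 < B) : Run B N countProg h (12 * m + 2) fun _ h' =>
      Mach.Same [5, 6, 10, 11, 12] [] h h' ∧
      h'.reg 6 = l + ((Finset.range c).filter fun d =>
        h.arr 6 (d + 1) = 0 ∧ h.arr 7 (d + 1) = 0).card ∧
      ((∃ d < c, h.arr 6 (d + 1) ≠ 0 ∧ h.arr 7 (d + 1) ≠ 0) → h'.reg 5 = 0) ∧
      ((¬ ∃ d < c, h.arr 6 (d + 1) ≠ 0 ∧ h.arr 7 (d + 1) ≠ 0) → h'.reg 5 = h.reg 5) := by
  obtain ⟨b₁, b₂, b₃, b₄, b₅, b₆, b₇⟩ := D.bounds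
  refine Run.mono (Run.forLoop (n := c) (Tb := 4) (I := fun j g =>
      Mach.Same [5, 6, 10, 11, 12] [] h g ∧
      g.reg 6 = l + ((Finset.range j).filter fun d =>
        h.arr 6 (d + 1) = 0 ∧ h.arr 7 (d + 1) = 0).card ∧
      ((∃ d < j, h.arr 6 (d + 1) ≠ 0 ∧ h.arr 7 (d + 1) ≠ 0) → g.reg 5 = 0) ∧
      ((¬ ∃ d < j, h.arr 6 (d + 1) ≠ 0 ∧ h.arr 7 (d + 1) ≠ 0) → g.reg 5 = h.reg 5))
      (P := fun h' => Mach.Same [5, 6, 10, 11, 12] [] h h' ∧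
      h'.reg 6 = l + ((Finset.range c).filter fun d =>
        h.arr 6 (d + 1) = 0 ∧ h.arr 7 (d + 1) = 0).card ∧
      ((∃ d < c, h.arr 6 (d + 1) ≠ 0 ∧ h.arr 7 (d + 1) ≠ 0) → h'.reg 5 = 0) ∧
      ((¬ ∃ d < c, h.arr 6 (d + 1) ≠ 0 ∧ h.arr 7 (d + 1) ≠ 0) → h'.reg 5 = h.reg 5))
      (by omega) ?_ ?_ (fun g h _ => h) ?_) (by omega) fun _ _ h => h
  · exact fun i g hg => (hg.1.1 8 (by decide)).trans h8
  · rintro j hj g ⟨S, I₁, I₂, I₃⟩ r10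
    have E := H.same S (by decide) (by decide)
    have a6 : g.arr 6 = h.arr 6 := S.2 6 (by decide)
    have a7 : g.arr 7 = h.arr 7 := S.2 7 (by decide)
    have hcard : ((Finset.range j).filter fun d =>
        h.arr 6 (d + 1) = 0 ∧ h.arr 7 (d + 1) = 0).card ≤ j :=
      (Finset.card_filter_le _ _).trans (by simp)
    have hex : (∃ d < j + 1, h.arr 6 (d + 1) ≠ 0 ∧ h.arr 7 (d + 1) ≠ 0) ↔
        (∃ d < j, h.arr 6 (d + 1) ≠ 0 ∧ h.arr 7 (d + 1) ≠ 0) ∨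
          (h.arr 6 (j + 1) ≠ 0 ∧ h.arr 7 (j + 1) ≠ 0) := by
      constructor
      · rintro ⟨d, hd, h⟩
        rcases Nat.lt_succ_iff_lt_or_eq.1 hd with hd | rfl
        · exact .inl ⟨d, hd, h⟩
        · exact .inr h
      · rintro (⟨d, hd, h⟩ | h)
        · exact ⟨d, by omega, h⟩
        · exact ⟨j, by omega, h⟩
    rw [hex, Finset.range_add_one, Finset.filter_insert]
    refine Run.load_cons (T := 3) b₇ E.reg15 (by norm_num)
      (by simp [Expr.eval, r10]; omega) ?_
    refine Run.load_cons (T := 2) b₇ (by simp [E.reg15]) (by norm_num)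
      (by simp [Expr.eval, r10]; omega) ?_
    set g₁ := (g.setR 11 (g.arr 6 (Expr.eval g.reg (.add (.reg 10) (.lit 1))))).setR 12
      ((g.setR 11 (g.arr 6 (Expr.eval g.reg (.add (.reg 10) (.lit 1))))).arr 7
        (Expr.eval (g.setR 11 (g.arr 6 (Expr.eval g.reg (.add (.reg 10) (.lit 1))))).reg
          (.add (.reg 10) (.lit 1)))) with hg₁
    have S₁ : Mach.Same [5, 6, 10, 11, 12] [] h g₁ := (S.setR (by simp) _).setR (by simp) _
    have r11 : g₁.reg 11 = h.arr 6 (j + 1) := by simp [hg₁, Expr.eval, r10, a6]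
    have r12 : g₁.reg 12 = h.arr 7 (j + 1) := by simp [hg₁, Expr.eval, r10, a7]
    have r10' : g₁.reg 10 = j := by simp [hg₁, r10]
    have r5 : g₁.reg 5 = g.reg 5 := by simp [hg₁]
    have r6 : g₁.reg 6 = g.reg 6 := by simp [hg₁]
    clear_value g₁
    have g5 : g.reg 5 ≤ h.reg 5 := by
      by_cases hd : ∃ d < j, h.arr 6 (d + 1) ≠ 0 ∧ h.arr 7 (d + 1) ≠ 0
      · rw [I₂ hd]; omega
      · rw [I₃ hd]
    refine Run.assign_cons (T := 1) ?_ ?_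
    · simp only [Expr.eval, r5]
      exact lt_of_le_of_lt ((Nat.mul_le_mul_left _ (Nat.sub_le _ _)).trans (by omega)) h5
    refine Run.assign_cons (T := 0) (by simp [Expr.eval, r6, I₁]; omega) (Run.nil ⟨by simp [r10'],
      ((S₁.setR (by simp) _).setR (by simp) _).setR (by simp) _, ?_, ?_, ?_⟩)
    · by_cases hb : h.arr 6 (j + 1) = 0 ∧ h.arr 7 (j + 1) = 0
      · rw [if_pos hb, Finset.card_insert_of_notMem (by simp)]
        simp [Expr.eval, r6, I₁, r11, r12, hb, add_assoc]
      · rw [if_neg hb]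
        simp [Expr.eval, r6, I₁, r11, r12]
        omega
    · rintro (hd | ⟨hd, hd'⟩)
      · simp [Expr.eval, r5, I₂ hd]
      · have := Nat.mul_pos (Nat.pos_of_ne_zero hd) (Nat.pos_of_ne_zero hd')
        simp [Expr.eval, r11, r12]
        right
        omega
    · intro hd
      rw [not_or] at hd
      have : h.arr 6 (j + 1) * h.arr 7 (j + 1) = 0 := by
        rw [Nat.mul_eq_zero]
        by_contra hz
        exact hd.2 (not_or.1 hz)
      simp [Expr.eval, r11, r12, r5, this, I₃ hd.1]
  · exact ⟨Mach.Same.rfl.setR (by simp) _, by simp [h6], by simp, by simp⟩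

end ZiminMatching

namespace ZiminMatching

open BFS

/-! ### The values of the variables as deques -/

/-- Mark the component of the right copy of the first variable as one in which the left copies have
the value 1, unless it is decided. -/
def firstProg : Prog := block [
  loadA 11 1 (.lit 0),
  loadA 18 4 (.add (.reg 1) (.reg 11)),
  loadA 12 7 (.reg 18),
  .ifNonzero (.reg 12) .skip (storeA 6 (.reg 18) (.lit 1))]

/-- Insert the current letter at the ends of the value of a variable. -/
def insertProg : Prog := block [
  loadA 13 8 (.mul (.lit 2) (.reg 10)), loadA 14 8 (.add (.mul (.lit 2) (.reg 10)) (.lit 1)),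
  loadA 11 4 (.add (.reg 1) (.reg 10)), loadA 11 6 (.reg 11),
  loadA 18 4 (.reg 10), loadA 18 6 (.reg 18),
  storeA 9 (.sub (.sub (.reg 13) (.mul (.lit 9) (.reg 15))) (.lit 1)) (.reg 4),
  .assign 11 (.sub (.lit 1) (.add (.reg 11) (.sub (.lit 1) (.sub (.reg 12) (.reg 4))))),
  .assign 13 (.sub (.reg 13) (.reg 11)), .assign 14 (.add (.reg 14) (.reg 11)),
  storeA 9 (.sub (.add (.reg 13) (.reg 14)) (.mul (.lit 9) (.reg 15))) (.reg 4),
  .assign 14 (.add (.reg 14) (.sub (.lit 1) (.sub (.lit 1) (.reg 18)))),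
  storeA 8 (.mul (.lit 2) (.reg 10)) (.reg 13),
  storeA 8 (.add (.mul (.lit 2) (.reg 10)) (.lit 1)) (.reg 14)]

/-- Insert the current letter at the ends of all values. -/
def updateProg : Prog :=
  forLoop 10 1 (block [
    loadA 12 0 (.reg 10),
    .ifNonzero (.sub (.add (.reg 12) (.lit 1)) (.reg 4)) insertProg .skip])

/-- The word `u` is stored as the value of `x`, with room for `i` letters at each end. -/
def Slot (N k i x : ℕ) (u : List ℕ) (tab dq : ℕ → ℕ) : Prop :=
  ∃ p, tab (2 * x) = 9 * N + p ∧ tab (2 * x + 1) = u.length ∧ x * (2 * k + 1) + i ≤ p ∧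
    p + u.length + i ≤ x * (2 * k + 1) + (2 * k + 1) ∧
    ∀ (j : ℕ) (hj : j < u.length), dq (p + j) = u[j]

variable {m : ℕ} {P : RankedPattern m} {k B N : ℕ} {A : ℕ → ℕ}

lemma Slot.mono {N k i i' x : ℕ} {u : List ℕ} {tab dq : ℕ → ℕ} (H : Slot N k i x u tab dq)
    (hi : i' ≤ i) : Slot N k i' x u tab dq := by
  obtain ⟨p, h₁, h₂, h₃, h₄, h₅⟩ := H
  exact ⟨p, h₁, h₂, by omega, by omega, h₅⟩

lemma Slot.congr {N k i x : ℕ} {u : List ℕ} {tab dq tab' dq' : ℕ → ℕ} (H : Slot N k i x u tab dq)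
    (h₀ : tab' (2 * x) = tab (2 * x)) (h₁ : tab' (2 * x + 1) = tab (2 * x + 1))
    (h : ∀ j, x * (2 * k + 1) ≤ j → j < x * (2 * k + 1) + (2 * k + 1) → dq' j = dq j) :
    Slot N k i x u tab' dq' := by
  obtain ⟨p, a₁, a₂, a₃, a₄, a₅⟩ := H
  exact ⟨p, h₀.trans a₁, h₁.trans a₂, a₃, a₄, fun j hj => by
    rw [h _ (by omega) (by omega), a₅ j hj]⟩

section Steps

variable {h : Mach} {T j v : ℕ} {Q : ℕ → Mach → Prop} {e : Expr} {l : List Prog}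

lemma Run.assign_eq {r : ℕ} (he : e.eval h.reg = v) (hv : v < B)
    (H : Run B N (block l) (h.setR r v) T Q) :
    Run B N (block (.assign r e :: l)) h (T + 1) Q := by
  subst he
  exact Run.assign_cons hv H

lemma Run.load_eq {r a : ℕ} (hB : 16 * N ≤ B) (h15 : h.reg 15 = N) (ha : a < 16)
    (he : e.eval h.reg = j) (hj : j < N) (hv : h.arr a j = v)
    (H : Run B N (block l) (h.setR r v) T Q) :
    Run B N (block (loadA r a e :: l)) h (T + 1) Q := by
  subst he hv
  exact Run.load_cons hB h15 ha hj H

lemma Run.store_eq {a : ℕ} {e' : Expr} (hB : 16 * N ≤ B) (h15 : h.reg 15 = N) (ha : a < 16)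
    (he : e.eval h.reg = j) (hj : j < N) (he' : e'.eval h.reg = v) (hv : v < B)
    (H : Run B N (block l) (h.setA a j v) T Q) :
    Run B N (block (storeA a e e' :: l)) h (T + 1) Q := by
  subst he he'
  exact Run.store_cons hB h15 ha hj hv H

end Steps

lemma run_firstProg {h : Mach} {L : ℕ} (D : Setup P k B N A) (H : Env P k N A h)
    (hx : h.arr 1 0 < m) (hL : h.arr 4 (m + h.arr 1 0) = L) (hL' : L ≤ 2 * m) :
    Run B N firstProg h 5 fun _ h' => Mach.Same [11, 12, 18] [6] h h' ∧
      ∀ d, h'.arr 6 d ≠ 0 ↔ h.arr 6 d ≠ 0 ∨ (h.arr 7 L = 0 ∧ d = L) := by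
  obtain ⟨b₁, b₂, b₃, b₄, b₅, b₆, b₇⟩ := D.bounds
  refine Run.load_cons (T := 4) b₇ H.reg15 (by norm_num) (by simp [Expr.eval]; omega) ?_
  have e₁ : h.arr 1 (Expr.eval h.reg (.lit 0)) = h.arr 1 0 := rfl
  rw [e₁]
  refine Run.load_cons (T := 3) b₇ (by simp [H.reg15]) (by norm_num)
    (by simp [Expr.eval, H.reg1]; omega) ?_
  have e₂ : (h.setR 11 (h.arr 1 0)).arr 4 (Expr.eval (h.setR 11 (h.arr 1 0)).reg
      (.add (.reg 1) (.reg 11))) = L := by simp [Expr.eval, H.reg1, hL]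
  rw [e₂]
  refine Run.load_cons (T := 2) b₇ (by simp [H.reg15]) (by norm_num)
    (by simp [Expr.eval]; omega) ?_
  have e₃ : ((h.setR 11 (h.arr 1 0)).setR 18 L).arr 7
      (Expr.eval ((h.setR 11 (h.arr 1 0)).setR 18 L).reg (.reg 18)) = h.arr 7 L := by
    simp [Expr.eval]
  rw [e₃]
  have S : Mach.Same [11, 12, 18] [6] h
      (((h.setR 11 (h.arr 1 0)).setR 18 L).setR 12 (h.arr 7 L)) :=
    ((Mach.Same.rfl.setR (by simp) _).setR (by simp) _).setR (by simp) _
  refine Run.ite_cons (T := 1) (fun hc => ?_) (fun hc => ?_)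
  · have hc' : h.arr 7 L ≠ 0 := by simpa [Expr.eval] using hc
    exact Run.skip (Run.nil ⟨S, fun d => by simp [hc']⟩)
  · have hc' : h.arr 7 L = 0 := by simpa [Expr.eval] using hc
    refine Run.store b₇ (by simp [H.reg15]) (by norm_num) (by simp [Expr.eval]; omega)
      (by simp [Expr.eval]; omega) (Run.nil ⟨S.setA (by simp) _ _, fun d => ?_⟩)
    by_cases hd : d = L <;> simp [Expr.eval, hc', hd]

/-- The letter is written into the free cells on both sides of the value unconditionally; whether it
belongs to the value is decided by the stored address and length alone. Each call uses up at most
one cell of the room at either end. -/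
lemma run_insertProg {h : Mach} {i x r : ℕ} {u : List ℕ} (D : Setup P k B N A)
    (H : Env P k N A h) (hx : x < m) (h10 : h.reg 10 = x) (h4 : h.reg 4 = i) (h12 : h.reg 12 = r)
    (hi : i < k) (hL : h.arr 4 x ≤ 2 * m) (hR : h.arr 4 (m + x) ≤ 2 * m)
    (hu : Slot N k (i + 1) x u (h.arr 8) (h.arr 9)) :
    Run B N insertProg h 14 fun _ h' => Mach.Same [11, 13, 14, 18] [8, 9] h h' ∧
      Slot N k i x ((if h.arr 6 (h.arr 4 (m + x)) = 0 ∧ i < r then [i] else []) ++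
        (u ++ if h.arr 6 (h.arr 4 x) ≠ 0 then [i] else [])) (h'.arr 8) (h'.arr 9) ∧
      ∀ y ≠ x, ∀ i' v, Slot N k i' y v (h.arr 8) (h.arr 9) →
        Slot N k i' y v (h'.arr 8) (h'.arr 9) := by
  obtain ⟨b₁, b₂, b₃, b₄, b₅, b₆, b₇⟩ := D.bounds
  obtain ⟨p, t₁, t₂, l₁, l₂, hd⟩ := hu
  have hseg : x * (2 * k + 1) + (2 * k + 1) ≤ 2 * (m * k) + m := by
    calc x * (2 * k + 1) + (2 * k + 1) = (x + 1) * (2 * k + 1) := by ring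
      _ ≤ m * (2 * k + 1) := Nat.mul_le_mul_right _ hx
      _ = _ := by ring
  set f := h.arr 6 (h.arr 4 (m + x)) with hf
  set g := h.arr 6 (h.arr 4 x) with hg
  -- The bit for the front: 1 iff the component of the right copy is unmarked and the rank exceeds
  -- `i`. Thus a new variable gets no letter in front.
  set b := 1 - (f + (1 - (r - i))) with hb
  have hb1 : b ≤ 1 := by omega
  have r15 := H.reg15
  have r1 := H.reg1
  refine Run.load_eq (j := 2 * x) (v := 9 * N + p) (T := 13) b₇ r15 (by norm_num)
    (by simp [Expr.eval, h10]) (by omega) (by simp [t₁]) ?_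
  refine Run.load_eq (j := 2 * x + 1) (v := u.length) (T := 12) b₇ (by simp [r15]) (by norm_num)
    (by simp [Expr.eval, h10]) (by omega) (by simp [t₂]) ?_
  refine Run.load_eq (j := m + x) (v := h.arr 4 (m + x)) (T := 11) b₇ (by simp [r15]) (by norm_num)
    (by simp [Expr.eval, h10, r1]) (by omega) (by simp) ?_
  refine Run.load_eq (j := h.arr 4 (m + x)) (v := f) (T := 10) b₇ (by simp [r15]) (by norm_num)
    (by simp [Expr.eval]) (by omega) (by simp [hf]) ?_
  refine Run.load_eq (j := x) (v := h.arr 4 x) (T := 9) b₇ (by simp [r15]) (by norm_num)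
    (by simp [Expr.eval, h10]) (by omega) (by simp) ?_
  refine Run.load_eq (j := h.arr 4 x) (v := g) (T := 8) b₇ (by simp [r15]) (by norm_num)
    (by simp [Expr.eval]) (by omega) (by simp [hg]) ?_
  refine Run.store_eq (j := p - 1) (v := i) (T := 7) b₇ (by simp [r15]) (by norm_num)
    (by simp [Expr.eval, r15]) (by omega) (by simp [Expr.eval, h4]) (by omega) ?_
  refine Run.assign_eq (v := b) (T := 6) (by simp [Expr.eval, h12, h4, hb]) (by omega) ?_
  refine Run.assign_eq (v := 9 * N + p - b) (T := 5) (by simp [Expr.eval]) (by omega) ?_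
  refine Run.assign_eq (v := u.length + b) (T := 4) (by simp [Expr.eval]) (by omega) ?_
  -- Moving the start back by `b` and lengthening by `b` leaves the address behind the last letter
  -- unchanged.
  refine Run.store_eq (j := p + u.length) (v := i) (T := 3) b₇ (by simp [r15]) (by norm_num)
    (by simp [Expr.eval, r15]; omega) (by omega) (by simp [Expr.eval, h4]) (by omega) ?_
  refine Run.assign_eq (v := u.length + b + (1 - (1 - g))) (T := 2) (by simp [Expr.eval])
    (by omega) ?_
  refine Run.store_eq (j := 2 * x) (v := 9 * N + p - b) (T := 1) b₇ (by simp [r15]) (by norm_num)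
    (by simp [Expr.eval, h10]) (by omega) (by simp [Expr.eval]) (by omega) ?_
  refine Run.store_eq (j := 2 * x + 1) (v := u.length + b + (1 - (1 - g))) (T := 0) b₇
    (by simp [r15]) (by norm_num)
    (by simp [Expr.eval, h10]) (by omega) (by simp [Expr.eval]) (by omega) ?_
  refine Run.nil ⟨?_, ?_, ?_⟩
  · repeat' first
      | exact Mach.Same.rfl
      | refine Mach.Same.setR ?_ (by simp) _
      | refine Mach.Same.setA ?_ (by simp) _ _
  · have hbi : (f = 0 ∧ i < r) ↔ b = 1 := by omega
    refine ⟨p - b, by simp; omega, ?_, by omega, ?_, ?_⟩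
    · by_cases hg0 : g = 0 <;> by_cases hb0 : b = 1 <;> simp [hbi, hg0, hb0] <;> omega
    · by_cases hg0 : g = 0 <;> by_cases hb0 : b = 1 <;> simp [hbi, hg0, hb0] <;> omega
    · intro j hj
      simp only [Mach.setA_arr, Mach.setR_arr]
      have main : ∀ q (hq : q < (u ++ if g ≠ 0 then [i] else []).length),
          (if p + q = p + u.length then i else if p + q = p - 1 then i else h.arr 9 (p + q)) =
            (u ++ if g ≠ 0 then [i] else [])[q] := by
        intro q hq
        by_cases hqu : q < u.length
        · rw [if_neg (by omega), if_neg (by omega), List.getElem_append_left hqu, hd q hqu]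
        · have hg0 : g ≠ 0 := by
            rintro hg0
            simp [hg0] at hq
            omega
          have : q = u.length := by
            simp [hg0] at hq
            omega
          subst this
          simp [hg0]
      by_cases hb0 : b = 1
      · have hbi' := hbi.2 hb0
        simp only [hbi', and_self, if_true] at hj ⊢
        rcases j with _ | j
        · simp [hb0]
        · have := main j (by simpa using hj)
          simp only [List.singleton_append, List.getElem_cons_succ]
          rw [← this, show p - b + (j + 1) = p + j by omega]
          simp
      · have hbi' : ¬ (f = 0 ∧ i < r) := fun h => hb0 (hbi.1 h)
        have hb0' : b = 0 := by omega
        simp only [hbi', if_false, List.nil_append] at hj ⊢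
        have := main j hj
        rw [← this, hb0', Nat.sub_zero]
        simp
  · intro y hy i' v hv
    have n₁ : 2 * y ≠ 2 * x + 1 := by omega
    have n₂ : 2 * y + 1 ≠ 2 * x := by omega
    refine hv.congr (by simp [hy, n₁]) (by simp [hy, n₂]) fun j h₁ h₂ => ?_
    -- The segments of different variables are disjoint.
    have hne : j < x * (2 * k + 1) ∨ x * (2 * k + 1) + (2 * k + 1) ≤ j := by
      rcases Nat.lt_or_gt_of_ne hy with hlt | hlt
      · left
        have : (y + 1) * (2 * k + 1) ≤ x * (2 * k + 1) := Nat.mul_le_mul_right _ hlt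
        rw [Nat.add_mul, one_mul] at this
        omega
      · right
        have : (x + 1) * (2 * k + 1) ≤ y * (2 * k + 1) := Nat.mul_le_mul_right _ hlt
        rw [Nat.add_mul, one_mul] at this
        omega
    simp
    rw [if_neg (by omega), if_neg (by omega)]

end ZiminMatching

/-! ### Updating all values, and the meaning of labels and marks. -/

namespace ZiminMatching

open BFS

variable {m : ℕ} {P : RankedPattern m} {k B N : ℕ} {A : ℕ → ℕ}

/-- The new value of a variable, computed from the labels and the marks. -/
def insertLetter (P : RankedPattern m) (i : ℕ) (lab mark : ℕ → ℕ) (val : Fin m → List ℕ)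
    (x : Fin m) : List ℕ :=
  if i ≤ P.rank x then
    (if mark (lab (m + x)) = 0 ∧ i < P.rank x then [i] else []) ++
      (val x ++ if mark (lab x) ≠ 0 then [i] else [])
  else val x

lemma run_updateProg {h : Mach} {i : ℕ} {val : Fin m → List ℕ} (D : Setup P k B N A)
    (H : Env P k N A h) (h4 : h.reg 4 = i) (hi : i < k)
    (hlab : ∀ x : Fin m, i ≤ P.rank x → h.arr 4 x ≤ 2 * m ∧ h.arr 4 (m + x) ≤ 2 * m)
    (ht : ∀ x : Fin m, Slot N k (i + 1) x (val x) (h.arr 8) (h.arr 9)) :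
    Run B N updateProg h (18 * m + 2) fun _ h' =>
      Mach.Same [10, 11, 12, 13, 14, 18] [8, 9] h h' ∧
      ∀ x : Fin m, Slot N k i x (insertLetter P i (h.arr 4) (h.arr 6) val x) (h'.arr 8) (h'.arr 9) := by
  obtain ⟨b₁, b₂, b₃, b₄, b₅, b₆, b₇⟩ := D.bounds
  refine Run.mono (Run.forLoop (n := m) (Tb := 16) (I := fun j g =>
      Mach.Same [10, 11, 12, 13, 14, 18] [8, 9] h g ∧
      (∀ x : Fin m, x < j →
        Slot N k i x (insertLetter P i (h.arr 4) (h.arr 6) val x) (g.arr 8) (g.arr 9)) ∧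
      ∀ x : Fin m, j ≤ x → Slot N k (i + 1) x (val x) (g.arr 8) (g.arr 9))
      (P := fun h' => Mach.Same [10, 11, 12, 13, 14, 18] [8, 9] h h' ∧
      ∀ x : Fin m, Slot N k i x (insertLetter P i (h.arr 4) (h.arr 6) val x) (h'.arr 8) (h'.arr 9))
      (by omega) ?_ ?_ ?_ ?_) (by omega) fun _ _ h => h
  · exact fun i g hg => (hg.1.1 1 (by decide)).trans H.reg1
  · rintro j hj g ⟨S, I₁, I₂⟩ r10
    have E := H.same S (by decide) (by decide)
    obtain ⟨x, rfl⟩ : ∃ x : Fin m, (x : ℕ) = j := ⟨⟨j, hj⟩, rfl⟩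
    refine Run.load_eq (j := x) (v := P.rank x) (T := 15) b₇ E.reg15 (by norm_num)
      (by simp [Expr.eval, r10]) (by omega) (by rw [E.arr0, D.rank]) ?_
    have S₁ : Mach.Same [10, 11, 12, 13, 14, 18] [8, 9] h (g.setR 12 (P.rank x)) :=
      S.setR (by simp) _
    have r4' : (g.setR 12 (P.rank x)).reg 4 = i := (S₁.1 4 (by decide)).trans h4
    have a4' : (g.setR 12 (P.rank x)).arr 4 = h.arr 4 := S₁.2 4 (by decide)
    have a6' : (g.setR 12 (P.rank x)).arr 6 = h.arr 6 := S₁.2 6 (by decide)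
    have r10' : (g.setR 12 (P.rank x)).reg 10 = x := by simp [r10]
    have r12' : (g.setR 12 (P.rank x)).reg 12 = P.rank x := by simp
    have E₁ := H.same S₁ (by decide) (by decide)
    refine Run.ite_cons (T := 14) (fun hc => ?_) (fun hc => ?_)
    · have hr : i ≤ P.rank x := by
        simp only [Expr.eval, r4', r12'] at hc
        omega
      obtain ⟨l₁, l₂⟩ := hlab x hr
      refine Run.mono (run_insertProg D E₁ x.2 r10' r4' r12' hi (by rwa [a4']) (by rwa [a4'])
        (I₂ x le_rfl)) le_rfl ?_
      rintro T h' ⟨S', hs, hs'⟩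
      refine Run.nil ⟨(S'.1 10 (by decide)).trans r10', ((S₁.trans (S'.mono (by decide)
        (by decide)))).setR (by simp) _, fun y hy => ?_, fun y hy => ?_⟩
      · rcases Nat.lt_succ_iff_lt_or_eq.1 hy with hy | hy
        · exact hs' y hy.ne _ _ (I₁ y hy)
        · obtain rfl := Fin.ext hy
          rw [insertLetter, if_pos hr]
          rw [a4', a6'] at hs
          exact hs
      · exact hs' y (by omega) _ _ (I₂ y (by omega))
    · have hr : ¬ i ≤ P.rank x := by
        simp only [Expr.eval, r4', r12'] at hc
        omega
      refine Run.skip (Run.nil ⟨r10', S₁.setR (by simp) _, fun y hy => ?_, fun y hy => ?_⟩)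
      · rcases Nat.lt_succ_iff_lt_or_eq.1 hy with hy | hy
        · exact I₁ y hy
        · obtain rfl := Fin.ext hy
          rw [insertLetter, if_neg hr]
          exact (I₂ y le_rfl).mono (by omega)
      · exact I₂ y (by omega)
  · rintro g ⟨S, I₁, -⟩ -
    exact ⟨S, fun x => I₁ x x.2⟩
  · exact ⟨Mach.Same.rfl.setR (by simp) _, fun x hx => by simp at hx, fun x _ => ht x⟩

/-! ### Labels and marks -/

section Marks

variable {i c : ℕ} {W lab f₆ f₇ : ℕ → ℕ}

/-- The marks of the components with a left or a right copy of a variable of rank `i`. -/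
def Marks (P : RankedPattern m) (i : ℕ) (lab f₆ f₇ : ℕ → ℕ) : Prop :=
  ∀ d, 1 ≤ d → d ≤ 2 * m →
    (f₆ d ≠ 0 ↔ ∃ x : Fin m, P.rank x = i ∧ lab x = d) ∧
    (f₇ d ≠ 0 ↔ ∃ x : Fin m, P.rank x = i ∧ lab (m + x) = d)

variable (hW : ∀ (j : ℕ) (hj : j < (P.restrict i).length), W j = (P.restrict i)[j])
  (H : Labels m (P.restrict i).length W lab c)

include hW H

lemma label_bounds (a : Vertex (P.restrict i)) : 1 ≤ lab (vertexNumber a) ∧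
    lab (vertexNumber a) ≤ c := by
  have : Present m (P.restrict i).length W (vertexNumber a) := (present_iff hW).2 ⟨a, rfl⟩
  exact ⟨H.pos _ this, H.le _ this⟩

lemma label_le {x : Fin m} (hx : i ≤ P.rank x) : lab x ≤ 2 * m ∧ lab (m + x) ≤ 2 * m :=
  ⟨(label_bounds hW H (Sum.inl ⟨x, P.mem_restrict.2 hx⟩)).2.trans H.c_le,
    (label_bounds hW H (Sum.inr ⟨x, P.mem_restrict.2 hx⟩)).2.trans H.c_le⟩

lemma conflict_iff (M : Marks P i lab f₆ f₇) : Conflict (P.restrict i) (fun x => P.rank x = i) ↔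
    ∃ d < c, f₆ (d + 1) ≠ 0 ∧ f₇ (d + 1) ≠ 0 := by
  have hc := H.c_le
  constructor
  · rintro ⟨x, y, hx, hy, h⟩
    rw [H.reachable_iff hW] at h
    obtain ⟨h₁, h₂⟩ := label_bounds hW H (Sum.inl x)
    refine ⟨lab (vertexNumber (Sum.inl x)) - 1, by omega, ?_⟩
    rw [Nat.sub_add_cancel h₁]
    obtain ⟨M₁, M₂⟩ := M _ h₁ (h₂.trans hc)
    exact ⟨M₁.2 ⟨x, hx, rfl⟩, M₂.2 ⟨y, hy, h.symm⟩⟩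
  · rintro ⟨d, hd, h₁, h₂⟩
    obtain ⟨M₁, M₂⟩ := M (d + 1) (by omega) (by omega)
    obtain ⟨x, hx, ex⟩ := M₁.1 h₁
    obtain ⟨y, hy, ey⟩ := M₂.1 h₂
    refine ⟨⟨x, P.mem_restrict.2 hx.ge⟩, ⟨y, P.mem_restrict.2 hy.ge⟩, hx, hy, ?_⟩
    rw [H.reachable_iff hW]
    exact ex.trans ey.symm

/-- A component contains a copy of a new variable iff its label bears a mark, so the free components
are the unmarked labels. -/
lemma unvaluated_eq (M : Marks P i lab f₆ f₇) : P.unvaluated i =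
    ((Finset.range c).filter fun d => f₆ (d + 1) = 0 ∧ f₇ (d + 1) = 0).card := by
  have hc := H.c_le
  rw [← H.card_components hW fun d => f₆ d = 0 ∧ f₇ d = 0, RankedPattern.unvaluated]
  refine Nat.card_congr (Equiv.subtypeEquivRight fun C => ?_)
  have key : ∀ a ∈ C.supp, ∀ b, b ∈ C.supp ↔ lab (vertexNumber b) = lab (vertexNumber a) := by
    intro a ha b
    rw [← H.reachable_iff hW, ← SimpleGraph.ConnectedComponent.eq]
    rw [SimpleGraph.ConnectedComponent.mem_supp_iff] at ha ⊢
    rw [ha]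
  constructor
  · intro h a ha
    obtain ⟨h₁, h₂⟩ := label_bounds hW H a
    obtain ⟨M₁, M₂⟩ := M _ h₁ (h₂.trans hc)
    constructor
    · by_contra hn
      obtain ⟨x, hx, ex⟩ := M₁.1 hn
      exact (h ⟨x, P.mem_restrict.2 hx.ge⟩ hx).1 ((key a ha _).2 ex)
    · by_contra hn
      obtain ⟨x, hx, ex⟩ := M₂.1 hn
      exact (h ⟨x, P.mem_restrict.2 hx.ge⟩ hx).2 ((key a ha _).2 ex)
  · intro h x hx
    constructor
    · intro ha
      obtain ⟨h₁, h₂⟩ := label_bounds hW H (Sum.inl x)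
      exact (M _ h₁ (h₂.trans hc)).1.2 ⟨x, hx, rfl⟩ (h _ ha).1
    · intro ha
      obtain ⟨h₁, h₂⟩ := label_bounds hW H (Sum.inr x)
      exact (M _ h₁ (h₂.trans hc)).2.2 ⟨x, hx, rfl⟩ (h _ ha).2

/-- The mark of the first variable is set without testing whether a new left copy reaches it,
although `Flipped` asks for this in its second alternative. It makes no difference: such a component
is flipped by the first alternative anyway. -/
lemma flipped_iff (M : Marks P i lab f₆ f₇) (hw : P.restrict i ≠ []) {mark : ℕ → ℕ}
    (hm : ∀ d, mark d ≠ 0 ↔ f₆ d ≠ 0 ∨ (f₇ (lab (m + W 0)) = 0 ∧ d = lab (m + W 0)))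
    (a : Vertex (P.restrict i)) :
    Flipped (P.restrict i) (fun x => P.rank x = i) hw a ↔ mark (lab (vertexNumber a)) ≠ 0 := by
  have hc := H.c_le
  have h0 : vertexNumber (Sum.inr (firstVar _ hw)) = m + W 0 := by
    rw [hW 0 (List.length_pos_iff.2 hw)]
    simp [vertexNumber, firstVar, List.head_eq_getElem]
  have hex : ∀ b, (∃ x : {x // x ∈ P.restrict i}, P.rank x.1 = i ∧
      (adjGraph (P.restrict i)).Reachable (Sum.inl x) b) ↔ f₆ (lab (vertexNumber b)) ≠ 0 := by
    intro b
    obtain ⟨h₁, h₂⟩ := label_bounds hW H b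
    rw [(M _ h₁ (h₂.trans hc)).1]
    constructor
    · rintro ⟨x, hx, h⟩
      exact ⟨x, hx, (H.reachable_iff hW).1 h⟩
    · rintro ⟨x, hx, h⟩
      exact ⟨⟨x, P.mem_restrict.2 hx.ge⟩, hx, (H.reachable_iff hW).2 h⟩
  have hex' : ∀ b, (∃ x : {x // x ∈ P.restrict i}, P.rank x.1 = i ∧
      (adjGraph (P.restrict i)).Reachable (Sum.inr x) b) ↔ f₇ (lab (vertexNumber b)) ≠ 0 := by
    intro b
    obtain ⟨h₁, h₂⟩ := label_bounds hW H b
    rw [(M _ h₁ (h₂.trans hc)).2]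
    constructor
    · rintro ⟨x, hx, h⟩
      exact ⟨x, hx, (H.reachable_iff hW).1 h⟩
    · rintro ⟨x, hx, h⟩
      exact ⟨⟨x, P.mem_restrict.2 hx.ge⟩, hx, (H.reachable_iff hW).2 h⟩
  rw [hm, Flipped, hex, H.reachable_iff hW, ← h0]
  refine or_congr_right' fun h6 => ?_
  constructor
  · rintro ⟨h, e⟩
    refine ⟨?_, e.symm⟩
    by_contra hn
    obtain ⟨x, hx, hr⟩ := (hex' _).2 hn
    exact (h x hx).2 hr
  · rintro ⟨h, e⟩
    refine ⟨fun x hx => ⟨fun hr => h6 ?_, fun hr => (hex' _).1 ⟨x, hx, hr⟩ h⟩, e.symm⟩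
    rw [e]
    exact (hex _).1 ⟨x, hx, hr⟩

/-- A variable of rank `i` needs no special treatment: its value is empty, nothing is put in front,
and the component of its left copy is marked, so the insertion at the end produces the value `[i]`.
-/
lemma embeddingStep_eq_insertLetter (M : Marks P i lab f₆ f₇) (hw : P.restrict i ≠ [])
    (hc : ¬ Conflict (P.restrict i) (fun x => P.rank x = i)) {mark : ℕ → ℕ}
    (hm : ∀ d, mark d ≠ 0 ↔ f₆ d ≠ 0 ∨ (f₇ (lab (m + W 0)) = 0 ∧ d = lab (m + W 0)))
    {val : Fin m → List ℕ} (hval : ∀ x, i < P.rank x → val x ≠ [] ∧ ∀ a ∈ val x, i < a)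
    (hnil : ∀ x, P.rank x = i → val x = []) :
    P.embeddingStep val i = some (insertLetter P i lab mark val) := by
  classical
  rw [RankedPattern.embeddingStep_eq_some hw hc hval]
  congr 1
  funext x
  rw [insertLetter]
  by_cases hx : i ≤ P.rank x
  · have hmem := P.mem_restrict.2 hx
    have fl := flipped_iff hW H M hw hm (Sum.inl ⟨x, hmem⟩)
    have fr := flipped_iff hW H M hw hm (Sum.inr ⟨x, hmem⟩)
    simp only [vertexNumber, Sum.elim_inl, Sum.elim_inr] at fl fr
    by_cases hxi : P.rank x = i
    · rw [if_pos hxi, if_pos hx, hnil x hxi, if_neg (by omega), if_pos (fl.1 (.inl ⟨⟨x, hmem⟩, hxi,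
        .refl _⟩))]
      rfl
    · rw [if_neg hxi, if_pos hx, dif_pos hmem]
      congr 1
      · by_cases hz : mark (lab (m + x)) = 0
        · rw [if_neg (fun h => fr.1 h hz), if_pos ⟨hz, by omega⟩]
        · rw [if_pos (fr.2 hz), if_neg (fun h => hz h.1)]
      · congr 1
        exact if_congr fl rfl rfl
  · rw [if_neg (by omega), if_neg hx, dif_neg (fun h => hx (P.mem_restrict.1 h))]

end Marks

end ZiminMatching

/-! ### One complete level in linear time. -/

namespace ZiminMatching

open BFS

variable {m : ℕ} {P : RankedPattern m} {k B N : ℕ} {A : ℕ → ℕ}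

/-- One step of the algorithm, for the letter in register 4. -/
def levelProg : Prog := block [clearProg, filterProg, componentsProg, flagProg, countProg,
  .ifNonzero (.reg 5) (block [firstProg, updateProg]) .skip]

lemma WordInv.input {h : Mach} {i : ℕ} (D : Setup P k B N A) (I : WordInv h (P.restrict i)) :
    Input B N m (P.restrict i).length (h.arr 1) (h.arr 2) (h.arr 3) := by
  obtain ⟨b₁, b₂, b₃, b₄, b₅, b₆, b₇⟩ := D.bounds
  have : (P.restrict i).length ≤ P.pat.length := List.length_filter_le _ _
  refine ⟨b₇, by omega, by omega, fun j hj => ?_, I.prv, I.lst⟩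
  rw [I.word j hj]
  exact Fin.is_lt _

lemma run_levelProg {h : Mach} {i l : ℕ} {val : Fin m → List ℕ} (D : Setup P k B N A)
    (H : Env P k N A h) (h4 : h.reg 4 = i) (hiK : i < P.maxRank) (h5 : h.reg 5 = 1)
    (h6 : h.reg 6 = l) (hl : l + 2 * m < B)
    (hslot : ∀ x : Fin m, Slot N k (i + 1) x (val x) (h.arr 8) (h.arr 9))
    (hval : ∀ x, i < P.rank x → val x ≠ [] ∧ ∀ a ∈ val x, i < a)
    (hnil : ∀ x, P.rank x = i → val x = []) :
    Run B N levelProg h (190 * P.pat.length) fun _ h' =>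
      Mach.Same [5, 6, 7, 8, 9, 10, 11, 12, 13, 14, 16, 17, 18] [1, 2, 3, 4, 5, 6, 7, 8, 9] h h' ∧
      h'.reg 6 = l + P.unvaluated i ∧ P.unvaluated i ≤ 2 * m ∧
      ((P.embeddingStep val i = none ∧ h'.reg 5 = 0) ∨
        ∃ val', P.embeddingStep val i = some val' ∧ h'.reg 5 = 1 ∧
          ∀ x : Fin m, Slot N k i x (val' x) (h'.arr 8) (h'.arr 9)) := by
  obtain ⟨b₁, b₂, b₃, b₄, b₅, b₆, b₇⟩ := D.bounds
  have hlen : (P.restrict i).length ≤ P.pat.length := List.length_filter_le _ _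
  have hw := P.restrict_ne_nil hiK.le
  have hpos := List.length_pos_iff.2 hw
  have hik : i < k := hiK.trans_le D.maxRank_le
  -- At most 70m + 90n + 28 steps, which is at most 188n because 1 ≤ m ≤ n.
  refine Run.mono (T := (0 + (18 * m + 2) + 5 + 1) + (12 * m + 2) + (8 * m + 2) +
    (20 * m + 80 * (P.restrict i).length + 10) + (10 * P.pat.length + 3) + (12 * m + 3))
    ?_ (by omega) fun _ _ h => h
  refine Run.cons_of (run_clearProg D H) ?_
  rintro g₁ ⟨S₁, z3, z4, z6, z7⟩
  have E₁ := H.same S₁ (by decide) (by decide)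
  have q4 : g₁.reg 4 = i := (S₁.1 4 (by decide)).trans h4
  refine Run.cons_of (run_filterProg D E₁ q4 fun v hv => z3 v (by omega)) ?_
  rintro g₂ ⟨S₂, I⟩
  have E₂ := E₁.same S₂ (by decide) (by decide)
  refine Run.cons_of (run_componentsProg (I.input D)
    ⟨E₂.reg15, E₂.reg1, I.reg7, rfl, rfl, rfl⟩ fun v hv => ?_) ?_
  · rw [S₂.2 4 (by decide)]; exact z4 v hv
  rintro g₃ ⟨S₃, L⟩
  have E₃ := E₂.same S₃ (by decide) (by decide)
  have hW : ∀ (j : ℕ) (hj : j < (P.restrict i).length), g₂.arr 1 j = (P.restrict i)[j] := I.word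
  have p4 : g₃.reg 4 = i := (S₃.1 4 (by decide)).trans ((S₂.1 4 (by decide)).trans q4)
  have hlab : ∀ x : Fin m, i ≤ P.rank x → g₃.arr 4 x ≤ 2 * m ∧ g₃.arr 4 (m + x) ≤ 2 * m :=
    fun x hx => label_le hW L hx
  refine Run.cons_of (run_flagProg D E₃ p4 (fun x hx => hlab x hx.ge)
    (fun d hd hd' => ?_) fun d hd hd' => ?_) ?_
  · rw [S₃.2 6 (by decide), S₂.2 6 (by decide)]; exact z6 d hd hd'
  · rw [S₃.2 7 (by decide), S₂.2 7 (by decide)]; exact z7 d hd hd'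
  rintro g₄ ⟨S₄, M⟩
  have E₄ := E₃.same S₄ (by decide) (by decide)
  have S₁₄ : Mach.Same [7, 8, 9, 10, 11, 12, 13, 14, 16, 17, 18] [1, 2, 3, 4, 5, 6, 7] h g₄ :=
    (S₁.mono (by decide) (by decide)).trans <| (S₂.mono (by decide) (by decide)).trans <|
      (S₃.mono (by decide) (by decide)).trans (S₄.mono (by decide) (by decide))
  have h5' : g₄.reg 5 = 1 := (S₁₄.1 5 (by decide)).trans h5
  refine Run.cons_of (run_countProg D E₄ (S₄.1 8 (by decide)) L.c_le
    ((S₁₄.1 6 (by decide)).trans h6) hl (by omega)) ?_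
  rintro g₅ ⟨S₅, c6, cz, co⟩
  have E₅ := E₄.same S₅ (by decide) (by decide)
  have S₁₅ : Mach.Same [5, 6, 7, 8, 9, 10, 11, 12, 13, 14, 16, 17, 18] [1, 2, 3, 4, 5, 6, 7] h g₅ :=
    (S₁₄.mono (by decide) (by decide)).trans (S₅.mono (by decide) (by decide))
  have hun := unvaluated_eq hW L M
  have hcon := conflict_iff hW L M
  have hunle : P.unvaluated i ≤ 2 * m := by
    rw [hun]
    exact (Finset.card_filter_le _ _).trans (by simpa using L.c_le)
  rw [← hun] at c6
  rw [← hcon] at cz co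
  refine Run.ite_cons (fun hc => ?_) (fun hc => ?_)
  · have hc' : g₅.reg 5 ≠ 0 := hc
    have hnc : ¬ Conflict (P.restrict i) (fun x => P.rank x = i) := fun hn => hc' (cz hn)
    have a1 : g₅.arr 1 = g₂.arr 1 := (S₅.2 1 (by decide)).trans <|
      (S₄.2 1 (by decide)).trans (S₃.2 1 (by decide))
    have a4 : g₅.arr 4 = g₃.arr 4 := (S₅.2 4 (by decide)).trans (S₄.2 4 (by decide))
    have a6 : g₅.arr 6 = g₄.arr 6 := S₅.2 6 (by decide)
    have a7 : g₅.arr 7 = g₄.arr 7 := S₅.2 7 (by decide)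
    have hx₀ : g₅.arr 1 0 = ((P.restrict i)[0] : Fin m) := by rw [a1]; exact hW 0 hpos
    have hr₀ : i ≤ P.rank (P.restrict i)[0] := P.mem_restrict.1 (List.getElem_mem hpos)
    refine Run.cons_of (run_firstProg D E₅ (by rw [hx₀]; exact Fin.is_lt _) rfl
      (by rw [hx₀, a4]; exact (hlab _ hr₀).2)) ?_
    rintro g₆ ⟨S₆, hm⟩
    have E₆ := E₅.same S₆ (by decide) (by decide)
    have S₁₆ : Mach.Same [5, 6, 7, 8, 9, 10, 11, 12, 13, 14, 16, 17, 18] [1, 2, 3, 4, 5, 6, 7]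
      h g₆ := S₁₅.trans (S₆.mono (by decide) (by decide))
    have a4' : g₆.arr 4 = g₃.arr 4 := (S₆.2 4 (by decide)).trans a4
    refine Run.cons_of (run_updateProg D E₆ ((S₁₆.1 4 (by decide)).trans h4) hik
      (by rwa [a4']) (val := val) fun x => ?_) ?_
    · rw [S₁₆.2 8 (by decide), S₁₆.2 9 (by decide)]; exact hslot x
    rintro g₇ ⟨S₇, hs⟩
    refine Run.nil (Run.nil ⟨(S₁₆.mono (by decide) (by decide)).trans
      (S₇.mono (by decide) (by decide)), ?_, hunle, .inr ⟨_, ?_, ?_, hs⟩⟩)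
    · rw [S₇.1 6 (by decide), S₆.1 6 (by decide), c6]
    · rw [a1, a4, a6, a7] at hm
      rw [a4']
      exact embeddingStep_eq_insertLetter hW L M hw hnc hm hval hnil
    · rw [S₇.1 5 (by decide), S₆.1 5 (by decide), co hnc, h5']
  · have hc' : g₅.reg 5 = 0 := hc
    have hcf : Conflict (P.restrict i) (fun x => P.rank x = i) := by
      by_contra hn
      have := co hn
      omega
    exact Run.skip (Run.nil ⟨S₁₅.mono (by decide) (by decide), c6, hunle,
      .inl ⟨RankedPattern.embeddingStep_eq_none _ hcf, hc'⟩⟩)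

end ZiminMatching

namespace ZiminMatching

open BFS

/-! ### The whole program -/

/-- Put the maximal rank into register 4. -/
def maxProg : Prog :=
  forLoop 10 1 (block [loadA 11 0 (.reg 10), .assign 4 (.add (.reg 4) (.sub (.reg 11) (.reg 4)))])

/-- The values of the variables of maximal rank. -/
def initProg : Prog :=
  forLoop 10 1 (block [
    loadA 12 0 (.reg 10),
    storeA 9 (.add (.mul (.reg 10) (.add (.mul (.lit 2) (.reg 2)) (.lit 1))) (.reg 2)) (.reg 4),
    storeA 8 (.mul (.lit 2) (.reg 10)) (.add (.mul (.lit 9) (.reg 15))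
      (.add (.mul (.reg 10) (.add (.mul (.lit 2) (.reg 2)) (.lit 1))) (.reg 2))),
    storeA 8 (.add (.mul (.lit 2) (.reg 10)) (.lit 1)) (.sub (.lit 1) (.sub (.reg 4) (.reg 12)))])

/-- Perform the steps for the letters below the maximal rank. -/
def levelsProg : Prog :=
  .whileNonzero (.mul (.reg 5) (.sub (.reg 4) (.lit 1)))
    (block [.assign 4 (.sub (.reg 4) (.lit 1)), levelProg])

/-- Present the result. -/
def outputProg : Prog := block [
  .ifNonzero (.reg 5)
    (block [storeA 10 (.reg 6) (.lit 1), .assign 3 (.add (.reg 6) (.lit 1)),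
      .assign 2 (.mul (.lit 10) (.reg 15)), .assign 1 (.mul (.lit 8) (.reg 15)),
      .assign 0 (.lit 1)])
    (block [.assign 3 (.lit 0), .assign 0 (.lit 0)])]

/-- `Compressed-Embedding` with `ShortestFirstLast`, and the number of instances. -/
def embeddingProg : Prog := block [
  .assign 15 (.mul (.lit 8) (.add (.reg 0) (.mul (.reg 1) (.reg 2)))),
  maxProg, filterProg, .assign 5 (.sub (.lit 2) (.reg 7)), initProg, levelsProg, outputProg]

variable {m : ℕ} {P : RankedPattern m} {k B N : ℕ} {A : ℕ → ℕ}

/-- With truncated subtraction, a + (b - a) is the maximum of a and b. -/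
lemma run_maxProg {h : Mach} (D : Setup P k B N A) (H : Env P k N A h) (h4 : h.reg 4 = 0) :
    Run B N maxProg h (4 * m + 2) fun _ h' => Mach.Same [4, 10, 11] [] h h' ∧
      h'.reg 4 = P.maxRank := by
  obtain ⟨b₁, b₂, b₃, b₄, b₅, b₆, b₇⟩ := D.bounds
  have hK := D.maxRank_le
  refine Run.mono (Run.forLoop (n := m) (Tb := 2) (I := fun j g =>
      Mach.Same [4, 10, 11] [] h g ∧ g.reg 4 ≤ P.maxRank ∧
        ∀ x : Fin m, x < j → P.rank x ≤ g.reg 4)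
      (P := fun h' => Mach.Same [4, 10, 11] [] h h' ∧ h'.reg 4 = P.maxRank)
      (by omega) ?_ ?_ ?_ ?_) (by omega) fun _ _ h => h
  · exact fun i g hg => (hg.1.1 1 (by decide)).trans H.reg1
  · rintro j hj g ⟨S, I₁, I₂⟩ r10
    have E := H.same S (by decide) (by decide)
    obtain ⟨x, rfl⟩ : ∃ x : Fin m, (x : ℕ) = j := ⟨⟨j, hj⟩, rfl⟩
    have hx := P.rank_le_maxRank x
    refine Run.load_eq (j := x) (v := P.rank x) (T := 1) b₇ E.reg15 (by norm_num)
      (by simp [Expr.eval, r10]) (by omega) (by rw [E.arr0, D.rank]) ?_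
    refine Run.assign_eq (v := g.reg 4 + (P.rank x - g.reg 4)) (T := 0) (by simp [Expr.eval])
      (by omega) (Run.nil ⟨by simp [r10],
        ((S.setR (by simp) _).setR (by simp) _).setR (by simp) _, by simp; omega, fun y hy => ?_⟩)
    simp only [Mach.setR_reg]
    rcases Nat.lt_succ_iff_lt_or_eq.1 hy with hy | hy
    · have := I₂ y hy
      simp
      omega
    · obtain rfl := Fin.ext hy
      simp
      omega
  · rintro g ⟨S, I₁, I₂⟩ -
    exact ⟨S, le_antisymm I₁ (Finset.sup_le fun x _ => I₂ x x.2)⟩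
  · exact ⟨Mach.Same.rfl.setR (by simp) _, by simp [h4], fun x hx => by simp at hx⟩

/-- The maximal rank is written into the middle cell of every segment, with `k` free cells on both
sides, enough for all later insertions. -/
lemma run_initProg {h : Mach} (D : Setup P k B N A) (H : Env P k N A h)
    (h4 : h.reg 4 = P.maxRank) :
    Run B N initProg h (6 * m + 2) fun _ h' => Mach.Same [10, 12] [8, 9] h h' ∧
      ∀ x : Fin m, Slot N k P.maxRank x (P.topVal x) (h'.arr 8) (h'.arr 9) := by
  obtain ⟨b₁, b₂, b₃, b₄, b₅, b₆, b₇⟩ := D.bounds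
  have hK := D.maxRank_le
  refine Run.mono (Run.forLoop (n := m) (Tb := 4) (I := fun j g =>
      Mach.Same [10, 12] [8, 9] h g ∧
        ∀ x : Fin m, x < j → Slot N k P.maxRank x (P.topVal x) (g.arr 8) (g.arr 9))
      (P := fun h' => Mach.Same [10, 12] [8, 9] h h' ∧
        ∀ x : Fin m, Slot N k P.maxRank x (P.topVal x) (h'.arr 8) (h'.arr 9))
      (by omega) ?_ ?_ ?_ ?_) (by omega) fun _ _ h => h
  · exact fun i g hg => (hg.1.1 1 (by decide)).trans H.reg1
  · rintro j hj g ⟨S, I⟩ r10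
    have E := H.same S (by decide) (by decide)
    have r4 : g.reg 4 = P.maxRank := (S.1 4 (by decide)).trans h4
    have r2 := E.reg2
    have r15 := E.reg15
    obtain ⟨x, rfl⟩ : ∃ x : Fin m, (x : ℕ) = j := ⟨⟨j, hj⟩, rfl⟩
    have hx := P.rank_le_maxRank x
    have hseg : x * (2 * k + 1) + (2 * k + 1) ≤ 2 * (m * k) + m := by
      calc x * (2 * k + 1) + (2 * k + 1) = (x + 1) * (2 * k + 1) := by ring
        _ ≤ m * (2 * k + 1) := Nat.mul_le_mul_right _ x.2
        _ = _ := by ring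
    refine Run.load_eq (j := x) (v := P.rank x) (T := 3) b₇ r15 (by norm_num)
      (by simp [Expr.eval, r10]) (by omega) (by rw [E.arr0, D.rank]) ?_
    refine Run.store_eq (j := x * (2 * k + 1) + k) (v := P.maxRank) (T := 2) b₇ (by simp [r15])
      (by norm_num) (by simp [Expr.eval, r10, r2]) (by omega) (by simp [Expr.eval, r4])
      (by omega) ?_
    refine Run.store_eq (j := 2 * x) (v := 9 * N + (x * (2 * k + 1) + k)) (T := 1) b₇
      (by simp [r15]) (by norm_num) (by simp [Expr.eval, r10]) (by omega)
      (by simp [Expr.eval, r10, r2, r15]) (by omega) ?_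
    -- The length is 1 for a variable of maximal rank; for the others it is 0, which makes the
    -- written letter invisible.
    refine Run.store_eq (j := 2 * x + 1) (v := 1 - (P.maxRank - P.rank x)) (T := 0) b₇
      (by simp [r15]) (by norm_num) (by simp [Expr.eval, r10]) (by omega)
      (by simp [Expr.eval, r4]) (by omega) ?_
    refine Run.nil ⟨by simp [r10], ?_, fun y hy => ?_⟩
    · exact ((((S.setR (by simp) _).setA (by simp) _ _).setA (by simp) _ _).setA
        (by simp) _ _).setR (by simp) _
    · by_cases hyx : y = x
      · subst hyx
        have hlen : (P.topVal y).length = 1 - (P.maxRank - P.rank y) := by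
          rw [RankedPattern.topVal]
          split_ifs with hr
          · simp [hr]
          · simp; omega
        refine ⟨y * (2 * k + 1) + k, by simp, by simp [hlen], by omega, by omega, fun j hj => ?_⟩
        have hr : P.rank y = P.maxRank := by
          by_contra hr
          simp [RankedPattern.topVal, hr] at hj
        have hj0 : j = 0 := by
          simp [RankedPattern.topVal, hr] at hj
          exact hj
        subst hj0
        simp [RankedPattern.topVal, hr]
      · have hyx' : (y : ℕ) < x := by
          have := Fin.val_ne_of_ne hyx
          omega
        have n₁ : 2 * (y : ℕ) ≠ 2 * x + 1 := by omega
        have n₂ : 2 * (y : ℕ) + 1 ≠ 2 * x := by omega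
        have hne : (y : ℕ) ≠ x := by omega
        refine (I y hyx').congr (by simp [hne, n₁]) (by simp [hne, n₂])
          fun j h₁ h₂ => ?_
        have : (y + 1) * (2 * k + 1) ≤ x * (2 * k + 1) := Nat.mul_le_mul_right _ hyx'
        rw [Nat.add_mul, one_mul] at this
        simp
        omega
  · rintro g ⟨S, I⟩ -
    exact ⟨S, fun x => I x x.2⟩
  · exact ⟨Mach.Same.rfl.setR (by simp) _, fun x hx => by simp at hx⟩

/-- Failure persists on the lower levels, so the program may stop as soon as register 5 is 0. -/
lemma RankedPattern.embeddingUpTo_sub_eq_none {i : ℕ} (hi : i ≤ P.maxRank)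
    (h : P.embeddingUpTo i = none) (n : ℕ) : P.embeddingUpTo (i - n) = none := by
  induction n with
  | zero => exact h
  | succ n ih =>
    rcases Nat.eq_zero_or_pos (i - n) with h0 | h0
    · rwa [show i - (n + 1) = i - n by omega]
    · rw [embeddingUpTo_of_lt (by omega), show i - (n + 1) + 1 = i - n by omega, ih]
      rfl

/-- The state of the algorithm after the steps down to `i`. -/
def AfterLevel (P : RankedPattern m) (k N i : ℕ) (g : Mach) : Prop :=
  (g.reg 5 = 1 ∧ (P.restrict P.maxRank).length = 1 ∧
    g.reg 6 = ∑ j ∈ Finset.Ico i P.maxRank, P.unvaluated j ∧ g.reg 6 ≤ 2 * m * (P.maxRank - i) ∧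
    ∃ v, P.LevelCorrect i v ∧
      ∀ x : Fin m, Slot N k i x (compress (v x)) (g.arr 8) (g.arr 9)) ∨
  (g.reg 5 = 0 ∧ P.compressedEmbedding = none)

lemma run_levelsProg {h : Mach} (D : Setup P k B N A) (H : Env P k N A h)
    (h4 : h.reg 4 = P.maxRank) (h0 : AfterLevel P k N P.maxRank h) :
    Run B N levelsProg h (192 * (P.pat.length * k)) fun _ h' =>
      Mach.Same [4, 5, 6, 7, 8, 9, 10, 11, 12, 13, 14, 16, 17, 18] [1, 2, 3, 4, 5, 6, 7, 8, 9]
        h h' ∧ AfterLevel P k N 1 h' := by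
  obtain ⟨b₁, b₂, b₃, b₄, b₅, b₆, b₇⟩ := D.bounds
  have hK := D.maxRank_le
  have hK1 := P.one_le_maxRank
  have hT : (P.maxRank - 1) * (190 * P.pat.length + 2) + 1 ≤ 192 * (P.pat.length * k) := by
    obtain ⟨k', rfl⟩ : ∃ k', k = k' + 1 := ⟨k - 1, by omega⟩
    calc (P.maxRank - 1) * (190 * P.pat.length + 2) + 1
        ≤ k' * (192 * P.pat.length) + 192 * P.pat.length := by
          have := Nat.mul_le_mul (show P.maxRank - 1 ≤ k' by omega)
            (show 190 * P.pat.length + 2 ≤ 192 * P.pat.length by omega)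
          omega
      _ = _ := by ring
  refine Run.whileLoop (I := fun T g => ∃ i, 1 ≤ i ∧ i ≤ P.maxRank ∧
    (i - 1) * (190 * P.pat.length + 2) + 1 ≤ T ∧ g.reg 4 = i ∧
    Mach.Same [4, 5, 6, 7, 8, 9, 10, 11, 12, 13, 14, 16, 17, 18] [1, 2, 3, 4, 5, 6, 7, 8, 9]
      h g ∧ AfterLevel P k N i g) ?_ ⟨P.maxRank, hK1, le_rfl, hT, h4, Mach.Same.rfl, h0⟩
  rintro T g ⟨i, hi1, hiK, hT, r4, S, I⟩
  refine ⟨T - 1, by omega, fun hc => ?_, fun hc => ?_⟩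
  · simp only [Expr.eval, r4, Nat.mul_ne_zero_iff] at hc
    rcases I with ⟨r5, hl, r6, hle, v, hv, hs⟩ | ⟨r5, -⟩
    swap
    · exact absurd r5 hc.1
    obtain ⟨i, rfl⟩ : ∃ i', i = i' + 1 := ⟨i - 1, by omega⟩
    obtain ⟨i', rfl⟩ : ∃ i', i = i' + 1 := ⟨i - 1, by omega⟩
    simp only [Nat.add_sub_cancel] at hT hc
    rw [Nat.add_mul, one_mul] at hT
    -- A level adds at most 2m free components, so the counter never exceeds 2mk and fits into a
    -- memory word.
    have hmul : 2 * m * (P.maxRank - (i' + 1 + 1)) + 2 * m ≤ 2 * m * (P.maxRank - (i' + 1)) := by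
      rw [← Nat.mul_succ]
      exact Nat.mul_le_mul_left _ (by omega)
    have hmul' : 2 * m * (P.maxRank - (i' + 1)) ≤ 2 * (m * k) := by
      rw [← mul_assoc]
      exact Nat.mul_le_mul_left _ (by omega)
    have S' : Mach.Same [4, 5, 6, 7, 8, 9, 10, 11, 12, 13, 14, 16, 17, 18]
      [1, 2, 3, 4, 5, 6, 7, 8, 9] h (g.setR 4 (i' + 1)) := S.setR (by simp) _
    have E := H.same S' (by decide) (by decide)
    refine Run.mono (T := i' * (190 * P.pat.length + 2) + 1 + 190 * P.pat.length + 1) ?_ (by omega)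
      fun _ _ h => h
    refine Run.assign_eq (v := i' + 1) (by simp [Expr.eval, r4]) (by omega) ?_
    refine Run.cons_of (run_levelProg D E (i := i' + 1) (val := fun x => compress (v x))
      (by simp) (by omega) (by simp [r5]) rfl (by simp; omega) hs (fun x hx => ?_) fun x hx => ?_)
      ?_
    · exact ⟨compress_ne_nil (RankedPattern.ne_nil_of_level hv.mem hx), fun a ha =>
        RankedPattern.le_of_mem_level hv.mem (mem_of_mem_compress ha)⟩
    · rw [hv.mem.1 x (by omega)]
      rfl
    rintro g' ⟨Sg, q6, hu, hcase⟩
    refine Run.nil ⟨i' + 1, by omega, by omega, by simp, ?_,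
      S'.trans (Sg.mono (by decide) (by decide)), ?_⟩
    · rw [Sg.1 4 (by decide)]; simp
    · have hlt : i' + 1 < P.maxRank := by omega
      have hstep := RankedPattern.embeddingUpTo_of_lt hlt
      rw [hv.eq, Option.bind_some] at hstep
      rcases hcase with ⟨hn, q5⟩ | ⟨val', hsome, q5, hs'⟩
      · refine .inr ⟨q5, ?_⟩
        rw [RankedPattern.compressedEmbedding_eq, if_pos hl]
        rw [hn] at hstep
        have := RankedPattern.embeddingUpTo_sub_eq_none hlt.le hstep i'
        rwa [show i' + 1 - i' = 1 by omega] at this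
      · obtain ⟨v', hv'⟩ := hv.step (by omega) hlt fun hcf => by
          rw [RankedPattern.embeddingStep_eq_none _ hcf] at hsome
          exact absurd hsome (by simp)
        rw [hv'.eq, hsome, Option.some.injEq] at hstep
        subst hstep
        have r6' : (g.setR 4 (i' + 1)).reg 6 = g.reg 6 := by simp
        refine .inl ⟨q5, hl, ?_, ?_, v', hv', hs'⟩
        · rw [q6, r6', r6, Finset.sum_eq_sum_Ico_succ_bot hlt, add_comm]
        · rw [q6, r6']
          omega
  · refine ⟨S, ?_⟩
    rcases I with I | ⟨r5, hn⟩
    · have : i = 1 := by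
        simp [Expr.eval, r4, I.1] at hc
        omega
      subst this
      exact .inl I
    · exact .inr ⟨r5, hn⟩

end ZiminMatching

/-! ### The result in memory, and the bounds for the whole program. -/

namespace ZiminMatching

open BFS

variable {m : ℕ} {P : RankedPattern m} {k B N : ℕ} {A : ℕ → ℕ}

/-- The final state of the machine. -/
def Presents (P : RankedPattern m) (k N : ℕ) (h : Mach) : Prop :=
  (P.compressedEmbedding = none ∧ h.reg 0 = 0 ∧ h.reg 3 = 0) ∨
  ∃ v : Fin m → List ℕ, P.compressedEmbedding = some v ∧ h.reg 0 = 1 ∧ h.reg 1 = 8 * N ∧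
    h.reg 2 = 10 * N ∧ h.reg 3 = P.totalUnvaluated + 1 ∧ P.totalUnvaluated < N ∧
    (∀ x : Fin m, Slot N k 1 x (v x) (h.arr 8) (h.arr 9)) ∧
    (∀ d < P.totalUnvaluated, h.arr 10 d = 0) ∧ h.arr 10 P.totalUnvaluated = 1

/-- Array 10 has remained zero, so a single 1 at index `l` writes the binary expansion of 2^l. The
index fits since each level contributes at most 2m. -/
lemma run_outputProg {h : Mach} (D : Setup P k B N A) (H : Env P k N A h)
    (hz : ∀ d < N, h.arr 10 d = 0) (h1 : AfterLevel P k N 1 h) :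
    Run B N outputProg h 6 fun _ h' => Presents P k N h' := by
  obtain ⟨b₁, b₂, b₃, b₄, b₅, b₆, b₇⟩ := D.bounds
  have r15 := H.reg15
  rcases h1 with ⟨r5, hl, r6, hle, v, hv, hs⟩ | ⟨r5, hn⟩
  · have hmul : 2 * m * (P.maxRank - 1) ≤ 2 * (m * k) := by
      rw [← mul_assoc]
      have := D.maxRank_le
      exact Nat.mul_le_mul_left _ (by omega)
    have r6' : h.reg 6 = P.totalUnvaluated := r6
    refine Run.ite_cons (T := 5) (fun _ => ?_) fun hc => absurd hc (by simp [Expr.eval, r5])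
    refine Run.store_eq (j := P.totalUnvaluated) (v := 1) (T := 4) b₇ r15 (by norm_num)
      (by simp [Expr.eval, r6']) (by omega) (by simp [Expr.eval]) (by omega) ?_
    refine Run.assign_eq (v := P.totalUnvaluated + 1) (T := 3) (by simp [Expr.eval, r6'])
      (by omega) ?_
    refine Run.assign_eq (v := 10 * N) (T := 2) (by simp [Expr.eval, r15]) (by omega) ?_
    refine Run.assign_eq (v := 8 * N) (T := 1) (by simp [Expr.eval, r15]) (by omega) ?_
    refine Run.assign_eq (v := 1) (T := 0) (by simp [Expr.eval]) (by omega) ?_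
    refine Run.nil (Run.nil (.inr ⟨fun x => compress (v x), ?_, by simp, by simp, by simp, by simp,
      by omega, fun x => ?_, fun d hd => ?_, by simp⟩))
    · rw [RankedPattern.compressedEmbedding_eq, if_pos hl, hv.eq]
    · simpa using hs x
    · simp [hd.ne, hz d (by omega)]
  · refine Run.ite_cons (T := 5) (fun hc => absurd r5 hc) fun _ => ?_
    refine Run.assign_eq (v := 0) (T := 4) (by simp [Expr.eval]) (by omega) ?_
    refine Run.assign_eq (v := 0) (T := 3) (by simp [Expr.eval]) (by omega) ?_
    exact Run.nil (Run.nil (.inl ⟨hn, by simp, by simp⟩))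

lemma exists_levelCorrect_topVal (hl : (P.restrict P.maxRank).length = 1) :
    ∃ v, P.LevelCorrect P.maxRank v ∧ ∀ x, compress (v x) = P.topVal x := by
  rcases RankedPattern.levelCorrect_or_empty hl 0 P.maxRank P.one_le_maxRank rfl with
    ⟨v, hv⟩ | ⟨h, -⟩
  · have := hv.eq
    rw [RankedPattern.embeddingUpTo_maxRank, Option.some.injEq] at this
    exact ⟨v, hv, fun x => (congrFun this x).symm⟩
  · rw [RankedPattern.embeddingUpTo_maxRank] at h
    exact absurd h (by simp)

lemma run_embeddingProg {h : Mach} (D : Setup P k B N A) (r0 : h.reg 0 = P.pat.length)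
    (r1 : h.reg 1 = m) (r2 : h.reg 2 = k) (hr : ∀ r, 3 ≤ r → h.reg r = 0) (a0 : h.arr 0 = A)
    (ha : ∀ a, 1 ≤ a → ∀ j < N, h.arr a j = 0) :
    Run B N embeddingProg h (300 * (P.pat.length * k)) fun _ h' => Presents P k N h' := by
  obtain ⟨b₁, b₂, b₃, b₄, b₅, b₆, b₇⟩ := D.bounds
  have hnk : P.pat.length ≤ P.pat.length * k := Nat.le_mul_of_pos_right _ (by omega)
  refine Run.mono (T := 0 + 6 + 192 * (P.pat.length * k) + (6 * m + 2) + 1 +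
    (10 * P.pat.length + 3) + (4 * m + 2) + 1) ?_ (by omega) fun _ _ h => h
  refine Run.assign_eq (v := N) (by simp [Expr.eval, r0, r1, r2, b₆]) (by omega) ?_
  have S₁ : Mach.Same [15] [] h (h.setR 15 N) := Mach.Same.rfl.setR (by simp) _
  have E₁ : Env P k N A (h.setR 15 N) := ⟨by simp [r0], by simp [r1], by simp [r2], by simp, a0⟩
  refine Run.cons_of (run_maxProg D E₁ (by simp [hr])) ?_
  rintro g₂ ⟨S₂, q4⟩
  have E₂ := E₁.same S₂ (by decide) (by decide)
  refine Run.cons_of (run_filterProg D E₂ q4 fun v hv => ?_) ?_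
  · rw [S₂.2 3 (by decide), S₁.2 3 (by decide)]; exact ha 3 (by omega) v (by omega)
  rintro g₃ ⟨S₃, I⟩
  have E₃ := E₂.same S₃ (by decide) (by decide)
  have p4 : g₃.reg 4 = P.maxRank := (S₃.1 4 (by decide)).trans q4
  -- Some position has maximal rank, so this truncated difference is 1 if there is exactly one such
  -- position and 0 otherwise.
  refine Run.assign_eq (v := 2 - (P.restrict P.maxRank).length) (by simp [Expr.eval, I.reg7])
    (by omega) ?_
  set g₄ := g₃.setR 5 (2 - (P.restrict P.maxRank).length) with hg₄
  have S₄ : Mach.Same [5] [] g₃ g₄ := Mach.Same.rfl.setR (by simp) _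
  have E₄ := E₃.same S₄ (by decide) (by decide)
  refine Run.cons_of (run_initProg D E₄ ((S₄.1 4 (by decide)).trans p4)) ?_
  rintro g₅ ⟨S₅, hs⟩
  have E₅ := E₄.same S₅ (by decide) (by decide)
  have S₁₅ : Mach.Same [4, 5, 7, 10, 11, 12, 15] [1, 2, 3, 8, 9] h g₅ :=
    (S₁.mono (by decide) (by decide)).trans <| (S₂.mono (by decide) (by decide)).trans <|
      (S₃.mono (by decide) (by decide)).trans <| (S₄.mono (by decide) (by decide)).trans
        (S₅.mono (by decide) (by decide))
  have t5 : g₅.reg 5 = 2 - (P.restrict P.maxRank).length := by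
    rw [S₅.1 5 (by decide)]; simp [hg₄]
  have t6 : g₅.reg 6 = 0 := (S₁₅.1 6 (by decide)).trans (hr 6 (by omega))
  have hpos := List.length_pos_iff.2 (P.restrict_ne_nil le_rfl)
  have hA : AfterLevel P k N P.maxRank g₅ := by
    by_cases hl : (P.restrict P.maxRank).length = 1
    · obtain ⟨v, hv, hv'⟩ := exists_levelCorrect_topVal hl
      exact .inl ⟨by omega, hl, by simp [t6], by omega, v, hv, fun x => by rw [hv']; exact hs x⟩
    · exact .inr ⟨by omega, by rw [RankedPattern.compressedEmbedding_eq, if_neg hl]⟩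
  refine Run.cons_of (run_levelsProg D E₅ ?_ hA) ?_
  · rw [S₅.1 4 (by decide), S₄.1 4 (by decide), p4]
  rintro g₆ ⟨S₆, hA₁⟩
  have E₆ := E₅.same S₆ (by decide) (by decide)
  refine Run.cons_of (run_outputProg D E₆ (fun d hd => ?_) hA₁) fun h' hp => Run.nil hp
  rw [S₆.2 10 (by decide), S₁₅.2 10 (by decide)]
  exact ha 10 (by omega) d hd

lemma Presents.outputs {h : Mach} {s : State} (D : Setup P k B N A) (hrel : h.Rel N s)
    (H : Presents P k N h) : s.Outputs P.compressedEmbedding (P.instances k).ncard := by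
  obtain ⟨b₁, b₂, b₃, b₄, b₅, b₆, b₇⟩ := D.bounds
  obtain ⟨hreg, hmem⟩ := hrel
  rcases H with ⟨hn, r0, r3⟩ | ⟨v, hv, r0, r1, r2, r3, hl, hs, hz, h1⟩
  · rw [RankedPattern.ncard_instances_of_eq_none D.rank_le hn, hn]
    refine ⟨fun _ => by rw [hreg, r0], fun _ h => by simp at h, fun j hj => by simp at hj, ?_⟩
    rw [hreg, r3]
    simp
  · rw [RankedPattern.ncard_instances_of_eq_some D.rank_le hv, hv]
    have hdig : Nat.digits 2 (2 ^ P.totalUnvaluated) =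
        List.replicate P.totalUnvaluated 0 ++ [1] := by
      have := Nat.digits_base_pow_mul (b := 2) (k := P.totalUnvaluated) (m := 1) (by norm_num)
        (by norm_num)
      simpa using this
    refine ⟨fun h => by simp at h, ?_, ?_, ?_⟩
    · rintro w hw
      obtain rfl := Option.some.inj hw
      refine ⟨by rw [hreg, r0], fun x => ?_⟩
      obtain ⟨p, t₁, t₂, l₁, l₂, hd⟩ := hs x
      have hx := x.2
      have hseg : x * (2 * k + 1) + (2 * k + 1) ≤ 2 * (m * k) + m := by
        calc x * (2 * k + 1) + (2 * k + 1) = (x + 1) * (2 * k + 1) := by ring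
          _ ≤ m * (2 * k + 1) := Nat.mul_le_mul_right _ x.2
          _ = _ := by ring
      rw [hreg, r1, hmem 8 (by norm_num) _ (by omega), t₁, add_assoc,
        hmem 8 (by norm_num) _ (by omega), t₂]
      refine ⟨fun j hj => ?_, rfl⟩
      rw [add_assoc, hmem 9 (by norm_num) _ (by omega), hd j hj]
    · intro j hj
      rw [hreg, r2]
      have hj' : j < P.totalUnvaluated + 1 := by
        rw [hdig] at hj
        simpa using hj
      rw [hmem 10 (by norm_num) _ (by omega)]
      simp only [hdig]
      rcases Nat.lt_succ_iff_lt_or_eq.1 hj' with hlt | rfl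
      · rw [hz j hlt, List.getElem_append_left (by simpa using hlt)]
        simp
      · rw [h1]
        simp
    · rw [hreg, r3, hdig]
      simp

/-- The arrays are only a view of the memory: the m + n input cells fit into array 0, so all other
arrays start with zeros. The 16 arrays take 128(n + mk) words, fewer than the 300(n + mk) allowed.
-/
theorem embeddingProg_correct {P : RankedPattern m} (hk : ∀ x, P.rank x ≤ k) :
    ∃ (t : ℕ) (s : State), Exec (300 * (P.pat.length + m * k)) embeddingProg (P.input k) t s ∧
      t ≤ 300 * (P.pat.length * k) ∧ s.Outputs P.compressedEmbedding (P.instances k).ncard := by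
  set N := 8 * (P.pat.length + m * k) with hN
  have hlen : (List.ofFn P.rank ++ P.pat.map Fin.val).length = m + P.pat.length := by simp
  have hmn := Setup.le_length P
  have D : Setup P k (300 * (P.pat.length + m * k)) N fun j => (P.input k).mem (0 * N + j) := by
    refine ⟨by omega, hN, hk, fun x => ?_, fun j hj => ?_⟩
    · simp [RankedPattern.input, List.getD_eq_getElem?_getD, List.getElem?_append]
    · simp [RankedPattern.input, List.getD_eq_getElem?_getD, List.getElem?_append, hj]
  obtain ⟨t, s, h', T', h₁, h₂, h₃, h₄⟩ := run_embeddingProg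
    (h := ⟨(P.input k).reg, fun a j => (P.input k).mem (a * N + j)⟩) D rfl rfl rfl
    (fun r hr => by simp [RankedPattern.input, List.getD_eq_getElem?_getD, hr]) rfl
    (fun a ha j hj => by
      have : N ≤ a * N := Nat.le_mul_of_pos_left _ ha
      simp only [RankedPattern.input]
      rw [List.getD_eq_default _ _ (by rw [hlen]; omega)]) (P.input k) ⟨rfl, fun _ _ _ _ => rfl⟩
  exact ⟨t, s, h₁, by omega, h₄.outputs D h₃⟩

end ZiminMatching

theorem mainTheorem2 :
    (∀ (m k : ℕ) (P : ZiminMatching.RankedPattern m), (∀ x, P.rank x ≤ k) →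
      (P.compressedEmbedding = none ↔ P.instances k = ∅) ∧
      (∀ val, P.compressedEmbedding = some val →
        ∃ h, P.IsShortestInstance k h ∧ ∀ x, val x = ZiminMatching.compress (h x)) ∧
      ((P.instances k).Nonempty → (P.instances k).encard = 2 ^ P.totalUnvaluated)) ∧
    (∃ (prog : ZiminMatching.Prog) (C : ℕ),
      ∀ (m k : ℕ) (P : ZiminMatching.RankedPattern m), (∀ x, P.rank x ≤ k) →
        ∃ (t : ℕ) (s : ZiminMatching.State),
          ZiminMatching.Exec (C * (P.pat.length + m * k)) prog (P.input k) t s ∧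
          t ≤ C * (P.pat.length * k) ∧
          s.Outputs P.compressedEmbedding (P.instances k).ncard) :=
  ⟨fun _ _ _ hk => ZiminMatching.RankedPattern.embedding_and_count hk,
    ZiminMatching.embeddingProg, 300, fun _ _ _ hk => ZiminMatching.embeddingProg_correct hk⟩
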